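/- **Setting.** Algorithms are random-access Turing machines with a finite control, finitely many binary work tapes, and random access (by addresses written in binary on work tapes) to a read-only input $x\in\{0,1\}^n$. A *multiple access randomized logspace algorithm* can moreover read the bits of a uniformly random string $r_{ro}$ once each, in order, and the bits of an independent uniformly random string $r_{ma}$ at arbitrary addresses, as often as it likes; on every input of length $n$ and for all values of the random bits it uses $O(\log n)$ work cells and halts within $\mathrm{poly}(n)$ steps with one output bit. It uses at most $m$ multiple access random bits on an input if it only reads $r_{ma}$ at the first $m$ addresses. A *randomized logspace algorithm* is one without access to $r_{ma}$; a *deterministic logspace algorithm* reads neither string. ${\sf G}(n,1/2)$ is the Erdős–Rényi distribution on graphs with vertex set $\{1,\dots,n\}$. ${\sf G}(n,1/2,k)$ is obtained by choosing a uniformly random $K\subseteq\{1,\dots,n\}$ with $|K|=k$, including all edges inside $K$, and including every other edge independently with probability $1/2$. ${\sf clkG}(\ell k,1/2,k)$ is ${\sf G}(\ell k,1/2,k)$ conditioned on $K$ having exactly one vertex in each block $\{(i-1)\ell+1,\dots,i\ell\}$, $1\le i\le k$, and on $1\in K$. For an algorithm $\mathcal A$ put $$s_{\mathcal A}(\ell,k)=\Pr_{A\sim{\sf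 G}(\ell k,1/2)}\big(\mathcal A(\{\ell k,k,A\})=0\big)+\Pr_{A\sim{\sf clkG}(\ell k,1/2,k)}\big(\mathcal A(\{\ell k,k,A\})=1\big),$$ the probabilities being also over the random strings of $\mathcal A$; the input is the number of vertices, the clique size, and the adjacency matrix, written as a bit string. For sequences $\ell,k$, $\mathcal A$ *solves* ${\sf clkPC_D}(\ell\cdot k,k)$ if $s_{\mathcal A}(\ell,k)=1+\Omega(1)$. **clkPC-Conj-Space** is the assertion that for every randomized logspace algorithm $\mathcal A$ and all non-decreasing positive integer sequences $\ell=\omega(1)$ and $k$ with $k=O(\ell^{1-\delta})$ for some constant $\delta>0$, one has $s_{\mathcal A}(\ell,k)=1+o(1)$. **Lemma.** Let $\ell=\omega(1)$, $k$ and $k_s$ be non-decreasing positive integer sequences such that $k=O(\ell^{1-\delta})$ for some constant $\delta>0$ and $k_s\le k$. Assume that some deterministic logspace algorithm, given $\ell\cdot k$ and $k$, computes and stores $k_s$ (using $O(\log \ell)$ bits of space). If clkPC-Conj-Space is true, then no multiple access randomized logspace algorithm that uses at most $\binom{\ell k}{2}$ multiple access random bits on the instances of ${\sf clkPC_D}(\ell\cdot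 k_s,k_s)$ solves ${\sf clkPC_D}(\ell\cdot k_s,k_s)$. -/

import Mathlib

open MeasureTheory ProbabilityTheory Filter Topology Asymptotics

noncomputable section

namespace ClkPC

/-! ### Probabilistic random-access Turing machines -/

/-- The work tapes of the machines are one-way infinite, with cells `0, 1, 2, …`, each of which is
blank (`none`) or holds a bit. -/
structure WorkTape where
  cells : ℕ → Option Bool
  head : ℕ

inductive Dir
  | left
  | stay
  | right

namespace WorkTape

def blank : WorkTape := ⟨fun _ => none, 0⟩

/-- Write a symbol on the scanned cell, then move the head
(a move to the left at the left end of the tape has no effect). -/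
def act (t : WorkTape) (a : Option Bool) (d : Dir) : WorkTape where
  cells := Function.update t.cells t.head a
  head :=
    match d with
    | .left => t.head - 1
    | .stay => t.head
    | .right => t.head + 1

/-- The number whose binary digits, least significant digit first, stand on the cells to the left
of the head. -/
def value (t : WorkTape) : ℕ :=
  ∑ i ∈ Finset.range t.head, if t.cells i = some true then 2 ^ i else 0

/-- What the finite control sees of a tape: the scanned symbol, and whether the head is at the left
end of the tape. -/
def view (t : WorkTape) : Option Bool × Bool := (t.cells t.head, decide (t.head = 0))

end WorkTape

/-- One action of a machine with work tapes indexed by `K` and control states `Q`. -/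
inductive Action (K Q : Type)
  /-- Write on all work tapes, move all heads, and go to a new state. -/
  | work (next : Q) (write : K → Option Bool) (move : K → Dir)
  /-- Read the input bit whose address is the value of work tape `addr`
  (the answer is `none` beyond the end of the input). -/
  | readInput (addr : K) (next : Option Bool → Q)
  /-- Read the multiple access random bit whose address is the value of work tape `addr`. -/
  | readMultiAccess (addr : K) (next : Bool → Q)
  /-- Read the next bit of the read-once random string. -/
  | readOnce (next : Bool → Q)
  /-- Stop, with the given output bit. -/
  | halt (output : Bool)

/-- A (probabilistic, multiple access) random-access Turing machine: a finite control, finitely many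
work tapes, and random access to the read-only input and to the multiple access random bits by
addresses written in binary on the work tapes. -/
structure Machine where
  Tapes : Type
  State : Type
  finite_tapes : Finite Tapes
  finite_state : Finite State
  start : State
  trans : State → (Tapes → Option Bool × Bool) → Action Tapes State

namespace Machine

variable (M : Machine)

structure Config where
  state : M.State
  tapes : M.Tapes → WorkTape
  /-- The number of bits of the read-once random string that have been read. -/
  used : ℕ

def initial : M.Config := ⟨M.start, fun _ => WorkTape.blank, 0⟩

variable {M} in
/-- The action that the machine takes in a configuration. -/
def Config.action (c : M.Config) : Action M.Tapes M.State :=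
  M.trans c.state fun κ => (c.tapes κ).view

/-- One step on input `x`, read-once random string `ro` and multiple access random string `ma`;
configurations in which the machine halts stay as they are. -/
def step (x : List Bool) (ro ma : ℕ → Bool) (c : M.Config) : M.Config :=
  match c.action with
  | .work q w d => { c with state := q, tapes := fun κ => (c.tapes κ).act (w κ) (d κ) }
  | .readInput κ q => { c with state := q (x[(c.tapes κ).value]?) }
  | .readMultiAccess κ q => { c with state := q (ma (c.tapes κ).value) }
  | .readOnce q => { c with state := q (ro c.used), used := c.used + 1 }
  | .halt _ => c

/-- The configuration after `t` steps. -/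
def run (x : List Bool) (ro ma : ℕ → Bool) (t : ℕ) : M.Config :=
  (M.step x ro ma)^[t] M.initial

/-- The machine halts with output bit `b`. -/
def Outputs (x : List Bool) (ro ma : ℕ → Bool) (b : Bool) : Prop :=
  ∃ t, (M.run x ro ma t).action = .halt b

/-- `M` is a multiple access randomized logspace algorithm: on every input of length `n`, whatever
the random bits are, it visits only the first `O(log n)` cells of each of its work tapes, and it
halts within `poly(n)` steps. (Addresses are written on the work tapes and every read takes a step,
so at most `poly(n)` random bits of either kind are used.) -/
def IsMultiAccessLogspace : Prop :=
  ∃ c : ℕ, ∀ (x : List Bool) (ro ma : ℕ → Bool),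
    (∀ t κ, ((M.run x ro ma t).tapes κ).head < c * (Nat.log 2 x.length + 1)) ∧
    ∃ t ≤ c * (x.length + 1) ^ c, ∃ b, (M.run x ro ma t).action = .halt b

/-- The machine has no access to multiple access random bits. -/
def NoMultiAccess : Prop := ∀ q s κ next, M.trans q s ≠ .readMultiAccess κ next

/-- The machine does not read read-once random bits. -/
def NoReadOnce : Prop := ∀ q s next, M.trans q s ≠ .readOnce next

/-- Randomized logspace algorithms: read-once random bits only. -/
def IsRandomizedLogspace : Prop := M.IsMultiAccessLogspace ∧ M.NoMultiAccess

/-- Deterministic logspace algorithms. -/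
def IsDeterministicLogspace : Prop :=
  M.IsMultiAccessLogspace ∧ M.NoMultiAccess ∧ M.NoReadOnce

/-- On input `x`, the multiple access random string is only ever read at addresses below `m`, that
is, `M` uses a multiple access random string of length at most `m`. -/
def UsesAtMost (x : List Bool) (m : ℕ) : Prop :=
  ∀ (ro ma : ℕ → Bool) (t : ℕ) (κ : M.Tapes) (next : Bool → M.State),
    (M.run x ro ma t).action = .readMultiAccess κ next →
      ((M.run x ro ma t).tapes κ).value < m

/-- On input `x`, `M` halts with the number `y` stored in binary on its work tape `out`. -/
def Stores (out : M.Tapes) (x : List Bool) (y : ℕ) : Prop :=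
  ∀ ro ma : ℕ → Bool, ∃ t b,
    (M.run x ro ma t).action = .halt b ∧ ((M.run x ro ma t).tapes out).value = y

end Machine

/-! ### Encodings -/

/-- The pair of numbers `N`, `k` as a bit string: `N` ones, a zero, `k` ones, a zero. -/
def encodePair (N k : ℕ) : List Bool :=
  List.replicate N true ++ false :: (List.replicate k true ++ [false])

open Classical in
/-- The `n²` bits of the adjacency matrix of `G`, row by row. -/
def adjacencyBits {n : ℕ} (G : SimpleGraph (Fin n)) : List Bool :=
  List.ofFn fun i : Fin (n * n) => decide (G.Adj i.divNat i.modNat)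

/-- The triple (number of vertices, size of the planted clique, adjacency matrix) as a bit string.
Its length is `n² + n + k + 2`. -/
def encodeInstance {n : ℕ} (k : ℕ) (G : SimpleGraph (Fin n)) : List Bool :=
  encodePair n k ++ adjacencyBits G

/-- The number sequence `y` can be computed and stored in deterministic logarithmic space from the
pairs `N j`, `k j`. -/
def ComputableInLogspace (N k y : ℕ → ℕ) : Prop :=
  ∃ M : Machine, M.IsDeterministicLogspace ∧
    ∃ out : M.Tapes, ∀ j, M.Stores out (encodePair (N j) (k j)) (y j)

/-! ### Random graphs -/

/-- The complete graph on the vertices in `K`; the other vertices are isolated. -/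
def cliqueOn {n : ℕ} (K : Finset (Fin n)) : SimpleGraph (Fin n) where
  Adj u v := u ≠ v ∧ u ∈ K ∧ v ∈ K
  symm := ⟨fun _ _ h => ⟨h.1.symm, h.2.2, h.2.1⟩⟩
  loopless := ⟨fun _ h => h.1 rfl⟩

/-- The Erdős–Rényi distribution `G(n, 1/2)`. -/
def erdosRenyi (n : ℕ) : Measure (SimpleGraph (Fin n)) :=
  SimpleGraph.binomialRandom (Fin n) ⟨1 / 2, by norm_num, by norm_num⟩

/-- The joint distribution of the planted vertex set `K` (uniform among the sets of size `k`) and of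
the graph obtained from `G(n, 1/2)` by adding all edges inside `K`; the second marginal is the
planted clique distribution `G(n, 1/2, k)`. -/
def plantedPair (n k : ℕ) : Measure (Finset (Fin n) × SimpleGraph (Fin n)) :=
  ((uniformOn {K : Finset (Fin n) | K.card = k}).prod (erdosRenyi n)).map
    fun p => (p.1, p.2 ⊔ cliqueOn p.1)

/-- `plantedPair` conditioned on there being exactly one planted vertex in each of the `k`
consecutive blocks of `ℓ` vertices. Vertices are numbered from `0`. -/
def kPartitePair (ℓ k : ℕ) : Measure (Finset (Fin (ℓ * k)) × SimpleGraph (Fin (ℓ * k))) :=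
  cond (plantedPair (ℓ * k) k)
    {p | ∀ i < k, ∃! v : Fin (ℓ * k), v ∈ p.1 ∧ i * ℓ ≤ v.val ∧ v.val < (i + 1) * ℓ}

/-- `kPartitePair` conditioned on the first vertex being planted. -/
def cliqueLeakagePair (ℓ k : ℕ) : Measure (Finset (Fin (ℓ * k)) × SimpleGraph (Fin (ℓ * k))) :=
  cond (kPartitePair ℓ k) {p | ∃ v ∈ p.1, v.val = 0}

/-- The clique leakage `k`-partite planted clique distribution `clkG(ℓ·k, 1/2, k)` on graphs. -/
def cliqueLeakage (ℓ k : ℕ) : Measure (SimpleGraph (Fin (ℓ * k))) :=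
  (cliqueLeakagePair ℓ k).map Prod.snd

/-! ### The detection problem -/

/-- An infinite sequence of independent uniform random bits. -/
def coins : Measure (ℕ → Bool) :=
  Measure.infinitePi fun _ => (PMF.uniformOfFintype Bool).toMeasure

/-- The probability that `M` outputs `b` on the triple `(n, k, G)`, over `G ∼ μ` and independent
uniform read-once and multiple access random bits. -/
def outputProb (M : Machine) {n : ℕ} (k : ℕ) (μ : Measure (SimpleGraph (Fin n))) (b : Bool) : ℝ :=
  (μ.prod (coins.prod coins)).real
    {ω | M.Outputs (encodeInstance k ω.1) ω.2.1 ω.2.2 b}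

/-- `ℙ(M = 0)` under the null distribution `G(ℓ·k, 1/2)` plus `ℙ(M = 1)` under
`clkG(ℓ·k, 1/2, k)`. -/
def successSum (M : Machine) (ℓ k : ℕ) : ℝ :=
  outputProb M k (erdosRenyi (ℓ * k)) false + outputProb M k (cliqueLeakage ℓ k) true

/-- `M` solves the detection problem `clkPC_D(ℓ·k, k)`: the success sum is `1 + Ω(1)`. -/
def Solves (M : Machine) (ℓ k : ℕ → ℕ) : Prop :=
  ∃ ε : ℝ, 0 < ε ∧ ∀ᶠ j in atTop, 1 + ε ≤ successSum M (ℓ j) (k j)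

/-- Non-decreasing sequences of positive integers. -/
def IsParam (a : ℕ → ℕ) : Prop := Monotone a ∧ ∀ j, 0 < a j

/-- `k = O(ℓ^(1-δ))` for some constant `δ > 0`. -/
def IsSublinear (k ℓ : ℕ → ℕ) : Prop :=
  ∃ δ : ℝ, 0 < δ ∧ (fun j => (k j : ℝ)) =O[atTop] fun j => (ℓ j : ℝ) ^ (1 - δ)

/-- The clique leakage logspace `k`-partite planted clique conjecture: for every randomized logspace
algorithm and all such parameter sequences, the success sum is `1 + o(1)`. -/
def ClkPCConjSpace : Prop :=
  ∀ M : Machine, M.IsRandomizedLogspace →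
    ∀ ℓ k : ℕ → ℕ, IsParam ℓ → IsParam k → Tendsto ℓ atTop atTop → IsSublinear k ℓ →
      Tendsto (fun j => successSum M (ℓ j) (k j)) atTop (𝓝 1)

end ClkPC

end

/-!
The algorithm `S` is turned into an algorithm `M` without multiple access random bits, to which the
conjecture is applied with clique size `8 * k` and the same block length `ℓ`. Let `N = ℓ * k`, so
that the instances of `M` have `8 * N` vertices. On such an instance, `M` runs `S` on the subgraph
induced by the first `ℓ * ks` vertices, with `ks` computed by the given deterministic algorithm.
Restricting a uniformly random graph, or a uniformly random planted set with one vertex per block,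
to the first blocks gives a uniformly random object of the same kind (`expect_comap`,
`expect_restrictSet`); so the simulated instance has the correct distribution.

The multiple access random bits of `S` are entries of the adjacency matrix that the simulated
instance does not contain. In a planted graph, entries between planted vertices are useless, but
here the clique leakage helps: the first vertex is planted, hence its non-neighbours are not. The
bits are the entries in row `u` and column `7 * N + v`, where `u` runs through the non-neighbours of
the first vertex among `N, …, 7 * N - 1`, and `v < N` (`graphBits`). Toggling the corresponding
edges neither changes which rows are used nor the simulated instance. Therefore the bits are uniform
and independent of the instance as long as there are at least `N` such rows (`sum_good`), and then
there are `N ^ 2 ≥ N.choose 2` bits. By a second moment estimate there are fewer rows with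
probability at most `1 / N` only (`card_bad`). Altogether the success sum of `S` exceeds that of `M`
by at most `2 / ℓ` (`successSum_le`), which tends to zero.

It remains to see that `M` is a randomized logspace algorithm (`Machine.exists_simulator`,
`Machine.exists_reduction`). Machines are obtained by compiling structured programs (`Cmd`,
`Cmd.compile_run`), which keep numbers in binary counters. `M` simulates the composition of the two
given algorithms step by step, recomputing each requested input bit or multiple access bit from its
address: the entry of the matrix is found by a walk through the rows (`scanVal`). Only space and
termination have to be checked. A machine that stays in logarithmic space and halts for all random
strings runs in polynomial time: if it came back to an earlier state with the same tapes, then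
repeating the read-once bits of the loop would keep it running forever
(`Machine.isRandomizedLogspace_of_space`).
-/

noncomputable section

namespace ClkPC

/-! ### A structured programming language for the machines -/

/-- What a command sees of all tapes. -/
abbrev Views (K : Type) := K → Option Bool × Bool

/-- Structured programs over work tapes indexed by `K`, with a finite store `F` for the information
that the compiled machine keeps in its finite control. Tests may look at the store and at the views
of all tapes. -/
inductive Cmd (K F : Type) : Type
  | work (f : F → Views K → F × (K → Option Bool) × (K → Dir))
  | readInput (κ : K) (f : F → Views K → Option Bool → F)
  | readOnce (f : F → Views K → Bool → F)
  | seq (P Q : Cmd K F)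
  | ite (c : F → Views K → Bool) (P Q : Cmd K F)
  | loop (c : F → Views K → Bool) (P : Cmd K F)

/-- The memory on which commands act. -/
@[ext] structure Mem (K F : Type) where
  store : F
  tapes : K → WorkTape
  used : ℕ

namespace Mem

variable {K F : Type}

def views (m : Mem K F) : Views K := fun κ => (m.tapes κ).view

/-- All heads are within the first `H + 1` cells. -/
def Bdd (H : ℕ) (m : Mem K F) : Prop := ∀ κ, (m.tapes κ).head ≤ H

/-- The effect of a single working step. -/
def doWork (m : Mem K F) (a : F × (K → Option Bool) × (K → Dir)) : Mem K F :=
  ⟨a.1, fun κ => (m.tapes κ).act (a.2.1 κ) (a.2.2 κ), m.used⟩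

end Mem

/-- Big-step semantics of commands on input `x` with read-once string `ro`, recording that no head
ever goes beyond cell `H`. -/
inductive Exec {K F : Type} (x : List Bool) (ro : ℕ → Bool) (H : ℕ) :
    Cmd K F → Mem K F → Mem K F → Prop
  | work {f m} (hb : (m.doWork (f m.store m.views)).Bdd H) :
      Exec x ro H (.work f) m (m.doWork (f m.store m.views))
  | readInput {κ f m} :
      Exec x ro H (.readInput κ f) m ⟨f m.store m.views (x[(m.tapes κ).value]?), m.tapes, m.used⟩
  | readOnce {f m} :
      Exec x ro H (.readOnce f) m ⟨f m.store m.views (ro m.used), m.tapes, m.used + 1⟩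
  | seq {P Q m m' m''} (h₁ : Exec x ro H P m m') (h₂ : Exec x ro H Q m' m'') :
      Exec x ro H (.seq P Q) m m''
  | ite_true {c P Q m m'} (hc : c m.store m.views = true) (h : Exec x ro H P m m') :
      Exec x ro H (.ite c P Q) m m'
  | ite_false {c P Q m m'} (hc : c m.store m.views = false) (h : Exec x ro H Q m m') :
      Exec x ro H (.ite c P Q) m m'
  | loop_false {c P m} (hc : c m.store m.views = false) :
      Exec x ro H (.loop c P) m m
  | loop_true {c P m m' m''} (hc : c m.store m.views = true) (h₁ : Exec x ro H P m m')
      (h₂ : Exec x ro H (.loop c P) m' m'') : Exec x ro H (.loop c P) m m''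

/-! ### Compilation to machines -/

namespace Cmd

variable {K F : Type}

/-- The continuations (stacks of pending commands) that occur while `P` is executed before the
continuation `k`. -/
def conts : Cmd K F → List (Cmd K F) → Set (List (Cmd K F))
  | work f, k => {work f :: k}
  | readInput κ f, k => {readInput κ f :: k}
  | readOnce f, k => {readOnce f :: k}
  | seq P Q, k => {seq P Q :: k} ∪ (conts P (Q :: k) ∪ conts Q k)
  | ite c P Q, k => {ite c P Q :: k} ∪ (conts P k ∪ conts Q k)
  | loop c P, k => {loop c P :: k} ∪ conts P (loop c P :: k)

/-- The continuations that may follow a given one after a single step. -/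
def succs : List (Cmd K F) → Set (List (Cmd K F))
  | [] => ∅
  | work _ :: k => {k}
  | readInput _ _ :: k => {k}
  | readOnce _ :: k => {k}
  | seq P Q :: k => {P :: Q :: k}
  | ite _ P Q :: k => {P :: k, Q :: k}
  | loop c P :: k => {P :: loop c P :: k, k}

lemma finite_conts (P : Cmd K F) : ∀ k, (P.conts k).Finite := by
  induction P with
  | work | readInput | readOnce => intro k; simp [conts]
  | seq P Q hP hQ => intro k; exact (Set.finite_singleton _).union ((hP _).union (hQ _))
  | ite c P Q hP hQ => intro k; exact (Set.finite_singleton _).union ((hP _).union (hQ _))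
  | loop c P hP => intro k; exact (Set.finite_singleton _).union (hP _)

lemma cons_mem_conts (P : Cmd K F) (k : List (Cmd K F)) : P :: k ∈ P.conts k := by
  cases P <;> simp [conts]

/-- Steps stay within the continuations of `P`, until the continuation `k` of `P` itself is reached.
-/
lemma succs_subset_conts (P : Cmd K F) :
    ∀ k, ∀ l ∈ P.conts k, succs l ⊆ P.conts k ∪ {k} := by
  induction P with
  | work | readInput | readOnce =>
    rintro k l hl
    simp only [conts, Set.mem_singleton_iff] at hl
    subst hl
    simp [succs]
  | seq P Q hP hQ =>
    rintro k l (hl | hl | hl)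
    · simp only [Set.mem_singleton_iff] at hl
      subst hl
      simp only [succs, Set.singleton_subset_iff]
      exact Or.inl (Or.inr (Or.inl (cons_mem_conts _ _)))
    · refine (hP _ l hl).trans ?_
      rintro l' (h | h)
      · exact Or.inl (Or.inr (Or.inl h))
      · simp only [Set.mem_singleton_iff] at h
        subst h
        exact Or.inl (Or.inr (Or.inr (cons_mem_conts _ _)))
    · refine (hQ _ l hl).trans ?_
      rintro l' (h | h)
      · exact Or.inl (Or.inr (Or.inr h))
      · exact Or.inr h
  | ite c P Q hP hQ =>
    rintro k l (hl | hl | hl)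
    · simp only [Set.mem_singleton_iff] at hl
      subst hl
      rintro l' (h | h)
      · subst h; exact Or.inl (Or.inr (Or.inl (cons_mem_conts _ _)))
      · simp only [Set.mem_singleton_iff] at h
        subst h; exact Or.inl (Or.inr (Or.inr (cons_mem_conts _ _)))
    · refine (hP _ l hl).trans ?_
      rintro l' (h | h)
      · exact Or.inl (Or.inr (Or.inl h))
      · exact Or.inr h
    · refine (hQ _ l hl).trans ?_
      rintro l' (h | h)
      · exact Or.inl (Or.inr (Or.inr h))
      · exact Or.inr h
  | loop c P hP =>
    rintro k l (hl | hl)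
    · simp only [Set.mem_singleton_iff] at hl
      subst hl
      rintro l' (h | h)
      · subst h; exact Or.inl (Or.inr (cons_mem_conts _ _))
      · exact Or.inr h
    · refine (hP _ l hl).trans ?_
      rintro l' (h | h)
      · exact Or.inl (Or.inr h)
      · simp only [Set.mem_singleton_iff] at h
        subst h; exact Or.inl (cons_mem_conts _ _)

/-- The set of all continuations that occur in a run of the program `P`. -/
def points (P : Cmd K F) : Set (List (Cmd K F)) := P.conts [] ∪ {[]}

lemma finite_points (P : Cmd K F) : P.points.Finite :=
  (P.finite_conts []).union (Set.finite_singleton _)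

lemma succs_subset_points (P : Cmd K F) (l : List (Cmd K F)) (hl : l ∈ P.points) :
    succs l ⊆ P.points := by
  rcases hl with hl | hl
  · exact P.succs_subset_conts [] l hl
  · simp only [Set.mem_singleton_iff] at hl
    subst hl
    simp [succs]

/-- The step taken by the compiled machine at a continuation. At the empty continuation the machine
halts with output `out σ`. -/
def actionAt (out : F → Bool) : List (Cmd K F) → F → Views K → Action K (F × List (Cmd K F))
  | [], σ, _ => .halt (out σ)
  | work f :: k, σ, v => .work ((f σ v).1, k) (f σ v).2.1 (f σ v).2.2
  | readInput κ f :: k, σ, v => .readInput κ fun b => (f σ v b, k)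
  | readOnce f :: k, σ, v => .readOnce fun b => (f σ v b, k)
  | seq P Q :: k, σ, v => .work (σ, P :: Q :: k) (fun κ => (v κ).1) fun _ => .stay
  | ite c P Q :: k, σ, v =>
      .work (σ, if c σ v then P :: k else Q :: k) (fun κ => (v κ).1) fun _ => .stay
  | loop c P :: k, σ, v =>
      .work (σ, if c σ v then P :: loop c P :: k else k) (fun κ => (v κ).1) fun _ => .stay

end Cmd

/-- Renaming the states in an action. -/
def Action.mapState {K Q Q' : Type} (g : Q → Q') : Action K Q → Action K Q'
  | .work q w d => .work (g q) w d
  | .readInput κ n => .readInput κ fun b => g (n b)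
  | .readMultiAccess κ n => .readMultiAccess κ fun b => g (n b)
  | .readOnce n => .readOnce fun b => g (n b)
  | .halt b => .halt b

namespace Cmd

variable {K F : Type}

open Classical in
/-- A continuation as a program point of `P` (with the junk value `[]` for lists that are no program
points). -/
def toPoint (P : Cmd K F) (l : List (Cmd K F)) : P.points :=
  if h : l ∈ P.points then ⟨l, h⟩ else ⟨[], Or.inr rfl⟩

lemma toPoint_val {P : Cmd K F} {l : List (Cmd K F)} (h : l ∈ P.points) :
    (P.toPoint l).1 = l := by
  simp [toPoint, h]

variable [Finite K] [Finite F]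

/-- The machine that executes `P` from the store `σ₀` and then halts with output `out σ`. -/
def compile (P : Cmd K F) (σ₀ : F) (out : F → Bool) : Machine where
  Tapes := K
  State := F × P.points
  finite_tapes := inferInstance
  finite_state := by
    have := P.finite_points.to_subtype
    infer_instance
  start := (σ₀, P.toPoint [P])
  trans q v := (actionAt out q.2.1 q.1 v).mapState fun a => (a.1, P.toPoint a.2)

variable (P : Cmd K F) (σ₀ : F) (out : F → Bool)

/-- The machine configuration with memory `m` and continuation `l`. -/
def cfg (l : List (Cmd K F)) (m : Mem K F) : (P.compile σ₀ out).Config :=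
  ⟨(m.store, P.toPoint l), m.tapes, m.used⟩

lemma action_cfg {l : List (Cmd K F)} (h : l ∈ P.points) (m : Mem K F) :
    (cfg P σ₀ out l m).action =
      (actionAt out l m.store m.views).mapState fun a => (a.1, P.toPoint a.2) := by
  simp only [Machine.Config.action, compile, cfg, toPoint_val h]
  rfl

lemma noMultiAccess_compile : (P.compile σ₀ out).NoMultiAccess := by
  intro q s κ next
  simp only [compile]
  rcases q with ⟨σ, ⟨l, hl⟩⟩
  rcases l with _ | ⟨_ | _ | _ | _ | _ | _, k⟩ <;> simp [actionAt, Action.mapState]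

end Cmd

lemma WorkTape.act_stay (t : WorkTape) : t.act (t.view.1) .stay = t := by
  simp [act, view]

namespace Machine

variable {M : Machine} {x : List Bool} {ro ma : ℕ → Bool} {H : ℕ}

/-- `c'` is reached from `c` without any head going beyond cell `H`. -/
def Reaches (M : Machine) (x : List Bool) (ro ma : ℕ → Bool) (H : ℕ) (c c' : M.Config) : Prop :=
  ∃ t, (M.step x ro ma)^[t] c = c' ∧
    ∀ i ≤ t, ∀ κ, (((M.step x ro ma)^[i] c).tapes κ).head ≤ H

lemma Reaches.trans {c c' c'' : M.Config} (h : M.Reaches x ro ma H c c')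
    (h' : M.Reaches x ro ma H c' c'') : M.Reaches x ro ma H c c'' := by
  obtain ⟨t, ht, hb⟩ := h
  obtain ⟨t', ht', hb'⟩ := h'
  refine ⟨t' + t, by rw [Function.iterate_add_apply, ht, ht'], fun i hi κ => ?_⟩
  rcases le_total i t with hit | hit
  · exact hb i hit κ
  · obtain ⟨j, rfl⟩ := Nat.exists_eq_add_of_le' hit
    rw [Function.iterate_add_apply, ht]
    exact hb' j (by omega) κ

lemma Reaches.single {c : M.Config} (h : ∀ κ, (c.tapes κ).head ≤ H)
    (h' : ∀ κ, ((M.step x ro ma c).tapes κ).head ≤ H) :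
    M.Reaches x ro ma H c (M.step x ro ma c) := by
  refine ⟨1, rfl, fun i hi κ => ?_⟩
  interval_cases i
  · exact h κ
  · exact h' κ

end Machine

namespace Cmd

variable {K F : Type} (P₀ : Cmd K F) {x : List Bool} {ro : ℕ → Bool} {H : ℕ}

lemma _root_.ClkPC.Exec.bdd {P : Cmd K F} {m m' : Mem K F} (h : Exec x ro H P m m')
    (hm : m.Bdd H) : m'.Bdd H := by
  induction h with
  | work hb => exact hb
  | readInput | readOnce => exact hm
  | seq _ _ h₁ h₂ => exact h₂ (h₁ hm)
  | ite_true _ _ h | ite_false _ _ h => exact h hm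
  | loop_false => exact hm
  | loop_true _ _ _ h₁ h₂ => exact h₂ (h₁ hm)

/-- If a command is pending at a program point, then what remains after it is a program point as
well. -/
lemma mem_points_of_cons {P : Cmd K F} :
    ∀ {k}, P :: k ∈ P₀.points → k ∈ P₀.points := by
  induction P with
  | work | readInput | readOnce =>
    intro k h
    exact P₀.succs_subset_points _ h (by simp [succs])
  | seq P Q hP hQ =>
    intro k h
    exact hQ (hP (P₀.succs_subset_points _ h (by simp [succs])))
  | ite c P Q hP hQ =>
    intro k h
    exact hQ (P₀.succs_subset_points _ h (by simp [succs]))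
  | loop c P hP =>
    intro k h
    exact P₀.succs_subset_points _ h (by simp [succs])

variable [Finite K] [Finite F] (σ₀ : F) (out : F → Bool)

lemma step_eq_of_stay (ma : ℕ → Bool) {l l' : List (Cmd K F)} {m : Mem K F} (h : l ∈ P₀.points)
    (ha : actionAt out l m.store m.views =
      .work (m.store, l') (fun κ => (m.views κ).1) fun _ => .stay) :
    (P₀.compile σ₀ out).step x ro ma (cfg P₀ σ₀ out l m) = cfg P₀ σ₀ out l' m := by
  rw [Machine.step, action_cfg P₀ σ₀ out h, ha]
  simp only [Action.mapState, cfg, Mem.views]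
  congr 1
  funext κ
  exact WorkTape.act_stay _

/-- Correctness of the compilation: a terminating execution of `P` takes the machine from the
program point at which `P` is pending to the one at which only the continuation `k` is left. The
multiple access string `ma` plays no role, since compiled machines never read it. -/
lemma reaches_of_exec (ma : ℕ → Bool) {P : Cmd K F} {m m' : Mem K F} (h : Exec x ro H P m m') :
    ∀ k, m.Bdd H → P :: k ∈ P₀.points →
      (P₀.compile σ₀ out).Reaches x ro ma H (cfg P₀ σ₀ out (P :: k) m) (cfg P₀ σ₀ out k m') := by
  induction h with
  | @work f m hb =>
    intro k hm hk
    have : (P₀.compile σ₀ out).step x ro ma (cfg P₀ σ₀ out (.work f :: k) m) =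
        cfg P₀ σ₀ out k (m.doWork (f m.store m.views)) := by
      rw [Machine.step, action_cfg P₀ σ₀ out hk]
      rfl
    rw [← this]
    refine .single hm ?_
    rw [this]
    exact hb
  | @readInput κ f m =>
    intro k hm hk
    have : (P₀.compile σ₀ out).step x ro ma (cfg P₀ σ₀ out (.readInput κ f :: k) m) =
        cfg P₀ σ₀ out k ⟨f m.store m.views (x[(m.tapes κ).value]?), m.tapes, m.used⟩ := by
      rw [Machine.step, action_cfg P₀ σ₀ out hk]
      rfl
    rw [← this]
    refine .single hm ?_
    rw [this]
    exact hm
  | @readOnce f m =>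
    intro k hm hk
    have : (P₀.compile σ₀ out).step x ro ma (cfg P₀ σ₀ out (.readOnce f :: k) m) =
        cfg P₀ σ₀ out k ⟨f m.store m.views (ro m.used), m.tapes, m.used + 1⟩ := by
      rw [Machine.step, action_cfg P₀ σ₀ out hk]
      rfl
    rw [← this]
    refine .single hm ?_
    rw [this]
    exact hm
  | @seq P Q m m' m'' h₁ h₂ ih₁ ih₂ =>
    intro k hm hk
    have hk' : P :: Q :: k ∈ P₀.points := P₀.succs_subset_points _ hk (by simp [succs])
    have hs := step_eq_of_stay P₀ σ₀ out (x := x) (ro := ro) (l' := P :: Q :: k) ma (m := m) hk rfl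
    refine Machine.Reaches.trans (c' := cfg P₀ σ₀ out (P :: Q :: k) m) ?_
      ((ih₁ _ hm hk').trans (ih₂ _ (h₁.bdd hm) (mem_points_of_cons P₀ hk')))
    rw [← hs]
    exact .single hm (by rw [hs]; exact hm)
  | @ite_true c P Q m m' hc h ih =>
    intro k hm hk
    have hs := step_eq_of_stay P₀ σ₀ out (x := x) (ro := ro) (l' := P :: k) ma (m := m) hk
      (by simp [actionAt, hc])
    refine Machine.Reaches.trans (c' := cfg P₀ σ₀ out (P :: k) m) ?_
      (ih _ hm (P₀.succs_subset_points _ hk (by simp [succs])))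
    rw [← hs]
    exact .single hm (by rw [hs]; exact hm)
  | @ite_false c P Q m m' hc h ih =>
    intro k hm hk
    have hs := step_eq_of_stay P₀ σ₀ out (x := x) (ro := ro) (l' := Q :: k) ma (m := m) hk
      (by simp [actionAt, hc])
    refine Machine.Reaches.trans (c' := cfg P₀ σ₀ out (Q :: k) m) ?_
      (ih _ hm (P₀.succs_subset_points _ hk (by simp [succs])))
    rw [← hs]
    exact .single hm (by rw [hs]; exact hm)
  | @loop_false c P m hc =>
    intro k hm hk
    have hs := step_eq_of_stay P₀ σ₀ out (x := x) (ro := ro) (l' := k) ma (m := m) hk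
      (by simp [actionAt, hc])
    rw [← hs]
    exact .single hm (by rw [hs]; exact hm)
  | @loop_true c P m m' m'' hc h₁ h₂ ih₁ ih₂ =>
    intro k hm hk
    have hk' : P :: .loop c P :: k ∈ P₀.points := P₀.succs_subset_points _ hk (by simp [succs])
    have hs := step_eq_of_stay P₀ σ₀ out (x := x) (ro := ro) (l' := P :: .loop c P :: k) ma (m := m)
      hk (by simp [actionAt, hc])
    refine Machine.Reaches.trans (c' := cfg P₀ σ₀ out (P :: .loop c P :: k) m) ?_
      ((ih₁ _ hm hk').trans (ih₂ _ (h₁.bdd hm) hk))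
    rw [← hs]
    exact .single hm (by rw [hs]; exact hm)

end Cmd

namespace Machine

variable {M : Machine} {x : List Bool} {ro ma : ℕ → Bool}

lemma step_of_halt {c : M.Config} {b : Bool} (h : c.action = .halt b) :
    M.step x ro ma c = c := by
  rw [step, h]

lemma iterate_step_of_halt {c : M.Config} {b : Bool} (h : c.action = .halt b) (t : ℕ) :
    (M.step x ro ma)^[t] c = c :=
  Function.iterate_fixed (step_of_halt h) t

lemma run_eq_of_halt {t : ℕ} {b : Bool} (h : (M.run x ro ma t).action = .halt b) {t' : ℕ}
    (ht : t ≤ t') : M.run x ro ma t' = M.run x ro ma t := by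
  obtain ⟨j, rfl⟩ := Nat.exists_eq_add_of_le' ht
  rw [run, Function.iterate_add_apply]
  exact iterate_step_of_halt h j

lemma Outputs.unique {b b' : Bool} (h : M.Outputs x ro ma b) (h' : M.Outputs x ro ma b') :
    b = b' := by
  obtain ⟨t, ht⟩ := h
  obtain ⟨t', ht'⟩ := h'
  have := congrArg Config.action ((run_eq_of_halt ht (le_max_left t t')).symm.trans
    (run_eq_of_halt ht' (le_max_right t t')))
  rw [ht, ht'] at this
  exact Action.halt.inj this

end Machine

/-- The memory in which a compiled program starts. -/
def Mem.init {K F : Type} (σ₀ : F) : Mem K F := ⟨σ₀, fun _ => WorkTape.blank, 0⟩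

/-- A terminating execution of `P` from blank tapes determines the output of the compiled machine
and bounds its space. All later statements about compiled machines are derived from this one. -/
lemma Cmd.compile_run {K F : Type} [Finite K] [Finite F] (P : Cmd K F) (σ₀ : F) (out : F → Bool)
    {x : List Bool} {ro : ℕ → Bool} {H : ℕ} {m : Mem K F} (h : Exec x ro H P (Mem.init σ₀) m)
    (ma : ℕ → Bool) :
    (P.compile σ₀ out).Outputs x ro ma (out m.store) ∧
      ∀ t κ, (((P.compile σ₀ out).run x ro ma t).tapes κ).head ≤ H := by
  have hP : [P] ∈ P.points := Or.inl (P.cons_mem_conts [])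
  have h0 : (Mem.init σ₀ : Mem K F).Bdd H := fun κ => Nat.zero_le _
  obtain ⟨t, ht, hb⟩ := reaches_of_exec P σ₀ out ma h [] h0 hP
  have hrun : (P.compile σ₀ out).run x ro ma t = cfg P σ₀ out [] m := ht
  have hhalt : ((P.compile σ₀ out).run x ro ma t).action = .halt (out m.store) := by
    rw [hrun, action_cfg P σ₀ out (Or.inr rfl)]
    rfl
  refine ⟨⟨t, hhalt⟩, fun t' κ => ?_⟩
  rcases le_total t' t with htt | htt
  · exact hb t' htt κ
  · rw [Machine.run_eq_of_halt hhalt htt]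
    exact hb t le_rfl κ

namespace Machine

/-! ### Logarithmic space and termination imply polynomial time -/

variable {M : Machine} {x : List Bool} {ro ro' ma : ℕ → Bool}

/-- The next step reads a read-once bit. -/
def Config.Reads (c : M.Config) : Prop := ∃ next, c.action = .readOnce next

open Classical in
/-- A machine without multiple access bits depends on the read-once string, and on the number of
bits read so far, only through the bit that the step reads. -/
lemma step_congr (hM : M.NoMultiAccess) {c c' : M.Config} (hs : c.state = c'.state)
    (ht : c.tapes = c'.tapes) (hr : c.Reads → ro c.used = ro' c'.used) :
    (M.step x ro ma c).state = (M.step x ro' ma c').state ∧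
      (M.step x ro ma c).tapes = (M.step x ro' ma c').tapes ∧
      (M.step x ro' ma c').used = c'.used + if c.Reads then 1 else 0 := by
  have ha : c'.action = c.action := by simp only [Config.action, hs, ht]
  have hno : ∀ κ n, c.action ≠ .readMultiAccess κ n := fun κ n => hM _ _ _ _
  rw [step, step, ha]
  cases h : c.action with
  | work q w d => simp [Config.Reads, h, ht]
  | readInput κ q => simp [Config.Reads, h, ht]
  | readMultiAccess κ q => exact absurd h (hno _ _)
  | readOnce q =>
    have : c.Reads := ⟨_, h⟩
    simp [this, ht, hr this]
  | halt b => simp [Config.Reads, h, ht, hs]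

lemma run_succ (t : ℕ) : M.run x ro ma (t + 1) = M.step x ro ma (M.run x ro ma t) := by
  rw [run, Function.iterate_succ_apply', run]

open Classical in
/-- If a machine without multiple access bits returns to an earlier state and earlier tapes, then
reading the bits of the loop over and over again keeps it running forever. -/
lemma exists_run_of_loop (hM : M.NoMultiAccess) {i j : ℕ} (hij : i < j)
    (hs : (M.run x ro ma i).state = (M.run x ro ma j).state)
    (ht : (M.run x ro ma i).tapes = (M.run x ro ma j).tapes) :
    ∃ ro', ∀ t, ∃ s < j, (M.run x ro' ma t).action = (M.run x ro ma s).action := by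
  -- `p t` is the time of the given run that corresponds to the time `t` of the looping run
  let p : ℕ → ℕ := fun t => Nat.rec 0 (fun _ s => if s + 1 = j then i else s + 1) t
  have hp : ∀ t, p (t + 1) = if p t + 1 = j then i else p t + 1 := fun t => rfl
  have hpj : ∀ t, p t < j := by
    intro t
    induction t with
    | zero => exact Nat.zero_lt_of_lt hij
    | succ t ih => rw [hp]; split_ifs <;> omega
  let c : ℕ → M.Config := fun t => M.run x ro ma (p t)
  -- `u t` is the number of bits read by the looping run before the time `t`; it has
  -- different values at different reading times, so the bits of the new string can be prescribed
  -- independently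
  let u : ℕ → ℕ := fun t => Nat.rec 0 (fun t s => s + if (c t).Reads then 1 else 0) t
  have hu : ∀ t, u (t + 1) = u t + if (c t).Reads then 1 else 0 := fun t => rfl
  have humono : Monotone u := monotone_nat_of_le_succ fun t => by rw [hu]; omega
  have huinj : ∀ t t', (c t).Reads → (c t').Reads → u t = u t' → t = t' := by
    have key : ∀ t t', (c t).Reads → t < t' → u t < u t' := fun t t' h hlt => by
      have h1 := humono (Nat.succ_le_of_lt hlt)
      rw [Nat.succ_eq_add_one, hu, if_pos h] at h1
      omega
    intro t t' h h' he
    rcases lt_trichotomy t t' with hlt | rfl | hlt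
    · exact absurd he (key t t' h hlt).ne
    · rfl
    · exact absurd he (key t' t h' hlt).ne'
  obtain ⟨ro', hro'⟩ : ∃ ro' : ℕ → Bool, ∀ t, (c t).Reads → ro (c t).used = ro' (u t) := by
    refine ⟨fun n => decide (∃ t, (c t).Reads ∧ u t = n ∧ ro (c t).used = true), fun t h => ?_⟩
    rw [Bool.eq_iff_iff, decide_eq_true_iff]
    refine ⟨fun hb => ⟨t, h, rfl, hb⟩, ?_⟩
    rintro ⟨t', h', he, hb⟩
    rwa [huinj _ _ h h' he.symm]
  have hinv : ∀ t, (c t).state = (M.run x ro' ma t).state ∧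
      (c t).tapes = (M.run x ro' ma t).tapes ∧ (M.run x ro' ma t).used = u t := by
    intro t
    induction t with
    | zero => exact ⟨rfl, rfl, rfl⟩
    | succ t ih =>
      obtain ⟨h1, h2, h3⟩ := ih
      obtain ⟨g1, g2, g3⟩ := step_congr (x := x) (ma := ma) hM h1 h2
        (fun h => by rw [h3]; exact hro' t h)
      rw [run_succ, ← g1, ← g2, g3, h3, hu]
      have hc : M.step x ro ma (c t) = M.run x ro ma (p t + 1) := (run_succ _).symm
      rw [hc]
      simp only [c, hp]
      split_ifs with h
      · rw [h]; exact ⟨hs, ht, trivial⟩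
      · exact ⟨rfl, rfl, trivial⟩
  refine ⟨ro', fun t => ⟨p t, hpj t, ?_⟩⟩
  simp only [Config.action, ← (hinv t).1, ← (hinv t).2.1]
  rfl

/-- Cells that no head has visited are blank. -/
lemma cells_eq_none {h : ℕ} (hb : ∀ t κ, ((M.run x ro ma t).tapes κ).head < h) (t : ℕ) :
    ∀ κ, ∀ i ≥ h, ((M.run x ro ma t).tapes κ).cells i = none := by
  induction t with
  | zero => intro κ i _; rfl
  | succ t ih =>
    intro κ i hi
    have h1 := ih κ i hi
    rw [run_succ, step]
    cases (M.run x ro ma t).action with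
    | work q w d =>
      simp only [WorkTape.act]
      rw [Function.update_of_ne, h1]
      have := hb t κ
      omega
    | _ => exact h1

/-- A machine without multiple access bits that always halts, and stays within the first `h` cells
of its tapes, halts before it has visited more configurations than there are. -/
lemma exists_halt_le (hM : M.NoMultiAccess) {h : ℕ}
    (hb : ∀ ro ma t κ, ((M.run x ro ma t).tapes κ).head < h)
    (hh : ∀ ro ma, ∃ t b, (M.run x ro ma t).action = .halt b) (ro ma : ℕ → Bool) :
    ∃ t ≤ Nat.card M.State * (h * 3 ^ h) ^ Nat.card M.Tapes, ∃ b,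
      (M.run x ro ma t).action = .halt b := by
  classical
  have := M.finite_tapes
  have := M.finite_state
  have := Fintype.ofFinite M.Tapes
  have := Fintype.ofFinite M.State
  -- the configurations up to the number of bits read
  let X := M.State × (M.Tapes → Fin h × (Fin h → Option Bool))
  have hX : Fintype.card X = Nat.card M.State * (h * 3 ^ h) ^ Nat.card M.Tapes := by
    simp [X, Nat.card_eq_fintype_card]
  rw [← hX]
  let f : Fin (Fintype.card X + 1) → X := fun t => ((M.run x ro ma t).state, fun κ =>
    (⟨((M.run x ro ma t).tapes κ).head, hb ro ma t κ⟩,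
      fun i => ((M.run x ro ma t).tapes κ).cells i))
  obtain ⟨i', j', hne, hf⟩ := Fintype.exists_ne_map_eq_of_card_lt f (by simp)
  obtain ⟨i, j, hij, hf⟩ : ∃ i j, i < j ∧ f i = f j := by
    rcases lt_or_gt_of_ne hne with hlt | hlt
    · exact ⟨i', j', hlt, hf⟩
    · exact ⟨j', i', hlt, hf.symm⟩
  have hs : (M.run x ro ma i).state = (M.run x ro ma j).state := congrArg Prod.fst hf
  have ht : (M.run x ro ma i).tapes = (M.run x ro ma j).tapes := by
    funext κ
    have h2 := congrFun (congrArg Prod.snd hf) κ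
    have hhead : ((M.run x ro ma i).tapes κ).head = ((M.run x ro ma j).tapes κ).head :=
      congrArg (fun z => z.1.val) h2
    have hcells : ((M.run x ro ma i).tapes κ).cells = ((M.run x ro ma j).tapes κ).cells := by
      funext a
      by_cases ha : a < h
      · exact congrFun (congrArg Prod.snd h2) ⟨a, ha⟩
      · rw [cells_eq_none (hb ro ma) _ _ _ (not_lt.1 ha),
          cells_eq_none (hb ro ma) _ _ _ (not_lt.1 ha)]
    calc (M.run x ro ma i).tapes κ = ⟨_, _⟩ := rfl
      _ = ⟨_, _⟩ := by rw [hhead, hcells]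
  obtain ⟨ro', hro'⟩ := exists_run_of_loop hM hij hs ht
  obtain ⟨t, b, htb⟩ := hh ro' ma
  obtain ⟨s, hs', hact⟩ := hro' t
  exact ⟨s, by omega, b, by rw [← hact, htb]⟩

lemma two_pow_log_le (n : ℕ) : 2 ^ Nat.log 2 n ≤ n + 1 := by
  rcases eq_or_ne n 0 with rfl | hn
  · simp
  · exact (Nat.pow_log_le_self 2 hn).trans n.le_succ

/-- For machines without multiple access bits, the polynomial time bound is a consequence of the
logarithmic space bound and of termination. -/
lemma isRandomizedLogspace_of_space (hM : M.NoMultiAccess) {c : ℕ}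
    (hb : ∀ x ro ma t κ, ((M.run x ro ma t).tapes κ).head < c * (Nat.log 2 x.length + 1))
    (hh : ∀ x ro ma, ∃ t b, (M.run x ro ma t).action = .halt b) : M.IsRandomizedLogspace := by
  refine ⟨?_, hM⟩
  set k := Nat.card M.Tapes with hk
  set q := Nat.card M.State with hq
  refine ⟨c + 3 * c * k + q * 2 ^ (3 * c * k), fun x ro ma => ⟨fun t κ => ?_, ?_⟩⟩
  · refine (hb x ro ma t κ).trans_le (Nat.mul_le_mul_right _ ?_)
    rw [add_assoc]
    exact Nat.le_add_right _ _
  · obtain ⟨t, ht, b, htb⟩ := exists_halt_le hM (hb x) (hh x) ro ma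
    refine ⟨t, ht.trans ?_, b, htb⟩
    set n := x.length
    set L := Nat.log 2 n with hL
    have h1 : c * (L + 1) * 3 ^ (c * (L + 1)) ≤ 2 ^ (3 * (c * (L + 1))) := by
      calc c * (L + 1) * 3 ^ (c * (L + 1))
          ≤ 2 ^ (c * (L + 1)) * (2 ^ 2) ^ (c * (L + 1)) :=
            Nat.mul_le_mul Nat.lt_two_pow_self.le (Nat.pow_le_pow_left (by norm_num) _)
        _ = 2 ^ (3 * (c * (L + 1))) := by rw [← pow_mul, ← pow_add]; congr 1; ring
    have h2 : (c * (L + 1) * 3 ^ (c * (L + 1))) ^ k ≤ 2 ^ (3 * c * k) * (n + 1) ^ (3 * c * k) := by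
      calc (c * (L + 1) * 3 ^ (c * (L + 1))) ^ k ≤ (2 ^ (3 * (c * (L + 1)))) ^ k :=
            Nat.pow_le_pow_left h1 k
        _ = 2 ^ (3 * c * k) * (2 ^ L) ^ (3 * c * k) := by
            rw [← pow_mul, ← pow_mul, ← pow_add]; congr 1; ring
        _ ≤ _ := Nat.mul_le_mul_left _ (Nat.pow_le_pow_left (two_pow_log_le n) _)
    calc q * (c * (L + 1) * 3 ^ (c * (L + 1))) ^ k
        ≤ q * (2 ^ (3 * c * k) * (n + 1) ^ (3 * c * k)) := Nat.mul_le_mul_left _ h2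
      _ = (q * 2 ^ (3 * c * k)) * (n + 1) ^ (3 * c * k) := by ring
      _ ≤ _ := Nat.mul_le_mul (Nat.le_add_left _ _)
          (Nat.pow_le_pow_right (Nat.succ_pos _) (by omega))

end Machine

/-! ### Binary counters on work tapes -/

/-- The tape with the bits of `l₁` to the left of the head, those of `l₂` from the head on, and
blanks elsewhere. -/
def zipper (l₁ l₂ : List Bool) : WorkTape := ⟨fun i => (l₁ ++ l₂)[i]?, l₁.length⟩

/-- The tape holding the number `v` in binary, least significant digit first and without leading
zeros, with the head behind the last digit. -/
def natTape (v : ℕ) : WorkTape := zipper v.bits []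

lemma natTape_zero : natTape 0 = WorkTape.blank := by
  simp [natTape, zipper, WorkTape.blank]

lemma zipper_view (l₁ l₂ : List Bool) :
    (zipper l₁ l₂).view = (l₂.head?, decide (l₁ = [])) := by
  simp only [zipper, WorkTape.view, List.head?_eq_getElem?, List.length_eq_zero_iff]
  rw [List.getElem?_append_right le_rfl, Nat.sub_self]

lemma zipper_head (l₁ l₂ : List Bool) : (zipper l₁ l₂).head = l₁.length := rfl

lemma zipper_write_right (l₁ l₂ : List Bool) (b : Bool) :
    (zipper l₁ l₂).act (some b) .right = zipper (l₁ ++ [b]) l₂.tail := by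
  simp only [zipper, WorkTape.act, List.length_append, List.length_singleton, WorkTape.mk.injEq,
    and_true]
  funext i
  rcases lt_trichotomy i l₁.length with h | rfl | h
  · rw [Function.update_of_ne h.ne, List.getElem?_append_left h, List.append_assoc,
      List.getElem?_append_left h]
  · simp
  · rw [Function.update_of_ne h.ne', List.getElem?_append_right h.le,
      List.getElem?_append_right (by simpa using h)]
    simp only [List.length_append, List.length_singleton]
    obtain ⟨j, rfl⟩ := Nat.exists_eq_add_of_lt h
    cases l₂ <;> simp [show l₁.length + j + 1 - l₁.length = j + 1 by omega]

lemma zipper_move_left (l₁ l₂ : List Bool) (a : Bool) :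
    (zipper (l₁ ++ [a]) l₂).act l₂.head? .left = zipper l₁ (a :: l₂) := by
  have := WorkTape.act_stay (zipper (l₁ ++ [a]) l₂)
  rw [zipper_view] at this
  simp only [zipper, WorkTape.act, WorkTape.mk.injEq, and_true] at this ⊢
  rw [this]
  simp

lemma zipper_erase (l₁ : List Bool) (a : Bool) :
    (zipper l₁ [a]).act none .stay = zipper l₁ [] := by
  simp only [zipper, WorkTape.act, WorkTape.mk.injEq, and_true, List.append_nil]
  funext i
  rcases lt_trichotomy i l₁.length with h | rfl | h
  · rw [Function.update_of_ne h.ne, List.getElem?_append_left h]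
  · simp
  · rw [Function.update_of_ne h.ne', List.getElem?_eq_none (by simp; omega),
      List.getElem?_eq_none (by omega)]

/-- The binary successor on lists of digits. -/
def incBits : List Bool → List Bool
  | [] => [true]
  | false :: l => true :: l
  | true :: l => false :: incBits l

/-- The binary predecessor on lists of digits; it removes a leading digit that becomes zero, so that
the result is again without leading zeros. -/
def decBits : List Bool → List Bool
  | [] => []
  | false :: l => true :: decBits l
  | [true] => []
  | true :: l => false :: l

lemma bits_succ (v : ℕ) : (v + 1).bits = incBits v.bits := by
  induction v using Nat.strong_induction_on with
  | _ v ih =>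
    rcases Nat.even_or_odd' v with ⟨w, rfl | rfl⟩
    · rcases Nat.eq_zero_or_pos w with rfl | hw
      · simp [incBits]
      · rw [Nat.bit1_bits, Nat.bit0_bits _ hw.ne', incBits]
    · rw [Nat.bit1_bits, show 2 * w + 1 + 1 = 2 * (w + 1) by ring, Nat.bit0_bits _ (by omega),
        incBits, ih w (by omega)]

lemma decBits_bits_succ (v : ℕ) : decBits (v + 1).bits = v.bits := by
  induction v using Nat.strong_induction_on with
  | _ v ih =>
    rcases Nat.even_or_odd' v with ⟨w, rfl | rfl⟩
    · rcases Nat.eq_zero_or_pos w with rfl | hw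
      · simp [decBits]
      · rw [Nat.bit1_bits, Nat.bit0_bits _ hw.ne']
        have : w.bits ≠ [] := by
          obtain ⟨u, rfl⟩ := Nat.exists_eq_succ_of_ne_zero hw.ne'
          rw [Nat.succ_eq_add_one, bits_succ]
          rcases u.bits with _ | ⟨_ | _, _⟩ <;> simp [incBits]
        obtain ⟨a, l, hl⟩ := List.exists_cons_of_ne_nil this
        rw [hl, decBits]
        simp
    · rw [show 2 * w + 1 + 1 = 2 * (w + 1) by ring, Nat.bit0_bits _ (by omega), decBits,
        ih w (by omega), Nat.bit1_bits]

lemma bits_length_le {v H : ℕ} (h : v < 2 ^ H) : v.bits.length ≤ H := by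
  rw [Nat.size_eq_bits_len]
  exact Nat.size_le.2 h

lemma bits_ne_nil (v : ℕ) : (v + 1).bits ≠ [] := by
  rw [bits_succ]
  rcases v.bits with _ | ⟨_ | _, _⟩ <;> simp [incBits]

lemma bits_eq_nil_iff (v : ℕ) : v.bits = [] ↔ v = 0 := by
  cases v with
  | zero => simp
  | succ v => simp [bits_ne_nil]

lemma natTape_head_le {v H : ℕ} (h : v < 2 ^ H) : (natTape v).head ≤ H := bits_length_le h

lemma natTape_view_snd (v : ℕ) : (natTape v).view.2 = decide (v = 0) := by
  rw [natTape, zipper_view]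
  simp [bits_eq_nil_iff]

lemma sum_bits (v : ℕ) :
    ∑ i ∈ Finset.range v.bits.length, (if v.bits[i]? = some true then 2 ^ i else 0) = v := by
  induction v using Nat.strong_induction_on with
  | _ v ih =>
    have key : ∀ w, (∑ i ∈ Finset.range w.bits.length,
        (if w.bits[i]? = some true then 2 ^ i else 0) = w) →
        ∑ i ∈ Finset.range w.bits.length, (if w.bits[i]? = some true then 2 ^ (i + 1) else 0)
          = 2 * w := by
      intro w hw
      conv_rhs => rw [← hw, Finset.mul_sum]
      refine Finset.sum_congr rfl fun i _ => ?_
      split_ifs <;> ring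
    rcases Nat.even_or_odd' v with ⟨w, rfl | rfl⟩
    · rcases Nat.eq_zero_or_pos w with rfl | hw
      · simp
      · rw [Nat.bit0_bits _ hw.ne', List.length_cons, Finset.sum_range_succ']
        simp [key w (ih w (by omega))]
    · rw [Nat.bit1_bits, List.length_cons, Finset.sum_range_succ']
      simp [key w (ih w (by omega))]

lemma WorkTape.value_lt (t : WorkTape) : t.value < 2 ^ t.head := by
  rw [WorkTape.value]
  generalize t.head = h
  induction h with
  | zero => simp
  | succ n ih =>
    rw [Finset.sum_range_succ, pow_succ]
    split_ifs <;> omega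

lemma natTape_value (v : ℕ) : (natTape v).value = v := by
  conv_rhs => rw [← sum_bits v]
  simp [natTape, zipper, WorkTape.value]

namespace Mem

variable {K F : Type} [DecidableEq K]

/-- Replace one tape. -/
def setTape (m : Mem K F) (κ : K) (t : WorkTape) : Mem K F :=
  ⟨m.store, Function.update m.tapes κ t, m.used⟩

@[simp] lemma setTape_tapes (m : Mem K F) (κ : K) (t : WorkTape) :
    (m.setTape κ t).tapes κ = t := by simp [setTape]

lemma setTape_setTape (m : Mem K F) (κ : K) (t t' : WorkTape) :
    (m.setTape κ t).setTape κ t' = m.setTape κ t' := by simp [setTape]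

lemma views_setTape (m : Mem K F) (κ : K) (t : WorkTape) :
    (m.setTape κ t).views κ = t.view := by simp [views]

lemma Bdd.setTape {m : Mem K F} {H : ℕ} (hm : m.Bdd H) {κ : K} {t : WorkTape} (ht : t.head ≤ H) :
    (m.setTape κ t).Bdd H := by
  intro κ'
  rcases eq_or_ne κ' κ with rfl | h
  · simpa using ht
  · simpa [Mem.setTape, h] using hm κ'

end Mem

namespace Cmd

variable {K F : Type} [DecidableEq K]

/-- Rewrite the scanned symbol of the tape `κ σ` and move its head. -/
def tapeOp (κ : F → K) (w : Option Bool → Option Bool) (d : Dir) : Cmd K F :=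
  .work fun σ v => (σ, fun κ' => if κ' = κ σ then w (v κ').1 else (v κ').1,
    fun κ' => if κ' = κ σ then d else .stay)

variable {x : List Bool} {ro : ℕ → Bool} {H : ℕ}

lemma exec_tapeOp {m : Mem K F} (hm : m.Bdd H) (κ : F → K) (w : Option Bool → Option Bool)
    (d : Dir)
    (h : ((m.tapes (κ m.store)).act (w (m.tapes (κ m.store)).view.1) d).head ≤ H) :
    Exec x ro H (tapeOp κ w d) m
      (m.setTape (κ m.store) ((m.tapes (κ m.store)).act (w (m.tapes (κ m.store)).view.1) d)) := by
  have key : m.setTape (κ m.store)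
      ((m.tapes (κ m.store)).act (w (m.tapes (κ m.store)).view.1) d) =
      m.doWork ((fun σ v => (σ, fun κ' => if κ' = κ σ then w (v κ').1 else (v κ').1,
        fun κ' => if κ' = κ σ then d else .stay) : F → Views K → _) m.store m.views) := by
    simp only [Mem.setTape, Mem.doWork, Mem.views, Mem.mk.injEq, true_and, and_true]
    funext κ'
    rcases eq_or_ne κ' (κ m.store) with rfl | hne
    · simp
    · simp only [Function.update_of_ne hne, if_neg hne]
      exact (WorkTape.act_stay _).symm
  have hb := hm.setTape (κ := κ m.store) h
  rw [key] at hb ⊢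
  exact .work hb

lemma exec_tapeOp_const {m : Mem K F} {t t' : WorkTape} (hm : m.Bdd H) (ht : t.head ≤ H) (κ : K)
    {w : Option Bool → Option Bool} {d : Dir} (ht' : t.act (w t.view.1) d = t')
    (h : t'.head ≤ H) :
    Exec x ro H (tapeOp (fun _ => κ) w d) (m.setTape κ t) (m.setTape κ t') := by
  have := exec_tapeOp (x := x) (ro := ro) (hm.setTape (κ := κ) ht) (fun _ => κ) w d
    (by simpa [ht'] using h)
  simpa [ht', Mem.setTape_setTape] using this

/-- Move the head of the tape `κ` to the left end. -/
def rewind (κ : K) : Cmd K F :=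
  .loop (fun _ v => !(v κ).2) (tapeOp (fun _ => κ) id .left)

/-- Move the head of the tape `κ` to the next blank. -/
def forward (κ : K) : Cmd K F :=
  .loop (fun _ v => (v κ).1 != none) (tapeOp (fun _ => κ) id .right)

/-- Replace digits `b` by `!b` until another symbol is found. -/
def flips (κ : K) (b : Bool) : Cmd K F :=
  .loop (fun _ v => (v κ).1 == some b) (tapeOp (fun _ => κ) (fun _ => some !b) .right)

/-- Increment the binary counter on the tape `κ`. -/
def inc (κ : K) : Cmd K F :=
  .seq (rewind κ) (.seq (flips κ true)
    (.seq (tapeOp (fun _ => κ) (fun _ => some true) .right) (forward κ)))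

/-- Decrement the binary counter on the tape `κ`, assumed to be positive. -/
def dec (κ : K) : Cmd K F :=
  .seq (rewind κ) (.seq (flips κ false)
    (.seq (tapeOp (fun _ => κ) (fun _ => some false) .right)
      (.ite (fun _ v => (v κ).1 == none)
        (.seq (tapeOp (fun _ => κ) id .left) (tapeOp (fun _ => κ) (fun _ => none) .stay))
        (forward κ))))

variable {m : Mem K F} (hm : m.Bdd H) (κ : K)
include hm

lemma exec_rewind (l₁ : List Bool) : ∀ l₂, l₁.length ≤ H →
    Exec x ro H (rewind κ) (m.setTape κ (zipper l₁ l₂)) (m.setTape κ (zipper [] (l₁ ++ l₂))) := by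
  induction l₁ using List.reverseRecOn with
  | nil =>
    intro l₂ _
    exact .loop_false (by simp [Mem.views_setTape, zipper_view])
  | append_singleton l a ih =>
    intro l₂ hl
    have hl' : l.length ≤ H := by simp at hl; omega
    rw [List.append_assoc]
    refine .loop_true (by simp [Mem.views_setTape, zipper_view]) ?_ (ih (a :: l₂) hl')
    refine exec_tapeOp_const hm hl κ ?_ hl'
    rw [zipper_view]
    exact zipper_move_left l l₂ a

lemma exec_forward (l₂ : List Bool) : ∀ l₁, (l₁ ++ l₂).length ≤ H →
    Exec x ro H (forward κ) (m.setTape κ (zipper l₁ l₂)) (m.setTape κ (zipper (l₁ ++ l₂) [])) := by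
  induction l₂ with
  | nil =>
    intro l₁ _
    rw [List.append_nil]
    exact .loop_false (by simp [Mem.views_setTape, zipper_view])
  | cons a l ih =>
    intro l₁ hl
    have := ih (l₁ ++ [a]) (by simpa using hl)
    rw [List.append_assoc] at this
    simp only [List.length_append, List.length_cons] at hl
    refine .loop_true (by simp [Mem.views_setTape, zipper_view]) ?_ this
    refine exec_tapeOp_const hm (by rw [zipper_head]; omega) κ ?_
      (by rw [zipper_head, List.length_append, List.length_singleton]; omega)
    rw [zipper_view]
    exact zipper_write_right l₁ (a :: l) a

lemma exec_flip {l₁ l : List Bool} {a b : Bool} (h : l₁.length + 1 ≤ H) :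
    Exec x ro H (tapeOp (fun _ => κ) (fun _ => some b) .right) (m.setTape κ (zipper l₁ (a :: l)))
      (m.setTape κ (zipper (l₁ ++ [b]) l)) :=
  exec_tapeOp_const hm (by rw [zipper_head]; omega) κ (zipper_write_right l₁ (a :: l) b)
    (by rw [zipper_head, List.length_append, List.length_singleton]; omega)

lemma exec_inc_aux (l₂ : List Bool) : ∀ l₁, (l₁ ++ incBits l₂).length ≤ H →
    Exec x ro H (.seq (flips κ true)
      (.seq (tapeOp (fun _ => κ) (fun _ => some true) .right) (forward κ)))
      (m.setTape κ (zipper l₁ l₂)) (m.setTape κ (zipper (l₁ ++ incBits l₂) [])) := by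
  induction l₂ with
  | nil =>
    intro l₁ hl
    simp only [List.length_append, incBits, List.length_singleton] at hl
    refine .seq (.loop_false (by simp [Mem.views_setTape, zipper_view])) (.seq
      (exec_tapeOp_const hm (by rw [zipper_head]; omega) κ (zipper_write_right l₁ [] true)
        (by simpa [zipper_head] using hl)) ?_)
    have := exec_forward (x := x) (ro := ro) hm κ [] (l₁ ++ [true]) (by simpa using hl)
    simpa [incBits] using this
  | cons a l ih =>
    intro l₁ hl
    simp only [List.length_append] at hl
    cases a with
    | false =>
      simp only [incBits, List.length_cons] at hl
      refine .seq (.loop_false (by simp [Mem.views_setTape, zipper_view])) (.seq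
        (exec_flip hm κ (by omega)) ?_)
      have := exec_forward (x := x) (ro := ro) hm κ l (l₁ ++ [true]) (by simp; omega)
      simpa [incBits] using this
    | true =>
      simp only [incBits, List.length_cons] at hl
      have h1 := ih (l₁ ++ [false]) (by simp; omega)
      simp only [List.append_assoc, List.singleton_append] at h1
      cases h1 with
      | seq h1 h2 =>
        exact .seq (.loop_true (by simp [Mem.views_setTape, zipper_view])
          (exec_flip hm κ (by omega)) h1) h2

lemma exec_inc {v : ℕ} (hv : v + 1 < 2 ^ H) :
    Exec x ro H (inc κ) (m.setTape κ (natTape v)) (m.setTape κ (natTape (v + 1))) := by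
  have h1 := exec_rewind (x := x) (ro := ro) hm κ v.bits [] (bits_length_le (by omega))
  refine .seq h1 ?_
  rw [List.append_nil]
  have h2 := exec_inc_aux (x := x) (ro := ro) hm κ v.bits []
  rw [List.nil_append, ← bits_succ] at h2
  exact h2 (bits_length_le hv)

lemma exec_dec_aux (l₂ : List Bool) : ∀ l₁, (l₁ ++ l₂).length ≤ H → true ∈ l₂ →
    Exec x ro H (.seq (flips κ false)
      (.seq (tapeOp (fun _ => κ) (fun _ => some false) .right)
      (.ite (fun _ v => (v κ).1 == none)
        (.seq (tapeOp (fun _ => κ) id .left) (tapeOp (fun _ => κ) (fun _ => none) .stay))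
        (forward κ))))
      (m.setTape κ (zipper l₁ l₂)) (m.setTape κ (zipper (l₁ ++ decBits l₂) [])) := by
  induction l₂ with
  | nil => simp
  | cons a l ih =>
    intro l₁ hl ht
    simp only [List.length_append, List.length_cons] at hl
    cases a with
    | true =>
      refine .seq (.loop_false (by simp [Mem.views_setTape, zipper_view])) (.seq
        (exec_flip hm κ (by omega)) ?_)
      cases l with
      | nil =>
        refine .ite_true (by simp [Mem.views_setTape, zipper_view])
          (.seq (m' := m.setTape κ (zipper l₁ [false])) ?_ ?_)
        · refine exec_tapeOp_const hm (by simpa [zipper_head] using hl) κ ?_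
            (by rw [zipper_head]; omega)
          rw [zipper_view]
          exact zipper_move_left l₁ [] false
        · refine exec_tapeOp_const hm (by rw [zipper_head]; omega) κ ?_
            (by simp [zipper_head, decBits]; omega)
          simpa [decBits] using zipper_erase l₁ false
      | cons b l =>
        refine .ite_false (by simp [Mem.views_setTape, zipper_view]) ?_
        have := exec_forward (x := x) (ro := ro) hm κ (b :: l) (l₁ ++ [false])
          (by simp at hl ⊢; omega)
        simpa [decBits] using this
    | false =>
      have h1 := ih (l₁ ++ [true]) (by simp; omega) (by simpa using ht)
      simp only [List.append_assoc, List.singleton_append] at h1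
      cases h1 with
      | seq h1 h2 =>
        exact .seq (.loop_true (by simp [Mem.views_setTape, zipper_view])
          (exec_flip hm κ (by omega)) h1) h2

lemma exec_dec {v : ℕ} (hv : v + 1 < 2 ^ H) :
    Exec x ro H (dec κ) (m.setTape κ (natTape (v + 1))) (m.setTape κ (natTape v)) := by
  have h1 := exec_rewind (x := x) (ro := ro) hm κ (v + 1).bits [] (bits_length_le (by omega))
  refine .seq h1 ?_
  rw [List.append_nil]
  have h2 := exec_dec_aux (x := x) (ro := ro) hm κ (v + 1).bits []
  rw [List.nil_append, List.nil_append, decBits_bits_succ] at h2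
  refine h2 (bits_length_le hv) ?_
  rw [bits_succ]
  generalize v.bits = l
  induction l with
  | nil => simp [incBits]
  | cons a l ih => cases a <;> simp [incBits, ih]

end Cmd

/-! ### Register programs -/

/-- The finite store of the programs below: a control state, the last bit that has been read, and a
selected tape. -/
abbrev Store (Q T : Type) := Q × Option Bool × Option T

/-- The registers of the programs below. Their roles: `rP` points into the input, `rN`, `rK` and
`rL` hold the parameters read off from the input, `rW` the length of a row of the adjacency matrix,
`rM` and `rY` the parameters of the instance that is simulated, `rA` the address that is asked for;
`rRow`, `rQ`, `rC`, `rD` are used for walking through the rows of the matrix, and `rT`, `rU`, `rZ`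
are auxiliary. -/
inductive Reg
  | rN | rK | rP | rW | rM | rY | rL | rA | rRow | rQ | rC | rD | rT | rU | rZ
  deriving DecidableEq

instance : Fintype Reg where
  elems := {.rN, .rK, .rP, .rW, .rM, .rY, .rL, .rA, .rRow, .rQ, .rC, .rD, .rT, .rU, .rZ}
  complete i := by cases i <;> simp

/-- The memory with register values `r` (each held by a binary counter) and further tapes `τ`. -/
def regs {T F : Type} (σ : F) (r : Reg → ℕ) (τ : T → WorkTape) (u : ℕ) : Mem (Reg ⊕ T) F :=
  ⟨σ, Sum.elim (fun i => natTape (r i)) τ, u⟩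

/-- All register values have at most `H` digits. -/
def Small (H : ℕ) (r : Reg → ℕ) : Prop := ∀ i, r i < 2 ^ H

lemma Small.update {H : ℕ} {r : Reg → ℕ} (h : Small H r) (i : Reg) {v : ℕ} (hv : v < 2 ^ H) :
    Small H (Function.update r i v) := by
  intro j
  rcases eq_or_ne j i with rfl | hj
  · simpa using hv
  · simpa [hj] using h j

section

variable {T F : Type}

lemma regs_bdd {H : ℕ} {σ : F} {r : Reg → ℕ} {τ : T → WorkTape} {u : ℕ} (hr : Small H r)
    (hτ : ∀ κ, (τ κ).head ≤ H) : (regs σ r τ u).Bdd H := by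
  rintro (i | κ)
  · exact natTape_head_le (hr i)
  · exact hτ κ

variable [DecidableEq T]

lemma regs_setTape (σ : F) (r : Reg → ℕ) (τ : T → WorkTape) (u : ℕ) (i : Reg) (v : ℕ) :
    (regs σ r τ u).setTape (.inl i) (natTape v) = regs σ (Function.update r i v) τ u := by
  simp only [regs, Mem.setTape, Mem.mk.injEq, true_and, and_true]
  funext κ
  rcases κ with j | κ
  · rcases eq_or_ne j i with rfl | hj <;> simp [*]
  · simp

lemma regs_setTape_inr (σ : F) (r : Reg → ℕ) (τ : T → WorkTape) (u : ℕ) (κ : T) (t : WorkTape) :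
    (regs σ r τ u).setTape (.inr κ) t = regs σ r (Function.update τ κ t) u := by
  simp only [regs, Mem.setTape, Mem.mk.injEq, true_and, and_true]
  funext κ'
  rcases κ' with j | κ'
  · simp
  · rcases eq_or_ne κ' κ with rfl | hj <;> simp [*]

end

/-- The test whether a register is nonzero. -/
def nz {T F : Type} (i : Reg) : F → Views (Reg ⊕ T) → Bool := fun _ v => !(v (.inl i)).2

lemma nz_regs {T F : Type} (σ : F) (r : Reg → ℕ) (τ : T → WorkTape) (u : ℕ) (i : Reg) :
    nz i (regs σ r τ u).store (regs σ r τ u).views = decide (r i ≠ 0) := by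
  simp [nz, Mem.views, regs, natTape_view_snd]

namespace Cmd

variable {T F : Type}

lemma exec_of_eq {x : List Bool} {ro : ℕ → Bool} {H : ℕ} {σ : F} {τ : T → WorkTape} {u : ℕ}
    {P : Cmd (Reg ⊕ T) F} {σ' : F} {r₁ r₁' r₂ r₂' : Reg → ℕ} {τ' : T → WorkTape}
    {u' : ℕ} (h : Exec x ro H P (regs σ r₁ τ u) (regs σ' r₂ τ' u')) (h₁ : r₁ = r₁')
    (h₂ : r₂ = r₂') :
    Exec x ro H P (regs σ r₁' τ u) (regs σ' r₂' τ' u') := by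
  rwa [← h₁, ← h₂]

/-- Change only the store. -/
def setStore {K : Type} (f : F → Views K → F) : Cmd K F :=
  .work fun σ v => (f σ v, fun κ => (v κ).1, fun _ => .stay)

/-- Do nothing. -/
def skip {K : Type} : Cmd K F := setStore fun σ _ => σ

lemma exec_setStore {K : Type} {x : List Bool} {ro : ℕ → Bool} {H : ℕ} {m : Mem K F}
    (hm : m.Bdd H) (f : F → Views K → F) :
    Exec x ro H (setStore f) m ⟨f m.store m.views, m.tapes, m.used⟩ := by
  have : (⟨f m.store m.views, m.tapes, m.used⟩ : Mem K F) =
      m.doWork ((fun σ v => (f σ v, fun κ => (v κ).1, fun _ => .stay) :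
        F → Views K → F × (K → Option Bool) × (K → Dir)) m.store m.views) := by
    simp only [Mem.doWork, Mem.views, Mem.mk.injEq, true_and, and_true]
    funext κ
    exact (WorkTape.act_stay _).symm
  rw [this]
  refine .work ?_
  rw [← this]
  exact hm

variable [DecidableEq T]

variable {x : List Bool} {ro : ℕ → Bool} {H : ℕ} {σ : F} {r : Reg → ℕ} {τ : T → WorkTape}
  {u : ℕ}

lemma exec_skip {K : Type} {m : Mem K F} (hm : m.Bdd H) :
    Exec x ro H (skip : Cmd K F) m m := exec_setStore hm _

section
variable (hr : Small H r) (hτ : ∀ κ, (τ κ).head ≤ H)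
include hr hτ

lemma exec_incReg (i : Reg) {v : ℕ} (hi : r i = v) (hv : v + 1 < 2 ^ H) :
    Exec x ro H (inc (.inl i)) (regs σ r τ u) (regs σ (Function.update r i (v + 1)) τ u) := by
  have := exec_inc (x := x) (ro := ro) (regs_bdd (σ := σ) (u := u) hr hτ) (.inl i) hv
  rw [regs_setTape, regs_setTape] at this
  rwa [show Function.update r i v = r by rw [← hi]; simp] at this

lemma exec_decReg (i : Reg) {v : ℕ} (hi : r i = v + 1) :
    Exec x ro H (dec (.inl i)) (regs σ r τ u) (regs σ (Function.update r i v) τ u) := by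
  have := exec_dec (x := x) (ro := ro) (regs_bdd (σ := σ) (u := u) hr hτ) (.inl i)
    (v := v) (by rw [← hi]; exact hr i)
  rw [regs_setTape, regs_setTape] at this
  rwa [show Function.update r i (v + 1) = r by rw [← hi]; simp] at this

end

/-- `i := 0`. -/
def clear (i : Reg) : Cmd (Reg ⊕ T) F := .loop (nz i) (dec (.inl i))

/-- `i := i + j; j := 0`. -/
def move (i j : Reg) : Cmd (Reg ⊕ T) F := .loop (nz j) (.seq (dec (.inl j)) (inc (.inl i)))

/-- `i := i + j`, with the help of a register `t` that is zero. -/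
def add (i j t : Reg) : Cmd (Reg ⊕ T) F :=
  .seq (.loop (nz j) (.seq (dec (.inl j)) (.seq (inc (.inl i)) (inc (.inl t))))) (move j t)

/-- `(i, j) := (i - j, j - i)` with truncated subtractions. -/
def sub (i j : Reg) : Cmd (Reg ⊕ T) F :=
  .loop (fun σ v => nz i σ v && nz j σ v) (.seq (dec (.inl i)) (dec (.inl j)))

/-- `i := i + j * k; k := 0`, with the help of a register `t` that is zero. -/
def mulAdd (i j k t : Reg) : Cmd (Reg ⊕ T) F :=
  .loop (nz k) (.seq (dec (.inl k)) (add i j t))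

variable (hτ : ∀ κ, (τ κ).head ≤ H)
include hτ

lemma exec_clear (i : Reg) : ∀ {v : ℕ} {r : Reg → ℕ}, Small H r →
    r i = v → Exec x ro H (clear i) (regs σ r τ u) (regs σ (Function.update r i 0) τ u) := by
  intro v
  induction v with
  | zero =>
    intro r _ hi
    rw [show Function.update r i 0 = r by rw [← hi]; simp]
    exact .loop_false (by simp [nz_regs, hi])
  | succ v ih =>
    intro r hr hi
    have := hr i
    refine .loop_true (by simp [nz_regs, hi]) (exec_decReg hr hτ i hi) ?_
    have h2 := ih (r := Function.update r i v) (hr.update i (by omega)) (by simp)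
    rwa [Function.update_idem] at h2

lemma exec_move {i j : Reg} (hij : i ≠ j) :
    ∀ {w v : ℕ} {r : Reg → ℕ}, Small H r → r i = v → r j = w → v + w < 2 ^ H →
    Exec x ro H (move i j) (regs σ r τ u)
      (regs σ (Function.update (Function.update r j 0) i (v + w)) τ u) := by
  intro w
  induction w with
  | zero =>
    intro v r _ hi hj _
    rw [show Function.update (Function.update r j 0) i (v + 0) = r by
      rw [add_zero, ← hi, ← hj]; simp]
    exact .loop_false (by simp [nz_regs, hj])
  | succ w ih =>
    intro v r hr hi hj hlt
    have h1 := hr.update j (v := w) (by have := hr j; omega)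
    have h2 := h1.update i (v := v + 1) (by omega)
    refine .loop_true (by simp [nz_regs, hj]) (.seq (exec_decReg hr hτ j hj)
      (exec_incReg h1 hτ i (v := v) (by simp [hij, hi]) (by omega))) ?_
    refine exec_of_eq (ih (v := v + 1) h2 (by simp) (by simp [hij.symm]) (by omega)) rfl ?_
    funext l
    simp only [Function.update_apply]
    split_ifs <;> first | rfl | omega

lemma exec_add {i j t : Reg} (hij : i ≠ j) (hit : i ≠ t) (hjt : j ≠ t) {w v : ℕ} (hr : Small H r)
    (hi : r i = v) (hj : r j = w) (ht : r t = 0) (hlt : v + w < 2 ^ H) :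
    Exec x ro H (add i j t) (regs σ r τ u) (regs σ (Function.update r i (v + w)) τ u) := by
  have key : ∀ {w v z : ℕ} {r : Reg → ℕ}, Small H r → r i = v → r j = w → r t = z →
      v + w < 2 ^ H → z + w < 2 ^ H →
      Exec x ro H (.loop (nz j) (.seq (dec (.inl j)) (.seq (inc (.inl i)) (inc (.inl t)))))
        (regs σ r τ u) (regs σ (Function.update (Function.update (Function.update r j 0)
          i (v + w)) t (z + w)) τ u) := by
    intro w
    induction w with
    | zero =>
      intro v z r hr hi hj ht _ _
      refine exec_of_eq (r₂ := r) (.loop_false (by simp [nz_regs, hj])) rfl ?_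
      funext l
      simp only [Function.update_apply]
      split_ifs <;> first | rfl | omega | (subst_vars; first | contradiction | omega)
    | succ w ih =>
      intro v z r hr hi hj ht hlt hlt'
      have h1 := hr.update j (v := w) (by have := hr j; omega)
      have h2 := h1.update i (v := v + 1) (by omega)
      have h3 := h2.update t (v := z + 1) (by omega)
      refine .loop_true (by simp [nz_regs, hj]) (.seq (exec_decReg hr hτ j hj)
        (.seq (exec_incReg h1 hτ i (v := v) (by simp [hij, hi]) (by omega))
        (exec_incReg h2 hτ t (v := z) (by simp [hit.symm, hjt.symm, ht]) (by omega)))) ?_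
      refine exec_of_eq (ih (v := v + 1) (z := z + 1) h3 (by simp [hit]) (by simp [hij.symm, hjt])
        (by simp)
        (by omega) (by omega)) rfl ?_
      funext l
      simp only [Function.update_apply]
      split_ifs <;> first | rfl | omega
  have hw := hr j
  have h1 := ((hr.update j (v := 0) (by positivity)).update i (v := v + w) hlt).update t
    (v := 0 + w) (by omega)
  refine .seq (key hr hi hj ht hlt (by omega)) ?_
  refine exec_of_eq (exec_move hτ hjt h1 (v := 0) (w := w) (by simp [hij.symm, hjt])
    (by simp) (by omega)) rfl ?_
  funext l
  simp only [Function.update_apply]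
  split_ifs <;> first | rfl | omega | (subst_vars; first | contradiction | omega)

lemma exec_sub {i j : Reg} (hij : i ≠ j) :
    ∀ {v w : ℕ} {r : Reg → ℕ}, Small H r → r i = v → r j = w →
    Exec x ro H (sub i j) (regs σ r τ u)
      (regs σ (Function.update (Function.update r j (w - v)) i (v - w)) τ u) := by
  intro v
  induction v with
  | zero =>
    intro w r hr hi hj
    refine exec_of_eq (r₂ := r) (.loop_false ?_) rfl ?_
    · rw [nz_regs, nz_regs]; simp [hi]
    · funext l
      simp only [Function.update_apply]
      split_ifs <;> first | rfl | omega | (subst_vars; first | contradiction | omega)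
  | succ v ih =>
    intro w r hr hi hj
    rcases w with _ | w
    · refine exec_of_eq (r₂ := r) (.loop_false ?_) rfl ?_
      · rw [nz_regs, nz_regs]; simp [hj]
      · funext l
        simp only [Function.update_apply]
        split_ifs <;> first | rfl | omega | (subst_vars; first | contradiction | omega)
    · have h1 := hr.update i (v := v) (by have := hr i; omega)
      have h2 := h1.update j (v := w) (by have := hr j; omega)
      refine .loop_true ?_ (.seq (exec_decReg hr hτ i hi)
        (exec_decReg h1 hτ j (v := w) (by simp [hij.symm, hj]))) ?_
      · rw [nz_regs, nz_regs]; simp [hi, hj]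
      refine exec_of_eq (ih (w := w) h2 (by simp [hij]) (by simp)) rfl ?_
      funext l
      simp only [Function.update_apply]
      split_ifs <;> first | rfl | omega

lemma exec_mulAdd {i j k t : Reg} (hij : i ≠ j) (hik : i ≠ k) (hit : i ≠ t) (hjk : j ≠ k)
    (hjt : j ≠ t) (hkt : k ≠ t) {w : ℕ} :
    ∀ {z v : ℕ} {r : Reg → ℕ}, Small H r → r i = v → r j = w → r k = z → r t = 0 →
    v + w * z < 2 ^ H →
    Exec x ro H (mulAdd i j k t) (regs σ r τ u)
      (regs σ (Function.update (Function.update r k 0) i (v + w * z)) τ u) := by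
  intro z
  induction z with
  | zero =>
    intro v r hr hi hj hk ht _
    refine exec_of_eq (r₂ := r) (.loop_false (by simp [nz_regs, hk])) rfl ?_
    funext l
    simp only [Function.update_apply]
    split_ifs <;> first | rfl | omega | (subst_vars; first | contradiction | omega)
  | succ z ih =>
    intro v r hr hi hj hk ht hlt
    have hle : v + w + w * z < 2 ^ H := by
      rw [Nat.mul_succ] at hlt; omega
    have h1 := hr.update k (v := z) (by have := hr k; omega)
    have h2 := h1.update i (v := v + w) (by omega)
    refine .loop_true (by simp [nz_regs, hk]) (.seq (exec_decReg hr hτ k hk)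
      (exec_add hτ hij hit hjt (v := v) (w := w) h1 (by simp [hik, hi]) (by simp [hjk, hj])
        (by simp [hkt.symm, ht])
        (by omega))) ?_
    refine exec_of_eq (ih (v := v + w) h2 (by simp) (by simp [hij.symm, hjk, hj])
      (by simp [hik.symm])
      (by simp [hit.symm, hkt.symm, ht]) hle) rfl ?_
    funext l
    simp only [Function.update_apply, Nat.mul_succ]
    split_ifs <;> first | rfl | omega

/-- `i := 0` for all registers. -/
def clearAll : Cmd (Reg ⊕ T) F := (Finset.univ : Finset Reg).toList.foldr
    (fun i P => .seq (clear i) P) skip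

lemma exec_clearAll (hr : Small H r) :
    Exec x ro H (clearAll : Cmd (Reg ⊕ T) F) (regs σ r τ u) (regs σ (fun _ => 0) τ u) := by
  have key : ∀ (l : List Reg) (r : Reg → ℕ), Small H r → (∀ i ∉ l, r i = 0) →
      Exec x ro H (l.foldr (fun i P => .seq (clear i) P) skip : Cmd (Reg ⊕ T) F)
        (regs σ r τ u) (regs σ (fun _ => 0) τ u) := by
    intro l
    induction l with
    | nil =>
      intro r hr hl
      obtain rfl : r = fun _ => 0 := funext fun i => hl i (by simp)
      exact exec_skip (regs_bdd hr hτ)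
    | cons i l ih =>
      intro r hr hl
      refine .seq (exec_clear hτ i hr rfl) (ih _ (hr.update i (by positivity)) fun j hj => ?_)
      rcases eq_or_ne j i with rfl | hji
      · simp
      · simpa [hji] using hl j (by simp [hji, hj])
  exact key _ r hr (by simp)

end Cmd

open Function (update)

/-! ### Subroutines -/

namespace Cmd

variable {Q T : Type}

/-- Read the input bit whose address is the value of register `i`. -/
def readAt (i : Reg) : Cmd (Reg ⊕ T) (Store Q T) := .readInput (.inl i) fun σ _ b => (σ.1, b, σ.2.2)

/-- Apply `f` to the stored bit. -/
def mapBit (f : Option Bool → Option Bool) : Cmd (Reg ⊕ T) (Store Q T) :=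
  setStore fun σ _ => (σ.1, f σ.2.1, σ.2.2)

variable {x : List Bool} {ro : ℕ → Bool} {H : ℕ} {s : Option T} {qq : Q}
  {b : Option Bool} {r : Reg → ℕ} {τ : T → WorkTape} {u : ℕ}

lemma exec_readAt (i : Reg) {v : ℕ} (hi : r i = v) :
    Exec x ro H (readAt i) (regs (qq, b, s) r τ u) (regs (qq, x[v]?, s) r τ u) := by
  have := Exec.readInput (x := x) (ro := ro) (H := H) (κ := .inl i)
    (f := fun σ _ b => (σ.1, b, σ.2.2)) (m := regs (qq, b, s) r τ u)
  simpa [regs, natTape_value, hi, readAt] using this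

lemma exec_mapBit (hτ : ∀ κ, (τ κ).head ≤ H) (hr : Small H r) (f : Option Bool → Option Bool) :
    Exec x ro H (mapBit f) (regs (qq, b, s) r τ u) (regs (qq, f b, s) r τ u) :=
  exec_setStore (regs_bdd hr hτ) _

variable [DecidableEq T]

/-- `i := i + v` for a constant `v`. -/
def addConst (i : Reg) : ℕ → Cmd (Reg ⊕ T) (Store Q T)
  | 0 => skip
  | v + 1 => .seq (inc (.inl i)) (addConst i v)

/-- Count in register `i` how often one can read a one from the input, starting at the address `p`
and advancing by eight after each one. For a block of `8 * j` ones followed by a zero the result is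
`j`. -/
def parse (p i : Reg) : Cmd (Reg ⊕ T) (Store Q T) :=
  .seq (readAt p) (.loop (fun σ _ => σ.2.1 == some true)
    (.seq (addConst p 8) (.seq (inc (.inl i)) (readAt p))))

/-- Double register `a` with the help of registers `t` and `z` that are zero. -/
def double (a t z : Reg) : Cmd (Reg ⊕ T) (Store Q T) := .seq (add t a z) (move a t)

/-- Compute in register `a` the value of the tape `κ σ`. The head of that tape is moved to the left
end, where the number of moves is counted in `c`, and then back again. -/
def fetch (κ : Store Q T → Reg ⊕ T) (a c t z : Reg) : Cmd (Reg ⊕ T) (Store Q T) :=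
  .seq (.loop (fun σ v => !(v (κ σ)).2)
    (.seq (tapeOp κ id .left) (.seq (double a t z)
      (.seq (.ite (fun σ v => (v (κ σ)).1 == some true) (inc (.inl a)) skip) (inc (.inl c))))))
    (.loop (nz c) (.seq (dec (.inl c)) (tapeOp κ id .right)))

variable (hτ : ∀ κ, (τ κ).head ≤ H)
include hτ

lemma exec_addConst (i : Reg) : ∀ {w v : ℕ} {r : Reg → ℕ}, Small H r → r i = v → v + w < 2 ^ H →
    Exec x ro H (addConst i w : Cmd (Reg ⊕ T) (Store Q T)) (regs (qq, b, s) r τ u)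
      (regs (qq, b, s) (update r i (v + w)) τ u) := by
  intro w
  induction w with
  | zero =>
    intro v r hr hi _
    rw [show update r i (v + 0) = r by rw [add_zero, ← hi]; simp]
    exact exec_skip (regs_bdd hr hτ)
  | succ w ih =>
    intro v r hr hi hv
    refine .seq (exec_incReg hr hτ i hi (by omega)) ?_
    refine exec_of_eq (ih (hr.update i (v := v + 1) (by omega)) (v := v + 1) (by simp) (by omega))
      rfl ?_
    rw [Function.update_idem, show v + 1 + w = v + (w + 1) by omega]

lemma exec_parse {p i : Reg} (hpi : p ≠ i) {j v w : ℕ} (hr : Small H r) (hp : r p = v)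
    (hi : r i = w) (hj : ∀ i < j, x[v + 8 * i]? = some true) (hj' : x[v + 8 * j]? ≠ some true)
    (hb : v + 8 * j < 2 ^ H) (hb' : w + j < 2 ^ H) :
    ∃ b', Exec x ro H (parse p i : Cmd (Reg ⊕ T) (Store Q T)) (regs (qq, b, s) r τ u)
      (regs (qq, b', s) (update (update r p (v + 8 * j)) i (w + j)) τ u) := by
  refine ⟨x[v + 8 * j]?, .seq (exec_readAt p hp) ?_⟩
  induction j generalizing v w r with
  | zero =>
    refine exec_of_eq (r₂ := r) (.loop_false ?_) rfl ?_
    · have : (regs (qq, x[v]?, s) r τ u).store.2.1 = x[v]? := rfl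
      simpa [this] using hj'
    · rw [mul_zero, add_zero, add_zero, ← hp, ← hi]; simp
  | succ j ih =>
    have h0 : x[v]? = some true := by simpa using hj 0 (by omega)
    have h1 := hr.update p (v := v + 8) (by omega)
    have h2 := h1.update i (v := w + 1) (by omega)
    refine .loop_true ?_ (.seq (exec_addConst hτ p hr hp (by omega))
      (.seq (exec_incReg h1 hτ i (v := w) (by simp [hpi.symm, hi]) (by omega))
        (exec_readAt p (v := v + 8) (by simp [hpi])))) ?_
    · simp [regs, h0]
    · have e : v + 8 * (j + 1) = v + 8 + 8 * j := by ring
      rw [e] at hj' hb ⊢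
      refine exec_of_eq (ih (v := v + 8) (w := w + 1) h2 (by simp [hpi]) (by simp)
        (fun i hij => ?_) hj' hb (by omega)) rfl ?_
      · rw [← hj (i + 1) (by omega)]
        congr 1; ring
      · funext l
        simp only [Function.update_apply]
        split_ifs <;> first | rfl | omega

lemma exec_double {a t z : Reg} (hat : a ≠ t) (haz : a ≠ z) (htz : t ≠ z) {v : ℕ}
    (hr : Small H r) (ha : r a = v) (ht : r t = 0) (hz : r z = 0) (hv : v + v < 2 ^ H) :
    Exec x ro H (double a t z : Cmd (Reg ⊕ T) (Store Q T)) (regs (qq, b, s) r τ u)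
      (regs (qq, b, s) (update r a (v + v)) τ u) := by
  refine .seq (exec_add hτ hat.symm htz haz hr ht ha hz (by omega)) ?_
  refine exec_of_eq (exec_move hτ hat (hr.update t (v := 0 + v) (by omega)) (v := v) (w := v)
    (by simp [hat, ha]) (by simp) hv) rfl ?_
  funext l
  simp only [Function.update_apply]
  split_ifs <;> first | rfl | omega | (subst_vars; first | contradiction | omega)

omit hτ in
lemma exec_fetch {κ : Store Q T → Reg ⊕ T} {κ₀ : T} (hκ : κ (qq, b, s) = .inr κ₀)
    {a c t z : Reg} (hac : a ≠ c) (hat : a ≠ t) (haz : a ≠ z) (hct : c ≠ t) (hcz : c ≠ z)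
    (htz : t ≠ z) (hτ : ∀ κ, (τ κ).head ≤ H) (hr : Small H r) (ha : r a = 0) (hc : r c = 0)
    (ht : r t = 0) (hz : r z = 0) :
    Exec x ro H (fetch κ a c t z : Cmd (Reg ⊕ T) (Store Q T)) (regs (qq, b, s) r τ u)
      (regs (qq, b, s) (update r a (τ κ₀).value) τ u) := by
  set f := (τ κ₀).cells with hf
  have hbd : ∀ {h}, h ≤ H → ∀ κ, (update τ κ₀ ⟨f, h⟩ κ).head ≤ H := by
    intro h hh κ
    rcases eq_or_ne κ κ₀ with rfl | hne
    · simpa using hh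
    · simpa [hne] using hτ κ
  -- Horner evaluation of the digits from the head down to the left end: `w` is the value of the `j`
  -- digits that have been passed
  have key₁ : ∀ p j w r, Small H r → r a = w → r c = j → r t = 0 → r z = 0 → w < 2 ^ j →
      j + p ≤ H → Exec x ro H (.loop (fun σ v => !(v (κ σ)).2)
        (.seq (tapeOp κ id .left) (.seq (double a t z)
        (.seq (.ite (fun σ v => (v (κ σ)).1 == some true) (inc (.inl a)) skip) (inc (.inl c))))))
      (regs (qq, b, s) r (update τ κ₀ ⟨f, p⟩) u)
      (regs (qq, b, s) (update (update r c (j + p)) a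
        (w * 2 ^ p + ∑ i ∈ Finset.range p, if f i = some true then 2 ^ i else 0))
        (update τ κ₀ ⟨f, 0⟩) u) := by
    intro p
    induction p with
    | zero =>
      intro j w r hr ha hc ht hz hw hj
      refine exec_of_eq (r₂ := r) (.loop_false ?_) rfl ?_
      · simp [-Sum.elim_update_right, regs, hκ, Mem.views, WorkTape.view]
      · rw [add_zero, ← hc, pow_zero, mul_one, Finset.sum_range_zero, add_zero, ← ha]; simp
    | succ p ih =>
      intro j w r hr ha hc ht hz hw hj
      have hp : p ≤ H := by omega
      have hpow : 2 ^ (j + 1) ≤ 2 ^ H := Nat.pow_le_pow_right (by norm_num) (by omega)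
      have hww : w + w + 1 < 2 ^ (j + 1) := by rw [pow_succ]; omega
      have hjH : j + 1 < 2 ^ H :=
        lt_of_le_of_lt (by omega : j + 1 ≤ H) Nat.lt_two_pow_self
      have h1 := hr.update a (v := w + w) (by omega)
      set w' := w + w + if f p = some true then 1 else 0 with hw'
      have hw'lt : w' < 2 ^ (j + 1) := by rw [hw']; split_ifs <;> omega
      have h2 := hr.update a (v := w') (by omega)
      have h3 := h2.update c (v := j + 1) hjH
      have e1 : Exec x ro H (tapeOp κ id .left) (regs (qq, b, s) r (update τ κ₀ ⟨f, p + 1⟩) u)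
          (regs (qq, b, s) r (update τ κ₀ ⟨f, p⟩) u) := by
        have := exec_tapeOp (x := x) (ro := ro)
          (regs_bdd (σ := (qq, b, s)) (u := u) hr (hbd (h := p + 1) (by omega))) κ id .left
          (by simp [-Sum.elim_update_right, regs, hκ, WorkTape.act, hp])
        have hs : (regs (qq, b, s) r (update τ κ₀ ⟨f, p + 1⟩) u).store = (qq, b, s) := rfl
        rw [hs, hκ, regs_setTape_inr] at this
        simpa [-Sum.elim_update_right, regs, WorkTape.act, WorkTape.view] using this
      have e2 : Exec x ro H (.ite (fun σ v => (v (κ σ)).1 == some true) (inc (.inl a)) skip)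
          (regs (qq, b, s) (update r a (w + w)) (update τ κ₀ ⟨f, p⟩) u)
          (regs (qq, b, s) (update r a w') (update τ κ₀ ⟨f, p⟩) u) := by
        by_cases hfp : f p = some true
        · refine .ite_true (by simp [-Sum.elim_update_right, regs, hκ, Mem.views, WorkTape.view,
            hfp]) ?_
          refine exec_of_eq (exec_incReg h1 (hbd hp) a (v := w + w) (by simp) (by omega)) rfl ?_
          simp [hw', hfp]
        · refine .ite_false (by simp [-Sum.elim_update_right, regs, hκ, Mem.views, WorkTape.view,
            hfp]) ?_
          refine exec_of_eq (exec_skip (regs_bdd h1 (hbd hp))) rfl ?_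
          simp [hw', hfp]
      refine .loop_true (by simp [-Sum.elim_update_right, regs, hκ, Mem.views, WorkTape.view])
        (.seq e1 (.seq (exec_double (hbd hp) hat haz htz hr ha ht hz (by omega)) (.seq e2
          (exec_incReg h2 (hbd hp) c (v := j) (by simp [hac.symm, hc]) hjH)))) ?_
      refine exec_of_eq (ih (j + 1) w' _ h3 (by simp [hac]) (by simp)
        (by simp [hat.symm, hct.symm, ht]) (by simp [haz.symm, hcz.symm, hz]) hw'lt (by omega))
        rfl ?_
      have e : w' * 2 ^ p + ∑ i ∈ Finset.range p, (if f i = some true then 2 ^ i else 0) =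
          w * 2 ^ (p + 1) + ∑ i ∈ Finset.range (p + 1), if f i = some true then 2 ^ i else 0 := by
        rw [Finset.sum_range_succ, hw']
        split_ifs <;> ring
      rw [e]
      funext l
      simp only [Function.update_apply]
      split_ifs <;> first | rfl | omega
  -- the way back of the head
  have key₂ : ∀ j p r, Small H r → r c = j → p + j ≤ H →
      Exec x ro H (.loop (nz c) (.seq (dec (.inl c)) (tapeOp κ id .right)))
      (regs (qq, b, s) r (update τ κ₀ ⟨f, p⟩) u)
      (regs (qq, b, s) (update r c 0) (update τ κ₀ ⟨f, p + j⟩) u) := by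
    intro j
    induction j with
    | zero =>
      intro p r hr hc hp
      refine exec_of_eq (r₂ := r) (.loop_false (by simp [nz_regs, hc])) rfl ?_
      rw [← hc]; simp
    | succ j ih =>
      intro p r hr hc hp
      have h1 := hr.update c (v := j) (by have := hr c; omega)
      have e1 : Exec x ro H (tapeOp κ id .right)
          (regs (qq, b, s) (update r c j) (update τ κ₀ ⟨f, p⟩) u)
          (regs (qq, b, s) (update r c j) (update τ κ₀ ⟨f, p + 1⟩) u) := by
        have := exec_tapeOp (x := x) (ro := ro)
          (regs_bdd (σ := (qq, b, s)) (u := u) h1 (hbd (h := p) (by omega))) κ id .right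
          (by simp [-Sum.elim_update_right, regs, hκ, WorkTape.act]; omega)
        have hs : (regs (qq, b, s) (update r c j) (update τ κ₀ ⟨f, p⟩) u).store = (qq, b, s) := rfl
        rw [hs, hκ, regs_setTape_inr] at this
        simpa [-Sum.elim_update_right, regs, WorkTape.act, WorkTape.view] using this
      refine .loop_true (by simp [nz_regs, hc]) (.seq (exec_decReg hr (hbd (by omega)) c hc) e1) ?_
      have := ih (p + 1) _ h1 (by simp) (by omega)
      rw [Function.update_idem] at this
      rwa [show p + (j + 1) = p + 1 + j by omega]
  have hup : update τ κ₀ ⟨f, (τ κ₀).head⟩ = τ := Function.update_eq_self κ₀ τ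
  have hh := hτ κ₀
  have g1 := key₁ (τ κ₀).head 0 0 r hr ha hc ht hz (by simp) (by omega)
  have hval : 0 * 2 ^ (τ κ₀).head +
      ∑ i ∈ Finset.range (τ κ₀).head, (if f i = some true then 2 ^ i else 0) = (τ κ₀).value := by
    rw [zero_mul, zero_add, WorkTape.value]
  have hvlt : (τ κ₀).value < 2 ^ H :=
    (WorkTape.value_lt _).trans_le (Nat.pow_le_pow_right (by norm_num) hh)
  rw [hval, hup, zero_add] at g1
  have h2 := (hr.update c (v := (τ κ₀).head) (lt_of_le_of_lt hh Nat.lt_two_pow_self)).update a hvlt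
  have g2 := key₂ (τ κ₀).head 0 _ h2 (by simp [hac.symm]) (by omega)
  rw [zero_add, hup] at g2
  refine .seq g1 (exec_of_eq g2 rfl ?_)
  funext l
  simp only [Function.update_apply]
  split_ifs <;> first | rfl | omega | (subst_vars; first | contradiction | omega)

end Cmd

/-! ### The parameters of the input and the search in the adjacency matrix -/

lemma exists_getElem?_ne (x : List Bool) (p : ℕ) : ∃ j, x[p + 8 * j]? ≠ some true :=
  ⟨x.length, by rw [List.getElem?_eq_none (by omega)]; simp⟩

/-- The number of ones in `x` from position `p` on in steps of eight, up to the first other symbol.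
-/
def runLen (x : List Bool) (p : ℕ) : ℕ := Nat.find (exists_getElem?_ne x p)

lemma runLen_spec (x : List Bool) (p : ℕ) : x[p + 8 * runLen x p]? ≠ some true :=
  Nat.find_spec (exists_getElem?_ne x p)

lemma getElem?_of_lt_runLen {x : List Bool} {p i : ℕ} (hi : i < runLen x p) :
    x[p + 8 * i]? = some true :=
  not_not.1 (Nat.find_min (exists_getElem?_ne x p) hi)

lemma runLen_le (x : List Bool) (p : ℕ) : p + 8 * runLen x p ≤ max p (x.length + 7) := by
  rcases Nat.eq_zero_or_pos (runLen x p) with h | h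
  · simp [h]
  · have := getElem?_of_lt_runLen (x := x) (p := p) (i := runLen x p - 1) (by omega)
    have := (List.getElem?_eq_some_iff.1 this).1
    omega

/-- An eighth of the number of vertices given by the input `x`. -/
def valN (x : List Bool) : ℕ := runLen x 0

/-- An eighth of the clique size given by the input `x`. -/
def valK (x : List Bool) : ℕ := runLen x (8 * valN x + 1)

/-- The position in the input `x` at which the adjacency matrix starts. -/
def base (x : List Bool) : ℕ := 8 * valN x + 1 + 8 * valK x + 1

lemma base_le (x : List Bool) : base x ≤ x.length + 9 := by
  have h1 := runLen_le x 0
  have h2 := runLen_le x (8 * valN x + 1)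
  simp only [base, valN, valK] at *
  omega

/-- The quotient of `n` and `k`, rounded up (and `n` itself if `k = 0`). -/
def quot (n k : ℕ) : ℕ := (n + (k - 1)) / (k - 1 + 1)

lemma quot_zero (k : ℕ) : quot 0 k = 0 := by
  rw [quot, Nat.div_eq_of_lt (by omega)]

lemma quot_succ (n k : ℕ) : quot (n + 1) k = quot (n - (k - 1)) k + 1 := by
  rw [quot, quot, show n + 1 + (k - 1) = n + (k - 1 + 1) by omega,
    Nat.add_div_right _ (by omega)]
  rcases le_total (k - 1) n with h | h
  · rw [Nat.sub_add_cancel h]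
  · rw [Nat.sub_eq_zero_of_le h, zero_add, Nat.div_eq_of_lt (by omega), Nat.div_eq_of_lt (by omega)]

lemma quot_le (n k : ℕ) : quot n k ≤ n := by
  induction n using Nat.strong_induction_on with
  | _ n ih =>
    rcases n with _ | n
    · rw [quot_zero]
    · rw [quot_succ]
      have := ih (n - (k - 1)) (by omega)
      omega

lemma quot_mul (l : ℕ) {k : ℕ} (hk : 0 < k) : quot (l * k) k = l := by
  rw [quot, show k - 1 + 1 = k by omega, Nat.add_comm, Nat.add_mul_div_right _ _ hk,
    Nat.div_eq_of_lt (by omega), zero_add]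

/-- The search for a bit of a simulated string. The matrix `x` has rows of length `W`; `c` rows are
left, the first of which starts at `row`. Rows count only if the bit of `x` at the position `q`,
which advances with the rows, is zero (this is required only if `filt` is set). The wanted bit is
the one with index `a` in the concatenation of the first `w` entries of all rows that count. -/
def scanVal (x : List Bool) (filt : Bool) (W w : ℕ) : ℕ → ℕ → ℕ → ℕ → Option Bool
  | 0, _, _, _ => none
  | c + 1, q, row, a =>
    if filt = false ∨ x[q]? = some false then
      if a < w then some (x[row + a]?.getD false)
      else scanVal x filt W w c (q + 1) (row + W) (a - w)
    else scanVal x filt W w c (q + 1) (row + W) a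

/-- Without the filter, the position `q` does not matter. -/
lemma scanVal_filter_irrel (x : List Bool) (W w : ℕ) : ∀ c q q' row a,
    scanVal x false W w c q row a = scanVal x false W w c q' row a := by
  intro c
  induction c with
  | zero => intros; rfl
  | succ c ih =>
    intro q q' row a
    simp only [scanVal, true_or, if_true]
    rw [ih (q + 1) (q' + 1)]

namespace Cmd

variable {Q T : Type} [DecidableEq T]

/-- Read the parameters from the input: an eighth of the number of vertices into `rN`, an eighth of
the clique size into `rK`, the length of a row of the adjacency matrix into `rW`, and the position
at which this matrix starts into `rP`. -/
def header : Cmd (Reg ⊕ T) (Store Q T) :=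
  .seq (parse .rP .rN) (.seq (inc (.inl .rP)) (.seq (parse .rP .rK) (.seq (inc (.inl .rP))
    (.seq (addConst .rU 8) (mulAdd .rW .rN .rU .rT)))))

/-- Compute in `rL` the quotient of `rN` and `rK`, rounded up. After each subtraction of one,
further `rK - 1` are subtracted; so the loop ends even if `rK` is zero. -/
def divide : Cmd (Reg ⊕ T) (Store Q T) :=
  .seq (add .rD .rN .rT) (.loop (nz .rD) (.seq (dec (.inl .rD)) (.seq (inc (.inl .rL))
    (.seq (add .rU .rK .rT) (.seq (.ite (nz .rU) (dec (.inl .rU)) skip)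
      (.seq (sub .rD .rU) (clear .rU)))))))

/-- Look up the bit with address `a` in the encoding of a pair of numbers, which are given by the
registers `n` and `k`. Beyond the end of this encoding continue with the command `P`. -/
def lookup (a n k : Reg) (P : Cmd (Reg ⊕ T) (Store Q T)) : Cmd (Reg ⊕ T) (Store Q T) :=
  .seq (sub a n) (.ite (nz n) (mapBit fun _ => some true)
    (.ite (nz a) (.seq (dec (.inl a)) (.seq (sub a k) (.ite (nz k) (mapBit fun _ => some true)
      (.ite (nz a) (.seq (dec (.inl a)) P) (mapBit fun _ => some false)))))
      (mapBit fun _ => some false)))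

/-- One round of the search described at `scanVal`. -/
def scanStep (filt : Bool) : Cmd (Reg ⊕ T) (Store Q T) :=
  .seq (dec (.inl .rC))
    (.seq (if filt then .seq (readAt .rQ) (inc (.inl .rQ)) else mapBit fun _ => some false)
    (.seq (.ite (fun σ _ => σ.2.1 == some false)
      (.seq (add .rT .rM .rZ) (.seq (add .rU .rA .rZ) (.seq (sub .rU .rT)
        (.ite (nz .rT)
          (.seq (add .rRow .rA .rZ) (.seq (readAt .rRow) (.seq (mapBit fun b => some (b.getD false))
            (.seq (clear .rC) (clear .rT)))))
          (.seq (clear .rA) (.seq (move .rA .rU) (mapBit fun _ => none)))))))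
      (mapBit fun _ => none))
    (add .rRow .rW .rZ)))

/-- The search described at `scanVal`. -/
def scan (filt : Bool) : Cmd (Reg ⊕ T) (Store Q T) :=
  .seq (mapBit fun _ => none) (.loop (nz .rC) (scanStep filt))

variable {x : List Bool} {ro : ℕ → Bool} {H : ℕ} {s : Option T} {qq : Q}
  {b : Option Bool} {r : Reg → ℕ} {τ : T → WorkTape} {u : ℕ} (hτ : ∀ κ, (τ κ).head ≤ H)
include hτ

lemma exec_header (hr : Small H r) (hN : r .rN = 0) (hK : r .rK = 0) (hP : r .rP = 0)
    (hW : r .rW = 0) (hU : r .rU = 0) (hT : r .rT = 0) (hB : base x + 8 < 2 ^ H) :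
    ∃ b', Exec x ro H (header : Cmd (Reg ⊕ T) (Store Q T)) (regs (qq, b, s) r τ u)
      (regs (qq, b', s) (update (update (update (update r .rP (base x)) .rN (valN x)) .rK (valK x))
        .rW (8 * valN x)) τ u) := by
  have hb : base x = 8 * valN x + 1 + 8 * valK x + 1 := rfl
  obtain ⟨b₁, h₁⟩ := exec_parse (x := x) (ro := ro) (s := s) (qq := qq) (b := b) (u := u) hτ
    (p := .rP) (i := .rN) (by decide) (v := 0) (w := 0) (j := valN x) hr hP hN
    (fun i hi => getElem?_of_lt_runLen hi) (runLen_spec x 0) (by omega) (by omega)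
  simp only [zero_add] at h₁
  have s₁ : Small H (update (update r .rP (8 * valN x)) .rN (valN x)) :=
    (hr.update _ (by omega)).update _ (by omega)
  have h₂ := exec_incReg (x := x) (ro := ro) (σ := (qq, b₁, s)) (u := u) s₁ hτ .rP
    (v := 8 * valN x) (by simp) (by omega)
  have s₂ := s₁.update .rP (v := 8 * valN x + 1) (by omega)
  obtain ⟨b₃, h₃⟩ := exec_parse (x := x) (ro := ro) (s := s) (qq := qq) (b := b₁) (u := u) hτ
    (p := .rP) (i := .rK) (by decide) (v := 8 * valN x + 1) (w := 0) (j := valK x) s₂ (by simp)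
    (by simp [hK]) (fun i hi => getElem?_of_lt_runLen hi) (runLen_spec x _) (by omega) (by omega)
  simp only [zero_add] at h₃
  have s₃ := (s₂.update .rP (v := 8 * valN x + 1 + 8 * valK x) (by omega)).update .rK
    (v := valK x) (by omega)
  have h₄ := exec_incReg (x := x) (ro := ro) (σ := (qq, b₃, s)) (u := u) s₃ hτ .rP
    (v := 8 * valN x + 1 + 8 * valK x) (by simp) (by omega)
  have s₄ := s₃.update .rP (v := 8 * valN x + 1 + 8 * valK x + 1) (by omega)
  have h₅ := exec_addConst (x := x) (ro := ro) (s := s) (qq := qq) (b := b₃) (u := u) hτ .rU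
    (v := 0) (w := 8) s₄ (by simp [hU]) (by omega)
  have s₅ := s₄.update .rU (v := 0 + 8) (by omega)
  have h₆ := exec_mulAdd (x := x) (ro := ro) (σ := (qq, b₃, s)) (u := u) hτ
    (i := .rW) (j := .rN) (k := .rU) (t := .rT) (by decide) (by decide) (by decide) (by decide)
    (by decide) (by decide) (v := 0) (w := valN x) (z := 8) s₅ (by simp [hW]) (by simp) (by simp)
    (by simp [hT]) (by omega)
  refine ⟨b₃, .seq h₁ (.seq h₂ (.seq h₃ (.seq h₄ (.seq h₅ (exec_of_eq h₆ rfl ?_)))))⟩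
  rw [hb]
  funext l
  cases l <;> simp [hU]
  omega

lemma exec_divide {n k : ℕ} (hr : Small H r) (hN : r .rN = n) (hK : r .rK = k) (hD : r .rD = 0)
    (hL : r .rL = 0) (hU : r .rU = 0) (hT : r .rT = 0) :
    Exec x ro H (divide : Cmd (Reg ⊕ T) (Store Q T)) (regs (qq, b, s) r τ u)
      (regs (qq, b, s) (update r .rL (quot n k)) τ u) := by
  have hn := hr .rN
  have hk := hr .rK
  rw [hN] at hn
  rw [hK] at hk
  have key : ∀ d l r, Small H r → r .rD = d → r .rL = l → r .rU = 0 → r .rT = 0 → r .rK = k →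
      l + d < 2 ^ H →
      Exec x ro H (.loop (nz .rD) (.seq (dec (.inl .rD)) (.seq (inc (.inl .rL))
        (.seq (add .rU .rK .rT) (.seq (.ite (nz .rU) (dec (.inl .rU)) skip)
        (.seq (sub .rD .rU) (clear .rU))))))) (regs (qq, b, s) r τ u)
        (regs (qq, b, s) (update (update r .rD 0) .rL (l + quot d k)) τ u) := by
    intro d
    induction d using Nat.strong_induction_on with
    | _ d ih =>
      intro l r hr hD hL hU hT hK hlt
      rcases d with _ | d
      · refine exec_of_eq (r₂ := r) (.loop_false (by simp [nz_regs, hD])) rfl ?_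
        rw [quot_zero, add_zero, ← hD, ← hL]; simp
      · have s₁ := hr.update .rD (v := d) (by omega)
        have s₂ := s₁.update .rL (v := l + 1) (by omega)
        have s₃ := s₂.update .rU (v := 0 + k) (by omega)
        have s₄ := s₂.update .rU (v := k - 1) (by omega)
        have s₅ := (s₄.update .rU (v := k - 1 - d) (by omega)).update .rD (v := d - (k - 1))
          (by omega)
        have e₄ : Exec x ro H (.ite (nz .rU) (dec (.inl .rU)) skip)
            (regs (qq, b, s) (update (update (update r .rD d) .rL (l + 1)) .rU (0 + k)) τ u)
            (regs (qq, b, s) (update (update (update r .rD d) .rL (l + 1)) .rU (k - 1)) τ u) := by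
          rcases k with _ | k
          · exact .ite_false (by simp [nz_regs]) (exec_skip (regs_bdd s₃ hτ))
          · refine .ite_true (by simp [nz_regs]) ?_
            refine exec_of_eq (exec_decReg s₃ hτ .rU (v := k) (by simp)) rfl ?_
            simp
        refine .loop_true (by simp [nz_regs, hD]) (.seq (exec_decReg hr hτ .rD hD)
          (.seq (exec_incReg s₁ hτ .rL (v := l) (by simp [hL]) (by omega))
          (.seq (exec_add hτ (by decide) (by decide) (by decide) (v := 0) (w := k) s₂ (by simp [hU])
            (by simp [hK]) (by simp [hT]) (by omega)) (.seq e₄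
          (.seq (exec_sub hτ (by decide) (v := d) (w := k - 1) s₄ (by simp) (by simp))
            (exec_clear hτ .rU s₅ rfl)))))) ?_
        refine exec_of_eq (ih (d - (k - 1)) (by omega) (l + 1) _ (s₅.update .rU (v := 0) (by omega))
          (by simp) (by simp) (by simp) (by simp [hT]) (by simp [hK]) (by omega)) rfl ?_
        rw [quot_succ]
        funext i
        cases i <;> simp [hU]
        omega
  have h₁ := exec_add (x := x) (ro := ro) (σ := (qq, b, s)) (u := u) hτ (i := .rD) (j := .rN)
    (t := .rT) (by decide) (by decide) (by decide) (v := 0) (w := n) hr hD hN hT (by omega)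
  have s₁ := hr.update .rD (v := 0 + n) (by omega)
  refine .seq h₁ (exec_of_eq (key n 0 _ s₁ (by simp) (by simp [hL]) (by simp [hU]) (by simp [hT])
    (by simp [hK]) (by omega)) rfl ?_)
  funext i
  cases i <;> simp [hD]

omit hτ in
lemma _root_.ClkPC.getElem?_encodePair_append (n k a : ℕ) (l : List Bool) :
    (encodePair n k ++ l)[a]? = if a < n then some true else if a = n then some false else
      if a < n + 1 + k then some true else if a = n + 1 + k then some false else
        l[a - (n + 1 + k + 1)]? := by
  simp only [encodePair, List.append_assoc, List.cons_append, List.getElem?_append,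
    List.length_replicate, List.getElem?_replicate, List.getElem?_cons, List.length_nil,
    Nat.not_lt_zero, if_false, Nat.sub_zero]
  split_ifs <;> first | rfl | omega | (congr 1; omega)

lemma exec_lookup {a n k : Reg} (han : a ≠ n) (hak : a ≠ k) (hnk : n ≠ k) {va vn vk : ℕ}
    {l : List Bool} {P : Cmd (Reg ⊕ T) (Store Q T)} (hr : Small H r) (ha : r a = va) (hn : r n = vn)
    (hk : r k = vk)
    (hP : ∀ v, va = vn + 1 + vk + 1 + v → ∃ r', Small H r' ∧ Exec x ro H P
      (regs (qq, b, s) (update (update (update r n 0) k 0) a v) τ u) (regs (qq, l[v]?, s) r' τ u)) :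
    ∃ r', Small H r' ∧ Exec x ro H (lookup a n k P) (regs (qq, b, s) r τ u)
      (regs (qq, (encodePair vn vk ++ l)[va]?, s) r' τ u) := by
  have hva := hr a
  have hvn := hr n
  have hvk := hr k
  rw [ha] at hva
  rw [hn] at hvn
  rw [hk] at hvk
  rw [getElem?_encodePair_append]
  have h₁ := exec_sub (x := x) (ro := ro) (σ := (qq, b, s)) (u := u) hτ han hr ha hn
  have s₁ := (hr.update n (v := vn - va) (by omega)).update a (v := va - vn) (by omega)
  by_cases c₁ : va < vn
  · rw [if_pos c₁]
    exact ⟨_, s₁, .seq h₁ (.ite_true (by simp [nz_regs, han.symm]; omega)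
      (exec_mapBit hτ s₁ _))⟩
  rw [if_neg c₁]
  have t₁ : nz n (regs (qq, b, s) (update (update r n (vn - va)) a (va - vn)) τ u).store
      (regs (qq, b, s) (update (update r n (vn - va)) a (va - vn)) τ u).views = false := by
    simp [nz_regs, han.symm]; omega
  by_cases c₂ : va = vn
  · rw [if_pos c₂]
    exact ⟨_, s₁, .seq h₁ (.ite_false t₁ (.ite_false (by simp [nz_regs]; omega)
      (exec_mapBit hτ s₁ _)))⟩
  rw [if_neg c₂]
  have t₂ : nz a (regs (qq, b, s) (update (update r n (vn - va)) a (va - vn)) τ u).store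
      (regs (qq, b, s) (update (update r n (vn - va)) a (va - vn)) τ u).views = true := by
    simp [nz_regs]; omega
  have h₂ := exec_decReg (x := x) (ro := ro) (σ := (qq, b, s)) (u := u) s₁ hτ a (v := va - vn - 1)
    (by simp; omega)
  have s₂ := s₁.update a (v := va - vn - 1) (by omega)
  have h₃ := exec_sub (x := x) (ro := ro) (σ := (qq, b, s)) (u := u) hτ hak s₂ (v := va - vn - 1)
    (w := vk) (by simp) (by simp [hak.symm, hnk.symm, hk])
  set v' := va - vn - 1 with hv'
  have s₃ := (s₂.update k (v := vk - v') (by omega)).update a (v := v' - vk) (by omega)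
  by_cases c₃ : va < vn + 1 + vk
  · rw [if_pos c₃]
    exact ⟨_, s₃, .seq h₁ (.ite_false t₁ (.ite_true t₂ (.seq h₂ (.seq h₃ (.ite_true
      (by simp [nz_regs, hak.symm]; omega) (exec_mapBit hτ s₃ _))))))⟩
  rw [if_neg c₃]
  have e₃ : update (update (update (update (update r n (vn - va)) a (va - vn)) a v') k (vk - v')) a
      (v' - vk) = update (update (update r n 0) k 0) a (v' - vk) := by
    rw [show vn - va = 0 by omega, show vk - v' = 0 by omega]
    funext i
    simp only [Function.update_apply]
    split_ifs <;> rfl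
  rw [e₃] at h₃ s₃
  by_cases c₄ : va = vn + 1 + vk
  · rw [if_pos c₄]
    exact ⟨_, s₃, .seq h₁ (.ite_false t₁ (.ite_true t₂ (.seq h₂ (.seq h₃ (.ite_false
      (by simp [nz_regs, hak.symm]) (.ite_false (by simp [nz_regs]; omega)
        (exec_mapBit hτ s₃ _)))))))⟩
  rw [if_neg c₄]
  obtain ⟨r', hr', hP'⟩ := hP (v' - vk - 1) (by omega)
  have h₄ := exec_decReg (x := x) (ro := ro) (σ := (qq, b, s)) (u := u) s₃ hτ a (v := v' - vk - 1)
    (by simp; omega)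
  rw [Function.update_idem] at h₄
  rw [show va - (vn + 1 + vk + 1) = v' - vk - 1 by omega]
  exact ⟨r', hr', .seq h₁ (.ite_false t₁ (.ite_true t₂ (.seq h₂ (.seq h₃ (.ite_false
      (by simp [nz_regs, hak.symm]) (.ite_true (by simp [nz_regs]; omega) (.seq h₄ hP')))))))⟩

end Cmd

namespace Cmd

variable {Q T : Type} [DecidableEq T] {x : List Bool} {ro : ℕ → Bool} {H : ℕ} {s : Option T}
    {qq : Q}
  {b : Option Bool} {r : Reg → ℕ} {τ : T → WorkTape} {u : ℕ} (hτ : ∀ κ, (τ κ).head ≤ H)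
include hτ

/-- The case of a round in which the current row counts. -/
lemma exec_scan_hit {row a w W : ℕ} (hr : Small H r) (hRow : r .rRow = row)
    (hA : r .rA = a) (hM : r .rM = w) (hT : r .rT = 0) (hU : r .rU = 0)
    (hZ : r .rZ = 0) (hb : row + W + w < 2 ^ H) :
    ∃ r', Small H r' ∧ Exec x ro H
      (.seq (add .rT .rM .rZ) (.seq (add .rU .rA .rZ) (.seq (sub .rU .rT)
        (.ite (nz .rT)
          (.seq (add .rRow .rA .rZ) (.seq (readAt .rRow) (.seq (mapBit fun b => some (b.getD false))
            (.seq (clear .rC) (clear .rT)))))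
          (.seq (clear .rA) (.seq (move .rA .rU) (mapBit fun _ => none)))))))
      (regs (qq, b, s) r τ u)
      (regs (qq, if a < w then some (x[row + a]?.getD false) else none, s) r' τ u) ∧
      r' = if a < w then update (update r .rRow (row + a)) .rC 0 else update r .rA (a - w) := by
  have ha := hr .rA
  have hw := hr .rM
  rw [hA] at ha
  rw [hM] at hw
  have s₁ := hr.update .rT (v := 0 + w) (by omega)
  have s₂ := s₁.update .rU (v := 0 + a) (by omega)
  have h₁ := exec_add (x := x) (ro := ro) (σ := (qq, b, s)) (u := u) hτ (i := .rT) (j := .rM)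
    (t := .rZ) (by decide) (by decide) (by decide) (v := 0) (w := w) hr hT hM hZ (by omega)
  have h₂ := exec_add (x := x) (ro := ro) (σ := (qq, b, s)) (u := u) hτ (i := .rU) (j := .rA)
    (t := .rZ) (by decide) (by decide) (by decide) (v := 0) (w := a) s₁ (by simp [hU])
    (by simp [hA]) (by simp [hZ]) (by omega)
  have h₃ := exec_sub (x := x) (ro := ro) (σ := (qq, b, s)) (u := u) hτ (i := .rU) (j := .rT)
    (by decide) s₂ (v := a) (w := w) (by simp) (by simp)
  have s₃ := (s₂.update .rT (v := w - a) (by omega)).update .rU (v := a - w) (by omega)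
  have e₃ : update (update (update (update r .rT (0 + w)) .rU (0 + a)) .rT (w - a)) .rU (a - w) =
      update (update r .rT (w - a)) .rU (a - w) := by
    funext l
    cases l <;> simp
  rw [e₃] at h₃ s₃
  by_cases hc : a < w
  · simp only [hc, if_true]
    have hsmall : Small H (update (update r .rRow (row + a)) .rC 0) :=
      (hr.update _ (by omega)).update _ (by positivity)
    refine ⟨_, hsmall, .seq h₁ (.seq h₂ (.seq h₃ (.ite_true (by simp [nz_regs]; omega) ?_))), rfl⟩
    have h₄ := exec_add (x := x) (ro := ro) (σ := (qq, b, s)) (u := u) hτ (i := .rRow) (j := .rA)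
      (t := .rZ) (by decide) (by decide) (by decide) (v := row) (w := a) s₃ (by simp [hRow])
      (by simp [hA]) (by simp [hZ]) (by omega)
    have s₄ := s₃.update .rRow (v := row + a) (by omega)
    refine .seq h₄ (.seq (exec_readAt .rRow (v := row + a) (by simp)) (.seq (exec_mapBit hτ s₄ _)
      (.seq (exec_clear hτ .rC s₄ rfl)
        (exec_of_eq (exec_clear hτ .rT (s₄.update .rC (v := 0) (by positivity)) rfl) rfl ?_))))
    funext l
    cases l <;> simp [hT, hU]
    omega
  · simp only [hc, if_false]
    have hsmall : Small H (update r .rA (a - w)) := hr.update _ (by omega)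
    refine ⟨_, hsmall, .seq h₁ (.seq h₂ (.seq h₃ (.ite_false (by simp [nz_regs]; omega)
      (.seq (exec_clear hτ .rA s₃ rfl) (.seq (exec_move hτ (by decide)
        (s₃.update .rA (v := 0) (by positivity)) (v := 0) (w := a - w) (by simp) (by simp)
          (by omega))
        (exec_of_eq (exec_mapBit hτ (((s₃.update .rA (v := 0) (by positivity)).update .rU (v := 0)
          (by positivity)).update .rA (v := 0 + (a - w)) (by omega)) _) rfl ?_)))))), rfl⟩
    funext l
    cases l <;> simp [hT, hU]
    omega

/-- The loop carries out the recursion of `scanVal`. A hit ends it, because it sets the counter `rC`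
to zero. Without the filter the register `rQ` does not advance, which is harmless by
`scanVal_filter_irrel`. -/
lemma exec_scan_loop (filt : Bool) {W w : ℕ} : ∀ c q row a r, Small H r → r .rC = c → r .rQ = q →
    r .rRow = row → r .rA = a → r .rM = w → r .rW = W → r .rT = 0 → r .rU = 0 → r .rZ = 0 →
    row + c * W + w < 2 ^ H → q + c < 2 ^ H →
    ∃ r', Small H r' ∧ Exec x ro H (.loop (nz .rC) (scanStep filt)) (regs (qq, none, s) r τ u)
      (regs (qq, scanVal x filt W w c q row a, s) r' τ u) := by
  intro c
  induction c with
  | zero =>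
    intro q row a r hr hC _ _ _ _ _ _ _ _ _ _
    exact ⟨r, hr, .loop_false (by simp [nz_regs, hC])⟩
  | succ c ih =>
    intro q row a r hr hC hQ hRow hA hM hW hT hU hZ hb hq
    rw [Nat.succ_mul] at hb
    have hcW : 0 ≤ c * W := Nat.zero_le _
    have h₁ := exec_decReg (x := x) (ro := ro) (σ := ((qq, none, s) : Store Q T)) (u := u) hr hτ
        .rC hC
    have s₁ := hr.update .rC (v := c) (by omega)
    -- the bit that decides whether the row counts, and the memory after reading it
    obtain ⟨b₂, r₂, hb₂, hr₂, s₂, h₂⟩ : ∃ b₂ r₂,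
        (b₂ = some false ↔ (filt = false ∨ x[q]? = some false)) ∧
        r₂ = update (update r .rC c) .rQ (if filt then q + 1 else q) ∧ Small H r₂ ∧
        Exec x ro H (if filt then .seq (readAt .rQ) (inc (.inl .rQ)) else
          mapBit fun _ => some false)
          (regs (qq, none, s) (update r .rC c) τ u) (regs (qq, b₂, s) r₂ τ u) := by
      cases filt with
      | false =>
        refine ⟨some false, update r .rC c, by simp, ?_, s₁, ?_⟩
        · funext l
          cases l <;> simp [hQ]
        · rw [if_neg Bool.false_ne_true]
          exact exec_mapBit hτ s₁ _
      | true =>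
        refine ⟨x[q]?, _, by simp, rfl, s₁.update .rQ (by simp; omega), ?_⟩
        exact .seq (exec_readAt .rQ (v := q) (by simp [hQ]))
          (exec_incReg s₁ hτ .rQ (v := q) (by simp [hQ]) (by omega))
    by_cases hit : filt = false ∨ x[q]? = some false
    · obtain ⟨r₃, s₃, h₃, hr₃⟩ := exec_scan_hit (x := x) (ro := ro) (s := s) (qq := qq) (b := b₂)
        (u := u) (row := row) (a := a) (w := w) (W := W) hτ s₂
        (by simp [hr₂, hRow]) (by simp [hr₂, hA]) (by simp [hr₂, hM]) (by simp [hr₂, hT])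
        (by simp [hr₂, hU]) (by simp [hr₂, hZ]) (by omega)
      by_cases haw : a < w
      · simp only [haw, if_true] at hr₃ h₃
        have h₄ := exec_add (x := x) (ro := ro)
          (σ := (qq, some (x[row + a]?.getD false), s)) (u := u) hτ (i := .rRow) (j := .rW)
          (t := .rZ) (by decide) (by decide) (by decide) (v := row + a) (w := W) s₃
          (by simp [hr₃]) (by simp [hr₃, hr₂, hW]) (by simp [hr₃, hr₂, hZ]) (by omega)
        refine ⟨_, s₃.update .rRow (v := row + a + W) (by omega), ?_⟩
        rw [scanVal, if_pos hit, if_pos haw]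
        refine .loop_true (by simp [nz_regs, hC]) (.seq h₁ (.seq h₂ (.seq (.ite_true ?_ h₃) h₄)))
          (.loop_false ?_)
        · simpa [regs] using hb₂.2 hit
        · simp [nz_regs, hr₃]
      · simp only [haw, if_false] at hr₃ h₃
        have h₄ := exec_add (x := x) (ro := ro)
          (σ := ((qq, none, s) : Store Q T)) (u := u) hτ (i := .rRow) (j := .rW)
          (t := .rZ) (by decide) (by decide) (by decide) (v := row) (w := W) s₃
          (by simp [hr₃, hr₂, hRow]) (by simp [hr₃, hr₂, hW]) (by simp [hr₃, hr₂, hZ]) (by omega)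
        have s₄ := s₃.update .rRow (v := row + W) (by omega)
        obtain ⟨r', hr', h'⟩ := ih (if filt then q + 1 else q) (row + W) (a - w) _ s₄
          (by simp [hr₃, hr₂]) (by simp [hr₃, hr₂]) (by simp) (by simp [hr₃])
          (by simp [hr₃, hr₂, hM]) (by simp [hr₃, hr₂, hW]) (by simp [hr₃, hr₂, hT])
          (by simp [hr₃, hr₂, hU]) (by simp [hr₃, hr₂, hZ]) (by omega) (by split_ifs <;> omega)
        refine ⟨r', hr', ?_⟩
        rw [scanVal, if_pos hit, if_neg haw]
        have hq' : scanVal x filt W w c (if filt then q + 1 else q) (row + W) (a - w) =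
            scanVal x filt W w c (q + 1) (row + W) (a - w) := by
          cases filt with
          | true => rfl
          | false => exact scanVal_filter_irrel x W w c _ _ _ _
        rw [hq'] at h'
        refine .loop_true (by simp [nz_regs, hC]) (.seq h₁ (.seq h₂ (.seq (.ite_true ?_ h₃) h₄))) h'
        simpa [regs] using hb₂.2 hit
    · have hf : filt = true := by
        by_contra h
        exact hit (Or.inl (by simpa using h))
      have h₃ := exec_mapBit (x := x) (ro := ro) (s := s) (qq := qq) (b := b₂) (u := u) hτ s₂
        (fun _ => none)
      have h₄ := exec_add (x := x) (ro := ro)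
        (σ := ((qq, none, s) : Store Q T)) (u := u) hτ (i := .rRow) (j := .rW)
        (t := .rZ) (by decide) (by decide) (by decide) (v := row) (w := W) s₂
        (by simp [hr₂, hRow]) (by simp [hr₂, hW]) (by simp [hr₂, hZ]) (by omega)
      have s₄ := s₂.update .rRow (v := row + W) (by omega)
      obtain ⟨r', hr', h'⟩ := ih (q + 1) (row + W) a _ s₄
        (by simp [hr₂]) (by simp [hr₂, hf]) (by simp) (by simp [hr₂, hA])
        (by simp [hr₂, hM]) (by simp [hr₂, hW]) (by simp [hr₂, hT])
        (by simp [hr₂, hU]) (by simp [hr₂, hZ]) (by omega) (by omega)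
      refine ⟨r', hr', ?_⟩
      rw [scanVal, if_neg hit]
      refine .loop_true (by simp [nz_regs, hC]) (.seq h₁ (.seq h₂ (.seq (.ite_false ?_ h₃) h₄))) h'
      have : b₂ ≠ some false := fun h => hit (hb₂.1 h)
      simpa [regs] using this

lemma exec_scan (filt : Bool) {W w c q row a : ℕ} (hr : Small H r) (hC : r .rC = c)
    (hQ : r .rQ = q) (hRow : r .rRow = row) (hA : r .rA = a) (hM : r .rM = w) (hW : r .rW = W)
    (hT : r .rT = 0) (hU : r .rU = 0) (hZ : r .rZ = 0) (hb : row + c * W + w < 2 ^ H)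
    (hq : q + c < 2 ^ H) :
    ∃ r', Small H r' ∧ Exec x ro H (scan filt) (regs (qq, b, s) r τ u)
      (regs (qq, scanVal x filt W w c q row a, s) r' τ u) := by
  obtain ⟨r', hr', h'⟩ := exec_scan_loop (x := x) (ro := ro) (s := s) (qq := qq) (u := u) hτ filt
    c q row a r hr hC hQ hRow hA hM hW hT hU hZ hb hq
  exact ⟨r', hr', .seq (exec_mapBit hτ hr _) h'⟩

end Cmd

/-! ### The simulated strings -/

/-- The input of the algorithm that computes the clique size of the simulated instance. -/
def pairInput (x : List Bool) : List Bool := encodePair (valN x) (valK x)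

/-- The block length given by the input `x`. -/
def valL (x : List Bool) : ℕ := quot (valN x) (valK x)

/-- The simulated instance of clique size `y`: it consists of the first rows and columns of the
matrix in the input. -/
def instanceInput (x : List Bool) (y : ℕ) : List Bool :=
  encodePair (valL x * y) y ++ List.ofFn fun i : Fin ((valL x * y) * (valL x * y)) =>
    x[base x + i.divNat * (8 * valN x) + i.modNat]?.getD false

/-- The simulated multiple access random string. Its bits are entries of the matrix in the last
eighth of the columns, in those rows after the first eighth and before the last one that belong to
vertices not adjacent to the first vertex. -/
def instanceBits (x : List Bool) (a : ℕ) : Bool :=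
  (scanVal x true (8 * valN x) (valN x) (6 * valN x) (base x + valN x)
    (base x + valN x * (8 * valN x) + 7 * valN x) a).getD false

/-- If all rows count, then the search looks up an entry of the list of the first `w` entries of all
rows. -/
lemma scanVal_eq_ofFn (x : List Bool) (W w c₀ : ℕ) (f : Fin (c₀ * w) → Bool) (row₀ : ℕ)
    (hf : ∀ i, f i = x[row₀ + i.divNat * W + i.modNat]?.getD false) :
    ∀ c c', c' + c = c₀ → ∀ q a, scanVal x false W w c q (row₀ + c' * W) a =
      (List.ofFn f)[c' * w + a]? := by
  intro c
  induction c with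
  | zero =>
    intro c' hc q a
    obtain rfl : c' = c₀ := by omega
    rw [scanVal, List.getElem?_eq_none (by simp)]
  | succ c ih =>
    intro c' hc q a
    have hle : (c' + 1) * w ≤ c₀ * w := Nat.mul_le_mul_right _ (by omega)
    rw [Nat.succ_mul] at hle
    simp only [scanVal, true_or, if_true]
    split_ifs with haw
    · have hlt : c' * w + a < c₀ * w := by omega
      rw [List.getElem?_ofFn, dif_pos hlt, hf]
      have h1 : ((⟨c' * w + a, hlt⟩ : Fin (c₀ * w)).divNat : ℕ) = c' := by
        rw [Fin.coe_divNat]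
        show (c' * w + a) / w = c'
        rw [Nat.add_comm, Nat.add_mul_div_right _ _ (by omega), Nat.div_eq_of_lt haw, zero_add]
      have h2 : ((⟨c' * w + a, hlt⟩ : Fin (c₀ * w)).modNat : ℕ) = a := by
        rw [Fin.coe_modNat]
        show (c' * w + a) % w = a
        rw [Nat.add_comm, Nat.add_mul_mod_self_right, Nat.mod_eq_of_lt haw]
      rw [h1, h2]
    · rw [show row₀ + c' * W + W = row₀ + (c' + 1) * W by ring, ih (c' + 1) (by omega)]
      congr 1
      rw [Nat.succ_mul]
      omega

namespace Cmd

variable {Q T : Type} [DecidableEq T]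

/-- The selected tape. -/
def selTape (σ : Store Q T) : Reg ⊕ T := σ.2.2.elim (.inl .rZ) .inr

/-- Answer a query to `pairInput`. -/
def readPair : Cmd (Reg ⊕ T) (Store Q T) :=
  .seq (fetch selTape .rA .rC .rT .rZ) (.seq header
    (.seq (lookup .rA .rN .rK (mapBit fun _ => none)) clearAll))

/-- Answer a query to `instanceInput`, with the clique size being the value of the tape `out`. -/
def readInstance (out : T) : Cmd (Reg ⊕ T) (Store Q T) :=
  .seq (fetch selTape .rA .rC .rT .rZ) (.seq (fetch (fun _ => .inr out) .rY .rC .rT .rZ)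
    (.seq header (.seq divide (.seq (add .rD .rY .rT) (.seq (mulAdd .rM .rL .rD .rT)
    (.seq (add .rC .rM .rT) (.seq (add .rU .rM .rT) (.seq (add .rRow .rP .rT)
    (.seq (lookup .rA .rU .rY (scan false)) clearAll)))))))))

/-- Answer a query to `instanceBits`. -/
def readBits : Cmd (Reg ⊕ T) (Store Q T) :=
  .seq (fetch selTape .rA .rC .rT .rZ) (.seq header
    (.seq (add .rQ .rP .rT) (.seq (add .rQ .rN .rT)
    (.seq (add .rRow .rP .rT) (.seq (addConst .rU 7) (.seq (mulAdd .rRow .rN .rU .rT)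
    (.seq (add .rU .rN .rT) (.seq (mulAdd .rRow .rW .rU .rT)
    (.seq (addConst .rU 6) (.seq (mulAdd .rC .rN .rU .rT) (.seq (add .rM .rN .rT)
    (.seq (scan true) (.seq (mapBit fun b => some (b.getD false)) clearAll)))))))))))))

variable {x : List Bool} {ro : ℕ → Bool} {H : ℕ} {qq : Q}
  {b : Option Bool} {τ : T → WorkTape} {u : ℕ} (hτ : ∀ κ, (τ κ).head ≤ H)
include hτ

omit [DecidableEq T] in
lemma tape_value_lt (κ : T) : (τ κ).value < 2 ^ H :=
  (τ κ).value_lt.trans_le (Nat.pow_le_pow_right (by norm_num) (hτ κ))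

lemma exec_readPair (κ : T) (hB : base x + 8 < 2 ^ H) :
    Exec x ro H (readPair : Cmd (Reg ⊕ T) (Store Q T)) (regs (qq, b, some κ) (fun _ => 0) τ u)
      (regs (qq, (pairInput x)[(τ κ).value]?, some κ) (fun _ => 0) τ u) := by
  have s₀ : Small H fun _ => 0 := fun _ => by positivity
  have hv := tape_value_lt hτ κ
  have hb : base x = 8 * valN x + 1 + 8 * valK x + 1 := rfl
  have h₁ := exec_fetch (x := x) (ro := ro) (s := some κ) (qq := qq) (b := b) (u := u)
    (κ := selTape) (κ₀ := κ) rfl (a := .rA) (c := .rC) (t := .rT) (z := .rZ) (by decide) (by decide)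
    (by decide) (by decide) (by decide) (by decide) hτ s₀ rfl rfl rfl rfl
  have s₁ := s₀.update .rA hv
  obtain ⟨b₂, h₂⟩ := exec_header (x := x) (ro := ro) (s := some κ) (qq := qq) (b := b) (u := u)
    hτ s₁ (by simp) (by simp) (by simp) (by simp) (by simp) (by simp) hB
  have s₂ := (((s₁.update .rP (v := base x) (by omega)).update .rN (v := valN x) (by omega)).update
    .rK (v := valK x) (by omega)).update .rW (v := 8 * valN x) (by omega)
  obtain ⟨r', hr', h₃⟩ := exec_lookup (x := x) (ro := ro) (s := some κ) (qq := qq) (b := b₂)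
    (u := u) hτ (a := .rA) (n := .rN) (k := .rK) (by decide) (by decide) (by decide)
    (va := (τ κ).value) (vn := valN x) (vk := valK x) (l := []) (P := mapBit fun _ => none) s₂
    (by simp) (by simp) (by simp)
    (fun v hv' => ⟨_, ((s₂.update _ (by positivity)).update _ (by positivity)).update _ (by omega),
      exec_mapBit hτ (((s₂.update _ (by positivity)).update _ (by positivity)).update _ (by omega))
        _⟩)
  rw [List.append_nil] at h₃
  exact .seq h₁ (.seq h₂ (.seq h₃ (exec_clearAll hτ hr')))

lemma exec_readInstance (out κ : T) {y : ℕ} (hy : (τ out).value = y)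
    (hB : base x + 8 + valL x * y * (8 * valN x) + valL x * y < 2 ^ H) :
    Exec x ro H (readInstance out : Cmd (Reg ⊕ T) (Store Q T))
      (regs (qq, b, some κ) (fun _ => 0) τ u)
      (regs (qq, (instanceInput x y)[(τ κ).value]?, some κ) (fun _ => 0) τ u) := by
  have s₀ : Small H fun _ => 0 := fun _ => by positivity
  have hv := tape_value_lt hτ κ
  have hyH := tape_value_lt hτ out
  rw [hy] at hyH
  have hb : base x = 8 * valN x + 1 + 8 * valK x + 1 := rfl
  have h₁ := exec_fetch (x := x) (ro := ro) (s := some κ) (qq := qq) (b := b) (u := u)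
    (κ := selTape) (κ₀ := κ) rfl (a := .rA) (c := .rC) (t := .rT) (z := .rZ) (by decide) (by decide)
    (by decide) (by decide) (by decide) (by decide) hτ s₀ rfl rfl rfl rfl
  have s₁ := s₀.update .rA hv
  have h₁' := exec_fetch (x := x) (ro := ro) (s := some κ) (qq := qq) (b := b) (u := u)
    (κ := fun _ => .inr out) (κ₀ := out) rfl (a := .rY) (c := .rC) (t := .rT) (z := .rZ)
    (by decide) (by decide) (by decide) (by decide) (by decide) (by decide) hτ s₁ (by simp)
    (by simp) (by simp) (by simp)
  rw [hy] at h₁'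
  have s₁' := s₁.update .rY hyH
  obtain ⟨b₂, h₂⟩ := exec_header (x := x) (ro := ro) (s := some κ) (qq := qq) (b := b) (u := u)
    hτ s₁' (by simp) (by simp) (by simp) (by simp) (by simp) (by simp) (by omega)
  have s₂ := (((s₁'.update .rP (v := base x) (by omega)).update .rN (v := valN x) (by omega)).update
    .rK (v := valK x) (by omega)).update .rW (v := 8 * valN x) (by omega)
  have h₃ := exec_divide (x := x) (ro := ro) (s := some κ) (qq := qq) (b := b₂) (u := u) hτ
    (n := valN x) (k := valK x) s₂ (by simp) (by simp) (by simp) (by simp) (by simp) (by simp)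
  have hL : valL x ≤ valN x := quot_le _ _
  have s₃ := s₂.update .rL (v := valL x) (by omega)
  have h₄ := exec_add (x := x) (ro := ro) (σ := ((qq, b₂, some κ) : Store Q T)) (u := u) hτ
    (i := .rD) (j := .rY) (t := .rT) (by decide) (by decide) (by decide) (v := 0) (w := y) s₃
    (by simp) (by simp) (by simp) (by omega)
  have s₄ := s₃.update .rD (v := 0 + y) (by omega)
  have h₅ := exec_mulAdd (x := x) (ro := ro) (σ := ((qq, b₂, some κ) : Store Q T)) (u := u) hτ
    (i := .rM) (j := .rL) (k := .rD) (t := .rT) (by decide) (by decide) (by decide) (by decide)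
    (by decide) (by decide) (v := 0) (w := valL x) (z := y) s₄ (by simp) (by simp [valL]) (by simp)
    (by simp) (by omega)
  set m := valL x * y with hm
  have s₅ := (s₄.update .rD (v := 0) (by positivity)).update .rM (v := 0 + m) (by omega)
  have h₆ := exec_add (x := x) (ro := ro) (σ := ((qq, b₂, some κ) : Store Q T)) (u := u) hτ
    (i := .rC) (j := .rM) (t := .rT) (by decide) (by decide) (by decide) (v := 0) (w := m) s₅
    (by simp) (by simp) (by simp) (by omega)
  have s₆ := s₅.update .rC (v := 0 + m) (by omega)
  have h₇ := exec_add (x := x) (ro := ro) (σ := ((qq, b₂, some κ) : Store Q T)) (u := u) hτ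
    (i := .rU) (j := .rM) (t := .rT) (by decide) (by decide) (by decide) (v := 0) (w := m) s₆
    (by simp) (by simp) (by simp) (by omega)
  have s₇ := s₆.update .rU (v := 0 + m) (by omega)
  have h₈ := exec_add (x := x) (ro := ro) (σ := ((qq, b₂, some κ) : Store Q T)) (u := u) hτ
    (i := .rRow) (j := .rP) (t := .rT) (by decide) (by decide) (by decide) (v := 0) (w := base x) s₇
    (by simp) (by simp) (by simp) (by omega)
  have s₈ := s₇.update .rRow (v := 0 + base x) (by omega)
  obtain ⟨r', hr', h₉⟩ := exec_lookup (x := x) (ro := ro) (s := some κ) (qq := qq) (b := b₂)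
    (u := u) hτ (a := .rA) (n := .rU) (k := .rY) (by decide) (by decide) (by decide)
    (va := (τ κ).value) (vn := m) (vk := y)
    (l := List.ofFn fun i : Fin (m * m) =>
      x[base x + i.divNat * (8 * valN x) + i.modNat]?.getD false) (P := scan false) s₈
    (by simp) (by simp) (by simp)
    (fun v hv' => by
      have e := scanVal_eq_ofFn x (8 * valN x) m m _ (base x) (fun _ => rfl) m 0 (by simp) 0 v
      rw [zero_mul, zero_mul, zero_add, add_zero] at e
      rw [← e]
      exact exec_scan hτ false (((s₈.update _ (by positivity)).update _ (by positivity)).update _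
        (by omega)) (c := m) (q := 0) (row := base x) (a := v) (w := m) (W := 8 * valN x) (by simp)
        (by simp) (by simp) (by simp) (by simp) (by simp) (by simp) (by simp) (by simp)
        (by omega) (by omega))
  exact .seq h₁ (.seq h₁' (.seq h₂ (.seq h₃ (.seq h₄ (.seq h₅ (.seq h₆ (.seq h₇ (.seq h₈
    (.seq h₉ (exec_clearAll hτ hr'))))))))))

lemma exec_readBits (κ : T) (hB : base x + 8 + valN x * (8 * valN x) + 8 * valN x +
      6 * valN x * (8 * valN x) < 2 ^ H) :
    Exec x ro H (readBits : Cmd (Reg ⊕ T) (Store Q T)) (regs (qq, b, some κ) (fun _ => 0) τ u)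
      (regs (qq, some (instanceBits x (τ κ).value), some κ) (fun _ => 0) τ u) := by
  have s₀ : Small H fun _ => 0 := fun _ => by positivity
  have hv := tape_value_lt hτ κ
  have hb : base x = 8 * valN x + 1 + 8 * valK x + 1 := rfl
  have hsq : valN x * (8 * valN x) = 8 * valN x * valN x := by ring
  set n := valN x with hn
  have h₁ := exec_fetch (x := x) (ro := ro) (s := some κ) (qq := qq) (b := b) (u := u)
    (κ := selTape) (κ₀ := κ) rfl (a := .rA) (c := .rC) (t := .rT) (z := .rZ) (by decide) (by decide)
    (by decide) (by decide) (by decide) (by decide) hτ s₀ rfl rfl rfl rfl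
  have s₁ := s₀.update .rA hv
  obtain ⟨b₂, h₂⟩ := exec_header (x := x) (ro := ro) (s := some κ) (qq := qq) (b := b) (u := u)
    hτ s₁ (by simp) (by simp) (by simp) (by simp) (by simp) (by simp) (by omega)
  have s₂ := (((s₁.update .rP (v := base x) (by omega)).update .rN (v := n) (by omega)).update
    .rK (v := valK x) (by omega)).update .rW (v := 8 * n) (by omega)
  have h₃ := exec_add (x := x) (ro := ro) (σ := ((qq, b₂, some κ) : Store Q T)) (u := u) hτ
    (i := .rQ) (j := .rP) (t := .rT) (by decide) (by decide) (by decide) (v := 0) (w := base x) s₂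
    (by simp) (by simp) (by simp) (by omega)
  have s₃ := s₂.update .rQ (v := 0 + base x) (by omega)
  have h₄ := exec_add (x := x) (ro := ro) (σ := ((qq, b₂, some κ) : Store Q T)) (u := u) hτ
    (i := .rQ) (j := .rN) (t := .rT) (by decide) (by decide) (by decide) (v := base x) (w := n) s₃
    (by simp) (by simp) (by simp) (by omega)
  have s₄ := s₃.update .rQ (v := base x + n) (by omega)
  have h₅ := exec_add (x := x) (ro := ro) (σ := ((qq, b₂, some κ) : Store Q T)) (u := u) hτ
    (i := .rRow) (j := .rP) (t := .rT) (by decide) (by decide) (by decide) (v := 0) (w := base x) s₄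
    (by simp) (by simp) (by simp) (by omega)
  have s₅ := s₄.update .rRow (v := 0 + base x) (by omega)
  have h₆ := exec_addConst (x := x) (ro := ro) (s := some κ) (qq := qq) (b := b₂) (u := u) hτ .rU
    (v := 0) (w := 7) s₅ (by simp) (by omega)
  have s₆ := s₅.update .rU (v := 0 + 7) (by omega)
  have h₇ := exec_mulAdd (x := x) (ro := ro) (σ := ((qq, b₂, some κ) : Store Q T)) (u := u) hτ
    (i := .rRow) (j := .rN) (k := .rU) (t := .rT) (by decide) (by decide) (by decide) (by decide)
    (by decide) (by decide) (v := base x) (w := n) (z := 7) s₆ (by simp) (by simp) (by simp)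
    (by simp) (by omega)
  have s₇ := (s₆.update .rU (v := 0) (by positivity)).update .rRow (v := base x + n * 7) (by omega)
  have h₈ := exec_add (x := x) (ro := ro) (σ := ((qq, b₂, some κ) : Store Q T)) (u := u) hτ
    (i := .rU) (j := .rN) (t := .rT) (by decide) (by decide) (by decide) (v := 0) (w := n) s₇
    (by simp) (by simp) (by simp) (by omega)
  have s₈ := s₇.update .rU (v := 0 + n) (by omega)
  have h₉ := exec_mulAdd (x := x) (ro := ro) (σ := ((qq, b₂, some κ) : Store Q T)) (u := u) hτ
    (i := .rRow) (j := .rW) (k := .rU) (t := .rT) (by decide) (by decide) (by decide) (by decide)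
    (by decide) (by decide) (v := base x + n * 7) (w := 8 * n) (z := n) s₈ (by simp) (by simp)
    (by simp) (by simp) (by omega)
  have s₉ := (s₈.update .rU (v := 0) (by positivity)).update .rRow
    (v := base x + n * 7 + 8 * n * n) (by omega)
  have h₁₀ := exec_addConst (x := x) (ro := ro) (s := some κ) (qq := qq) (b := b₂) (u := u) hτ .rU
    (v := 0) (w := 6) s₉ (by simp) (by omega)
  have s₁₀ := s₉.update .rU (v := 0 + 6) (by omega)
  have h₁₁ := exec_mulAdd (x := x) (ro := ro) (σ := ((qq, b₂, some κ) : Store Q T)) (u := u) hτ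
    (i := .rC) (j := .rN) (k := .rU) (t := .rT) (by decide) (by decide) (by decide) (by decide)
    (by decide) (by decide) (v := 0) (w := n) (z := 6) s₁₀ (by simp) (by simp)
    (by simp) (by simp) (by omega)
  have s₁₁ := (s₁₀.update .rU (v := 0) (by positivity)).update .rC (v := 0 + n * 6) (by omega)
  have h₁₂ := exec_add (x := x) (ro := ro) (σ := ((qq, b₂, some κ) : Store Q T)) (u := u) hτ
    (i := .rM) (j := .rN) (t := .rT) (by decide) (by decide) (by decide) (v := 0) (w := n) s₁₁
    (by simp) (by simp) (by simp) (by omega)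
  have s₁₂ := s₁₁.update .rM (v := 0 + n) (by omega)
  obtain ⟨r', hr', h₁₃⟩ := exec_scan (x := x) (ro := ro) (s := some κ) (qq := qq) (b := b₂)
    (u := u) hτ true s₁₂ (c := 6 * n) (q := base x + n) (row := base x + n * (8 * n) + 7 * n)
    (a := (τ κ).value) (w := n) (W := 8 * n) (by simp; ring) (by simp) (by simp; ring) (by simp)
    (by simp) (by simp) (by simp) (by simp) (by simp) (by omega) (by omega)
  exact .seq h₁ (.seq h₂ (.seq h₃ (.seq h₄ (.seq h₅ (.seq h₆ (.seq h₇ (.seq h₈ (.seq h₉ (.seq h₁₀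
    (.seq h₁₁ (.seq h₁₂ (.seq h₁₃ (.seq (exec_mapBit hτ hr' _) (exec_clearAll hτ hr'))))))))))))))

end Cmd

/-! ### Simulation of a machine on virtual random access strings -/

namespace Machine

variable {M : Machine}

/-- One step of `M` when the input is given by the function `inp`. -/
def virtualStep (inp : ℕ → Option Bool) (ro ma : ℕ → Bool) (c : M.Config) : M.Config :=
  match c.action with
  | .work q w d => { c with state := q, tapes := fun κ => (c.tapes κ).act (w κ) (d κ) }
  | .readInput κ q => { c with state := q (inp (c.tapes κ).value) }
  | .readMultiAccess κ q => { c with state := q (ma (c.tapes κ).value) }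
  | .readOnce q => { c with state := q (ro c.used), used := c.used + 1 }
  | .halt _ => c

end Machine

/-- The action is to write on the tapes. -/
def Action.isWork {K Q : Type} : Action K Q → Bool
  | .work _ _ _ => true
  | _ => false

/-- The action is to read a bit of the read-once random string. -/
def Action.isReadOnce {K Q : Type} : Action K Q → Bool
  | .readOnce _ => true
  | _ => false

/-- The action is to read an input bit. -/
def Action.isReadInput {K Q : Type} : Action K Q → Bool
  | .readInput _ _ => true
  | _ => false

/-- The action is to halt. -/
def Action.isHalt {K Q : Type} : Action K Q → Bool
  | .halt _ => true
  | _ => false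

/-- The tape that holds the address at which the action reads. -/
def Action.addr {K Q : Type} : Action K Q → Option K
  | .readInput κ _ => some κ
  | .readMultiAccess κ _ => some κ
  | _ => none

/-- The output bit of a halting action. -/
def Action.output {K Q : Type} : Action K Q → Bool
  | .halt b => b
  | _ => false

namespace Cmd

open scoped Classical

variable {M : Machine}

/-- The action of the simulated machine. -/
def simAction (σ : Store M.State M.Tapes) (v : Views (Reg ⊕ M.Tapes)) : Action M.Tapes M.State :=
  M.trans σ.1 fun κ => v (.inr κ)

/-- Simulate one step of `M`, where the input of `M` is either `pairInput` or, in the states in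
which `late` holds, `instanceInput` for the clique size on the tape `out`, and where the multiple
access random string is `instanceBits`. -/
def simStep (late : M.State → Bool) (out : M.Tapes) :
    Cmd (Reg ⊕ M.Tapes) (Store M.State M.Tapes) :=
  .ite (fun σ v => (simAction σ v).isWork)
    (.work fun σ v => match simAction σ v with
      | .work q w d => ((q, σ.2), Sum.elim (fun i => (v (.inl i)).1) w, Sum.elim (fun _ => .stay) d)
      | _ => (σ, fun κ => (v κ).1, fun _ => .stay))
    (.ite (fun σ v => (simAction σ v).isReadOnce)
      (.readOnce fun σ v b => match simAction σ v with
        | .readOnce n => (n b, σ.2)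
        | _ => σ)
      (.seq (setStore fun σ v => (σ.1, σ.2.1, (simAction σ v).addr))
        (.seq (.ite (fun σ v => (simAction σ v).isReadInput)
          (.ite (fun σ _ => late σ.1) (readInstance out) readPair) readBits)
          (setStore fun σ v => match simAction σ v with
            | .readInput _ n => (n σ.2.1, none, none)
            | .readMultiAccess _ n => (n (σ.2.1.getD false), none, none)
            | _ => σ))))

/-- Simulate `M` until it halts, and store its output bit. -/
def sim (late : M.State → Bool) (out : M.Tapes) :
    Cmd (Reg ⊕ M.Tapes) (Store M.State M.Tapes) :=
  .seq (.loop (fun σ v => !(simAction σ v).isHalt) (simStep late out))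
    (setStore fun σ v => (σ.1, some (simAction σ v).output, none))

/-- The memory that represents a configuration of the simulated machine. -/
def simMem (c : M.Config) : Mem (Reg ⊕ M.Tapes) (Store M.State M.Tapes) :=
  regs (c.state, none, none) (fun _ => 0) c.tapes c.used

/-- The virtual input of the simulated machine. -/
def simInput (late : M.State → Bool) (out : M.Tapes) (x : List Bool) (c : M.Config) :
    ℕ → Option Bool :=
  fun i => if late c.state then (instanceInput x (c.tapes out).value)[i]? else (pairInput x)[i]?

/-- The heads of the configuration and all numbers that come up in a simulation of its next step are
within the bound `H`. -/
structure Fits (x : List Bool) (out : M.Tapes) (H : ℕ) (c : M.Config) : Prop where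
  head_le : ∀ κ, (c.tapes κ).head ≤ H
  readInstance_lt : base x + 8 + valL x * (c.tapes out).value * (8 * valN x) +
    valL x * (c.tapes out).value < 2 ^ H
  readBits_lt : base x + 8 + valN x * (8 * valN x) + 8 * valN x + 6 * valN x * (8 * valN x) < 2 ^ H

variable {late : M.State → Bool} {out : M.Tapes} {x : List Bool} {ro : ℕ → Bool} {H : ℕ}

lemma exec_work_of_eq {K F : Type} {f : F → Views K → F × (K → Option Bool) × (K → Dir)}
    {m m' : Mem K F} (h : m.doWork (f m.store m.views) = m') (hb : m'.Bdd H) :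
    Exec x ro H (.work f) m m' := by
  subst h
  exact .work hb

lemma simMem_bdd {c : M.Config} (hc : ∀ κ, (c.tapes κ).head ≤ H) : (simMem c).Bdd H :=
  regs_bdd (fun _ => by positivity) hc

lemma exec_simStep {c : M.Config} (hc : Fits x out H c)
    (hc' : ∀ κ, ((M.virtualStep (simInput late out x c) ro (instanceBits x) c).tapes κ).head ≤ H)
    (hh : c.action.isHalt = false) :
    Exec x ro H (simStep late out) (simMem c)
      (simMem (M.virtualStep (simInput late out x c) ro (instanceBits x) c)) := by
  have hact : simAction (simMem c).store (simMem c).views = c.action := rfl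
  unfold Machine.virtualStep at hc' ⊢
  cases h : c.action with
  | work q w d =>
    rw [h] at hc'
    refine .ite_true (by rw [hact, h]; rfl) ?_
    refine exec_work_of_eq ?_ (simMem_bdd hc')
    simp only [hact, h]
    simp only [Mem.doWork, simMem, regs, Mem.mk.injEq, true_and, and_true]
    funext κ
    rcases κ with i | κ
    · exact WorkTape.act_stay (natTape 0)
    · rfl
  | readOnce n =>
    refine .ite_false (by rw [hact, h]; rfl) (.ite_true (by rw [hact, h]; rfl) ?_)
    have := Exec.readOnce (x := x) (ro := ro) (H := H) (m := simMem c)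
      (f := fun σ v b => match simAction σ v with
        | .readOnce n => (n b, σ.2)
        | _ => σ)
    rw [hact, h] at this
    exact this
  | readInput κ n =>
    refine .ite_false (by rw [hact, h]; rfl) (.ite_false (by rw [hact, h]; rfl) ?_)
    have h₁ := exec_setStore (x := x) (ro := ro) (simMem_bdd hc.head_le)
      (fun σ v => (σ.1, σ.2.1, (simAction σ v).addr))
    rw [hact, h] at h₁
    refine .seq h₁ ?_
    have hact' : ∀ b, simAction (regs ((c.state, b, some κ) : Store M.State M.Tapes)
      (fun _ => 0) c.tapes c.used).store (regs ((c.state, b, some κ) : Store M.State M.Tapes)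
      (fun _ => 0) c.tapes c.used).views = .readInput κ n := fun _ => h
    have h₃ : ∀ b, Exec x ro H (setStore fun σ v => match simAction σ v with
            | .readInput _ n => (n σ.2.1, none, none)
            | .readMultiAccess _ n => (n (σ.2.1.getD false), none, none)
            | _ => σ) (regs ((c.state, b, some κ) : Store M.State M.Tapes)
      (fun _ => 0) c.tapes c.used) (regs ((n b, none, none) : Store M.State M.Tapes)
      (fun _ => 0) c.tapes c.used) := fun b => by
      have := exec_setStore (x := x) (ro := ro) (H := H)
        (m := regs ((c.state, b, some κ) : Store M.State M.Tapes) (fun _ => 0) c.tapes c.used)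
        (regs_bdd (fun _ => by positivity) hc.head_le) (fun σ v => match simAction σ v with
            | .readInput _ n => (n σ.2.1, none, none)
            | .readMultiAccess _ n => (n (σ.2.1.getD false), none, none)
            | _ => σ)
      rw [hact'] at this
      exact this
    refine .seq (.ite_true (m' := regs (c.state, simInput late out x c (c.tapes κ).value, some κ)
      (fun _ => 0) c.tapes c.used) (by rw [← h]; exact congrArg _ h) ?_) (h₃ _)
    by_cases hl : late c.state
    · refine .ite_true hl ?_
      have := exec_readInstance (x := x) (ro := ro) (qq := c.state) (b := none) (u := c.used)
        hc.head_le out κ rfl hc.readInstance_lt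
      rw [show simInput late out x c (c.tapes κ).value = _ from if_pos hl]
      exact this
    · refine .ite_false ((Bool.not_eq_true _).mp hl) ?_
      have := exec_readPair (x := x) (ro := ro) (qq := c.state) (b := none) (u := c.used)
        hc.head_le κ (by have := hc.readInstance_lt; omega)
      rw [show simInput late out x c (c.tapes κ).value = _ from if_neg hl]
      exact this
  | readMultiAccess κ n =>
    refine .ite_false (by rw [hact, h]; rfl) (.ite_false (by rw [hact, h]; rfl) ?_)
    have h₁ := exec_setStore (x := x) (ro := ro) (simMem_bdd hc.head_le)
      (fun σ v => (σ.1, σ.2.1, (simAction σ v).addr))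
    rw [hact, h] at h₁
    refine .seq h₁ (.seq (.ite_false (by exact congrArg _ h)
      (exec_readBits (x := x) (ro := ro) (qq := c.state) (b := none) (u := c.used)
        hc.head_le κ hc.readBits_lt)) ?_)
    have := exec_setStore (x := x) (ro := ro) (H := H)
      (m := regs ((c.state, some (instanceBits x (c.tapes κ).value), some κ) :
        Store M.State M.Tapes) (fun _ => 0) c.tapes c.used)
      (regs_bdd (fun _ => by positivity) hc.head_le) (fun σ v => match simAction σ v with
          | .readInput _ n => (n σ.2.1, none, none)
          | .readMultiAccess _ n => (n (σ.2.1.getD false), none, none)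
          | _ => σ)
    have hact' : ∀ b, simAction (regs ((c.state, b, some κ) : Store M.State M.Tapes)
      (fun _ => 0) c.tapes c.used).store (regs ((c.state, b, some κ) : Store M.State M.Tapes)
      (fun _ => 0) c.tapes c.used).views = .readMultiAccess κ n := fun _ => h
    rw [hact'] at this
    exact this
  | halt b => rw [h] at hh; simp [Action.isHalt] at hh

/-- The simulated run. -/
def simRun (late : M.State → Bool) (out : M.Tapes) (x : List Bool) (ro : ℕ → Bool) (t : ℕ) :
    M.Config :=
  (fun c => M.virtualStep (simInput late out x c) ro (instanceBits x) c)^[t] M.initial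

lemma exec_sim (hH : ∀ t, Fits x out H (simRun late out x ro t)) {t : ℕ} {b : Bool}
    (ht : (simRun late out x ro t).action = .halt b) :
    ∃ m, Exec x ro H (sim late out) (simMem M.initial) m ∧ m.store.2.1 = some b := by
  have key : ∀ s, ∀ i ≤ t, i + s = t →
      Exec x ro H (.loop (fun σ v => !(simAction σ v).isHalt) (simStep late out))
        (simMem (simRun late out x ro i)) (simMem (simRun late out x ro t)) := by
    intro s
    induction s with
    | zero =>
      intro i _ hi
      obtain rfl : i = t := hi
      refine .loop_false ?_
      change (!(simRun late out x ro i).action.isHalt) = false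
      rw [ht]
      rfl
    | succ s ih =>
      intro i hi hs
      by_cases hh : (simRun late out x ro i).action.isHalt = true
      · have hfix : M.virtualStep (simInput late out x (simRun late out x ro i)) ro (instanceBits x)
            (simRun late out x ro i) = simRun late out x ro i := by
          unfold Machine.virtualStep
          revert hh
          cases (simRun late out x ro i).action <;> simp [Action.isHalt]
        have : simRun late out x ro t = simRun late out x ro i := by
          rw [← hs, Nat.add_comm, simRun, Function.iterate_add_apply]
          exact Function.iterate_fixed (f := fun c => M.virtualStep (simInput late out x c) ro
            (instanceBits x) c) hfix _
        rw [this]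
        refine .loop_false ?_
        change (!(simRun late out x ro i).action.isHalt) = false
        rw [hh]
        rfl
      · have hsucc : simRun late out x ro (i + 1) = M.virtualStep (simInput late out x
            (simRun late out x ro i)) ro (instanceBits x) (simRun late out x ro i) := by
          rw [simRun, Function.iterate_succ_apply']
          rfl
        refine .loop_true (m' := simMem (simRun late out x ro (i + 1))) ?_ ?_
          (ih (i + 1) (by omega) (by omega))
        · change (!(simRun late out x ro i).action.isHalt) = true
          simpa using hh
        · rw [hsucc]
          refine exec_simStep (hH i) ?_ (by simpa using hh)
          rw [← hsucc]
          exact (hH (i + 1)).head_le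
  refine ⟨_, .seq (key t 0 (by omega) (by omega)) (exec_setStore (simMem_bdd (hH t).head_le) _), ?_⟩
  change some (simRun late out x ro t).action.output = some b
  rw [ht]
  rfl

end Cmd

/-! ### The composition of two machines -/

namespace Machine

variable (D S : Machine)

/-- The transition function of `andThen`. -/
def seqTrans : D.State ⊕ S.State → (D.Tapes ⊕ S.Tapes → Option Bool × Bool) →
    Action (D.Tapes ⊕ S.Tapes) (D.State ⊕ S.State)
  | .inl q, v => match D.trans q fun κ => v (.inl κ) with
    | .work q w d => .work (.inl q) (Sum.elim w fun κ => (v (.inr κ)).1) (Sum.elim d fun _ => .stay)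
    | .readInput κ n => .readInput (.inl κ) fun b => .inl (n b)
    | .readMultiAccess κ n => .readMultiAccess (.inl κ) fun b => .inl (n b)
    | .readOnce n => .readOnce fun b => .inl (n b)
    | .halt _ => .work (.inr S.start) (fun κ => (v κ).1) fun _ => .stay
  | .inr q, v => match S.trans q fun κ => v (.inr κ) with
    | .work q w d => .work (.inr q) (Sum.elim (fun κ => (v (.inl κ)).1) w)
        (Sum.elim (fun _ => .stay) d)
    | .readInput κ n => .readInput (.inr κ) fun b => .inr (n b)
    | .readMultiAccess κ n => .readMultiAccess (.inr κ) fun b => .inr (n b)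
    | .readOnce n => .readOnce fun b => .inr (n b)
    | .halt b => .halt b

/-- The machine that runs `D`, and then `S` on fresh tapes. -/
def andThen : Machine where
  Tapes := D.Tapes ⊕ S.Tapes
  State := D.State ⊕ S.State
  finite_tapes := by have := D.finite_tapes; have := S.finite_tapes; infer_instance
  finite_state := by have := D.finite_state; have := S.finite_state; infer_instance
  start := .inl D.start
  trans := seqTrans D S

variable {D S}

/-- A configuration of the composition in which `D` is running. -/
def Config.first (c : D.Config) : (D.andThen S).Config :=
  ⟨.inl c.state, Sum.elim c.tapes fun _ => WorkTape.blank, c.used⟩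

/-- A configuration of the composition in which `S` is running, and `D` has left the tapes `τ`. -/
def Config.second (τ : D.Tapes → WorkTape) (c : S.Config) : (D.andThen S).Config :=
  ⟨.inr c.state, Sum.elim τ c.tapes, c.used⟩

variable {inp : ℕ → Option Bool} {ro ma : ℕ → Bool}

lemma Config.mk_congr {M : Machine} {q : M.State} {τ τ' : M.Tapes → WorkTape} {u : ℕ}
    (h : τ = τ') : (⟨q, τ, u⟩ : M.Config) = ⟨q, τ', u⟩ := by
  rw [h]

lemma virtualStep_first {c : D.Config} (hc : c.action.isHalt = false) :
    (D.andThen S).virtualStep inp ro ma c.first = (D.virtualStep inp ro ma c).first := by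
  have ha : (Config.first (S := S) c).action = seqTrans D S (.inl c.state) fun κ =>
    (Sum.elim c.tapes (fun _ => WorkTape.blank) κ).view := rfl
  rw [virtualStep, virtualStep, ha]
  simp only [seqTrans, Sum.elim_inl]
  rw [show (D.trans c.state fun κ => (c.tapes κ).view) = c.action from rfl]
  cases h : c.action with
  | work q w d =>
    refine Config.mk_congr (M := D.andThen S) (funext ?_)
    rintro (κ | κ)
    · rfl
    · exact WorkTape.act_stay WorkTape.blank
  | halt b => rw [h] at hc; simp [Action.isHalt] at hc
  | _ => rfl

lemma virtualStep_first_halt {c : D.Config} (hc : c.action.isHalt = true) (hu : c.used = 0) :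
    (D.andThen S).virtualStep inp ro ma c.first = Config.second c.tapes S.initial := by
  have ha : (Config.first (S := S) c).action = seqTrans D S (.inl c.state) fun κ =>
    (Sum.elim c.tapes (fun _ => WorkTape.blank) κ).view := rfl
  rw [virtualStep, ha]
  simp only [seqTrans, Sum.elim_inl]
  rw [show (D.trans c.state fun κ => (c.tapes κ).view) = c.action from rfl]
  cases h : c.action with
  | halt b =>
    simp only [Config.first, Config.second, initial, hu]
    refine Config.mk_congr (M := D.andThen S) (funext ?_)
    rintro (κ | κ) <;> exact WorkTape.act_stay _
  | _ => rw [h] at hc; simp [Action.isHalt] at hc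

lemma action_second (τ : D.Tapes → WorkTape) (c : S.Config) {b : Bool} :
    (Config.second τ c).action = .halt b ↔ c.action = .halt b := by
  have ha : (Config.second τ c).action = seqTrans D S (.inr c.state) fun κ =>
    (Sum.elim τ c.tapes κ).view := rfl
  rw [ha]
  simp only [seqTrans, Sum.elim_inr]
  rw [show (S.trans c.state fun κ => (c.tapes κ).view) = c.action from rfl]
  cases h : c.action <;> simp
  exact Action.halt.injEq _ _ ▸ Iff.rfl

lemma virtualStep_second (τ : D.Tapes → WorkTape) (c : S.Config) :
    (D.andThen S).virtualStep inp ro ma (Config.second τ c) =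
      Config.second τ (S.virtualStep inp ro ma c) := by
  have ha : (Config.second τ c).action = seqTrans D S (.inr c.state) fun κ =>
    (Sum.elim τ c.tapes κ).view := rfl
  rw [virtualStep, virtualStep, ha]
  simp only [seqTrans, Sum.elim_inr]
  rw [show (S.trans c.state fun κ => (c.tapes κ).view) = c.action from rfl]
  cases h : c.action with
  | work q w d =>
    refine Config.mk_congr (M := D.andThen S) (funext ?_)
    rintro (κ | κ)
    · exact WorkTape.act_stay _
    · rfl
  | _ => rfl

/-- A deterministic algorithm leaves the read-once string untouched for its successor. -/
lemma run_used_eq_zero (hD : D.NoReadOnce) (x : List Bool) (t : ℕ) :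
    (D.run x ro ma t).used = 0 := by
  induction t with
  | zero => rfl
  | succ t ih =>
    rw [run_succ, step]
    cases h : (D.run x ro ma t).action with
    | readOnce n => exact absurd h (hD _ _ _)
    | _ => exact ih

end Machine

namespace Machine

open scoped Classical

variable {D S : Machine} {x : List Bool} {ro : ℕ → Bool} {out : D.Tapes}

/-- The phase predicate of the composition: `S` is running. -/
def secondPhase : (D.andThen S).State → Bool := Sum.isRight

/-- A tape of `D` as a tape of the composition. -/
def firstTape (κ : D.Tapes) : (D.andThen S).Tapes := Sum.inl κ

lemma virtualStep_getElem (M : Machine) (x : List Bool) (ro ma : ℕ → Bool) :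
    M.virtualStep (fun i => x[i]?) ro ma = M.step x ro ma := rfl

lemma simRun_succ {M : Machine} (late : M.State → Bool) (out : M.Tapes) (x : List Bool)
    (ro : ℕ → Bool) (t : ℕ) : Cmd.simRun late out x ro (t + 1) =
      M.virtualStep (Cmd.simInput late out x (Cmd.simRun late out x ro t)) ro (instanceBits x)
        (Cmd.simRun late out x ro t) := by
  unfold Cmd.simRun
  rw [Function.iterate_succ_apply']

/-- Until `D` halts, the simulated run of the composition is the run of `D` on `pairInput`. -/
lemma simRun_first {t₀ : ℕ} {ma : ℕ → Bool} (hma : ma = instanceBits x)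
    (h₀ : ∀ t < t₀, (D.run (pairInput x) ro ma t).action.isHalt = false) :
    ∀ t ≤ t₀, Cmd.simRun (M := D.andThen S) secondPhase (firstTape out) x ro t =
      (D.run (pairInput x) ro ma t).first := by
  subst hma
  intro t
  induction t with
  | zero =>
    intro _
    refine Config.mk_congr (M := D.andThen S) (funext ?_)
    rintro (κ | κ) <;> rfl
  | succ t ih =>
    intro ht
    have h := ih (by omega)
    rw [simRun_succ, h, run_succ, ← virtualStep_getElem, ← virtualStep_first (h₀ t (by omega))]
    rfl

/-- After `D` has halted, the simulated run of the composition is the run of `S` on the instance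
whose clique size is the number that `D` has stored. -/
lemma simRun_second (hD : D.NoReadOnce) {t₀ : ℕ} {ma : ℕ → Bool} (hma : ma = instanceBits x)
    (h₀ : ∀ t < t₀, (D.run (pairInput x) ro ma t).action.isHalt = false)
    (h₁ : (D.run (pairInput x) ro ma t₀).action.isHalt = true) (s : ℕ) :
    Cmd.simRun (M := D.andThen S) secondPhase (firstTape out) x ro (t₀ + 1 + s) =
      Config.second (D.run (pairInput x) ro ma t₀).tapes
        (S.run (instanceInput x ((D.run (pairInput x) ro ma t₀).tapes out).value) ro ma s) := by
  induction s with
  | zero =>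
    have h := simRun_first (S := S) (out := out) hma h₀ t₀ le_rfl
    subst hma
    rw [add_zero]
    rw [simRun_succ, h]
    exact virtualStep_first_halt h₁ (run_used_eq_zero hD _ _)
  | succ s ih =>
    subst hma
    rw [← add_assoc]
    rw [simRun_succ, ih, run_succ, ← virtualStep_getElem, ← virtualStep_second]
    rfl

end Machine

/-! ### Space bounds -/

lemma valN_add_valK_le (x : List Bool) : 8 * valN x + 8 * valK x ≤ x.length + 7 := by
  have := base_le x
  unfold base at this
  omega

lemma valL_le (x : List Bool) : valL x ≤ valN x := quot_le _ _

lemma length_encodePair (N k : ℕ) : (encodePair N k).length = N + k + 2 := by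
  simp [encodePair]
  omega

/-- Bounds for the numbers that come up in the simulation and for the length of the simulated input,
in terms of a bound `2 ^ a` for the clique size. In the application `a` is a multiple of `e`, so
that all exponents are `O(log n)`. -/
lemma instanceInput_bounds {x : List Bool} {e a y : ℕ} (he : x.length < 2 ^ e) (he' : 1 ≤ e)
    (hy : y < 2 ^ a) :
    base x + 8 + valL x * y * (8 * valN x) + valL x * y < 2 ^ (a + 7 * e) ∧
    base x + 8 + valN x * (8 * valN x) + 8 * valN x + 6 * valN x * (8 * valN x) < 2 ^ (a + 7 * e) ∧
    (instanceInput x y).length < 2 ^ (2 * a + 4 * e) := by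
  have h1 := valN_add_valK_le x
  have h2 := valL_le x
  have h3 := base_le x
  have hX : 2 ≤ 2 ^ e := le_self_pow₀ (by norm_num) (by omega)
  have hp : 2 ^ (a + 7 * e) = 2 ^ a * (2 ^ e) ^ 7 := by ring
  have hq : 2 ^ (2 * a + 4 * e) = (2 ^ a) ^ 2 * (2 ^ e) ^ 4 := by ring
  rw [hp, hq]
  have hlen : (instanceInput x y).length = valL x * y + y + 2 + (valL x * y) * (valL x * y) := by
    rw [instanceInput, List.length_append, length_encodePair, List.length_ofFn]
  rw [hlen]
  generalize 2 ^ e = X at *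
  generalize 2 ^ a = Y at *
  generalize valN x = n at *
  generalize valL x = l at *
  generalize base x = B at *
  have hn : 8 * n ≤ 4 * X := by omega
  have hl : l ≤ X := by omega
  have hl' : l + 1 ≤ X := by omega
  have hB : B + 8 ≤ 9 * X := by omega
  have hXX : 2 * X ≤ X * X := Nat.mul_le_mul_right _ hX
  have hX3 : 4 * (X * X) ≤ X ^ 4 := by
    calc 4 * (X * X) ≤ (X * X) * (X * X) := Nat.mul_le_mul_right _ (by omega)
      _ = X ^ 4 := by ring
  have hX7 : 32 * (X * X) ≤ X ^ 7 := by
    calc 32 * (X * X) ≤ X ^ 5 * (X * X) := Nat.mul_le_mul_right _ (Nat.pow_le_pow_left hX 5)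
      _ = X ^ 7 := by ring
  have hy' : y + 1 ≤ Y := hy
  have hly : l * y ≤ X * Y := Nat.mul_le_mul hl (by omega)
  refine ⟨?_, ?_, ?_⟩
  · have h4 : l * y * (8 * n) ≤ X * Y * (4 * X) := Nat.mul_le_mul hly hn
    have h5 : 32 * (X * X) * Y ≤ X ^ 7 * Y := Nat.mul_le_mul_right _ hX7
    have h6 : X * 1 ≤ X * Y := Nat.mul_le_mul_left _ (by omega)
    have h7 : 2 * X * Y ≤ X * X * Y := Nat.mul_le_mul_right _ hXX
    nlinarith [Nat.mul_pos (show 0 < X by omega) (show 0 < Y by omega)]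
  · have hn' : n ≤ X := by omega
    have h4 : n * (8 * n) ≤ 2 * (X * X) := by
      calc n * (8 * n) = 2 * (2 * n * (2 * n)) := by ring
        _ ≤ _ := Nat.mul_le_mul_left _ (Nat.mul_le_mul (by omega) (by omega))
    have h6 : 6 * n * (8 * n) = 6 * (n * (8 * n)) := by ring
    have h5 : 1 * X ^ 7 ≤ Y * X ^ 7 := Nat.mul_le_mul_right _ (by omega)
    nlinarith
  · have h4 : l * y * (l * y) ≤ X * Y * (X * Y) := Nat.mul_le_mul hly hly
    have h5 : 1 * Y ≤ Y * Y := Nat.mul_le_mul_right _ (by omega)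
    have h6 : X * Y ≤ X * (Y * Y) := Nat.mul_le_mul_left _ (by omega)
    have h7 : 2 * X * (Y * Y) ≤ X * X * (Y * Y) := Nat.mul_le_mul_right _ hXX
    have h8 : 4 * (X * X) * (Y * Y) ≤ X ^ 4 * (Y * Y) := Nat.mul_le_mul_right _ hX3
    nlinarith [Nat.mul_pos (show 0 < X by omega) (show 0 < Y by omega)]

lemma log_add_one_le {n e : ℕ} (h : n < 2 ^ e) : Nat.log 2 n + 1 ≤ e ∨ n = 0 := by
  rcases Nat.eq_zero_or_pos n with h0 | h0
  · exact .inr h0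
  · exact .inl (Nat.log_lt_of_lt_pow (by omega) h)

namespace Machine
open scoped Classical

/-- There is a randomized logspace algorithm that runs a deterministic algorithm `D` on `pairInput`
and, with the number stored by `D` as the clique size, the multiple access algorithm `S` on
`instanceInput` and `instanceBits`. -/
theorem exists_simulator {D S : Machine} (hD : D.IsDeterministicLogspace)
    (hS : S.IsMultiAccessLogspace) (out : D.Tapes) :
    ∃ M : Machine, M.IsRandomizedLogspace ∧ ∀ x y, D.Stores out (pairInput x) y →
      ∀ ro ma b, M.Outputs x ro ma b ↔ S.Outputs (instanceInput x y) ro (instanceBits x) b := by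
  obtain ⟨⟨cD, hcD⟩, -, hDro⟩ := hD
  obtain ⟨cS, hcS⟩ := hS
  have := (D.andThen S).finite_tapes
  have := (D.andThen S).finite_state
  set P := Cmd.sim (M := D.andThen S) secondPhase (firstTape out) with hP
  let M := P.compile ((D.andThen S).start, none, none) fun σ => σ.2.1.getD false
  let H : List Bool → ℕ := fun x => (cS * (8 * cD + 4) + 4 * cD + 7) * (Nat.log 2 x.length + 1)
  -- the simulation on an arbitrary input
  have key : ∀ x ro, ∃ y b, (∀ y', D.Stores out (pairInput x) y' → y' = y) ∧
      S.Outputs (instanceInput x y) ro (instanceBits x) b ∧ ∀ ma, M.Outputs x ro ma b ∧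
        ∀ t κ, ((M.run x ro ma t).tapes κ).head ≤ H x := by
    intro x ro
    set ma := instanceBits x with hma
    -- `t₀` is the time at which `D` halts; the simulation starts `S` one step later
    obtain ⟨hDh, t₁, -, b₁, ht₁⟩ := hcD (pairInput x) ro ma
    have hex : ∃ t, (D.run (pairInput x) ro ma t).action.isHalt = true := ⟨t₁, by rw [ht₁]; rfl⟩
    set t₀ := Nat.find hex with ht₀
    have h₁ : (D.run (pairInput x) ro ma t₀).action.isHalt = true := Nat.find_spec hex
    have h₀ : ∀ t < t₀, (D.run (pairInput x) ro ma t).action.isHalt = false := fun t ht => by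
      simpa using Nat.find_min hex ht
    set c₀ := D.run (pairInput x) ro ma t₀ with hc₀
    obtain ⟨hSh, t₂, -, b, ht₂⟩ := hcS (instanceInput x (c₀.tapes out).value) ro ma
    -- the heads and the numbers are within the bound `H x`
    have hxe : x.length < 2 ^ (Nat.log 2 x.length + 1) := Nat.lt_pow_succ_log_self (by norm_num) _
    have hHx : H x = (cS * (8 * cD + 4) + 4 * cD + 7) * (Nat.log 2 x.length + 1) := rfl
    set e := Nat.log 2 x.length + 1 with he
    have he' : 1 ≤ e := by omega
    have hlogD : Nat.log 2 (pairInput x).length + 1 ≤ 4 * e := by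
      refine (log_add_one_le ?_).resolve_right (by rw [pairInput, length_encodePair]; omega)
      rw [pairInput, length_encodePair, mul_comm, pow_mul]
      have := valN_add_valK_le x
      have h2 : 2 ≤ 2 ^ e := le_self_pow₀ (by norm_num) (by omega)
      nlinarith [Nat.pow_le_pow_right (show 0 < 2 ^ e by omega) (show 2 ≤ 4 by norm_num)]
    have hDhead : ∀ t κ, ((D.run (pairInput x) ro ma t).tapes κ).head ≤ cD * (4 * e) := fun t κ =>
      (hDh t κ).le.trans (Nat.mul_le_mul_left _ hlogD)
    have hval : ∀ t, ((D.run (pairInput x) ro ma t).tapes out).value < 2 ^ (cD * (4 * e)) :=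
      fun t => (WorkTape.value_lt _).trans_le (Nat.pow_le_pow_right (by norm_num) (hDhead t out))
    have hpow : 2 ^ (cD * (4 * e) + 7 * e) ≤ 2 ^ H x := by
      refine Nat.pow_le_pow_right (by norm_num) ?_
      rw [hHx]
      nlinarith [Nat.zero_le (cS * (8 * cD + 4) * e)]
    have hSlog : Nat.log 2 (instanceInput x (c₀.tapes out).value).length + 1 ≤
        2 * (cD * (4 * e)) + 4 * e := by
      refine (log_add_one_le (instanceInput_bounds hxe he' (hval t₀)).2.2).resolve_right ?_
      rw [instanceInput, List.length_append, length_encodePair]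
      omega
    have hDH : cD * (4 * e) ≤ H x := by
      rw [hHx]
      nlinarith [Nat.zero_le (cS * (8 * cD + 4) * e)]
    have hSH : cS * (2 * (cD * (4 * e)) + 4 * e) ≤ H x := by
      rw [hHx]
      nlinarith [Nat.zero_le (4 * cD * e)]
    have hfits : ∀ t, Cmd.Fits (M := D.andThen S) x (firstTape out) (H x)
        (Cmd.simRun secondPhase (firstTape out) x ro t) := by
      have hb : ∀ t, (((Cmd.simRun (M := D.andThen S) secondPhase (firstTape out) x ro t).tapes
          (firstTape out)).value < 2 ^ (cD * (4 * e))) ∧ ∀ κ,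
            ((Cmd.simRun (M := D.andThen S) secondPhase
            (firstTape out) x ro t).tapes κ).head ≤ H x := by
        intro t
        rcases Nat.lt_or_ge t₀ t with ht | ht
        · obtain ⟨s, rfl⟩ := Nat.exists_eq_add_of_le (Nat.succ_le_of_lt ht)
          rw [Nat.succ_eq_add_one, simRun_second hDro hma h₀ h₁ s]
          refine ⟨hval t₀, ?_⟩
          rintro (κ | κ)
          · exact (hDhead t₀ κ).trans hDH
          · exact ((hSh s κ).le.trans (Nat.mul_le_mul_left _ hSlog)).trans hSH
        · rw [simRun_first hma h₀ t ht]
          refine ⟨hval t, ?_⟩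
          rintro (κ | κ)
          · exact (hDhead t κ).trans hDH
          · exact Nat.zero_le _
      intro t
      obtain ⟨h1, h2, -⟩ := instanceInput_bounds hxe he' (hb t).1
      exact ⟨(hb t).2, h1.trans_le hpow, h2.trans_le hpow⟩
    have hhalt : (Cmd.simRun (M := D.andThen S) secondPhase (firstTape out) x ro
        (t₀ + 1 + t₂)).action =
        .halt b := by
      rw [simRun_second hDro hma h₀ h₁ t₂, action_second]
      exact ht₂
    obtain ⟨m, hm, hmb⟩ := Cmd.exec_sim hfits hhalt
    refine ⟨(c₀.tapes out).value, b, fun y' hy' => ?_, ⟨t₂, ht₂⟩, fun ma' => ?_⟩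
    · obtain ⟨t, b', ht, rfl⟩ := hy' ro ma
      have h2 : ∃ b₀, c₀.action = .halt b₀ := by
        revert h₁
        cases c₀.action <;> simp [Action.isHalt]
      obtain ⟨b₀, hb₀⟩ := h2
      rw [← run_eq_of_halt ht (le_max_left t t₀), hc₀,
        ← run_eq_of_halt hb₀ (le_max_right t t₀)]
    · have hinit : Cmd.simMem (D.andThen S).initial =
          Mem.init ((D.andThen S).start, none, none) := by
        simp only [Cmd.simMem, regs, Mem.init, Machine.initial, natTape_zero, Mem.mk.injEq,
          true_and,
          and_true]
        funext κ
        rcases κ with i | κ <;> rfl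
      rw [hinit] at hm
      have := Cmd.compile_run P ((D.andThen S).start, none, none) (fun σ => σ.2.1.getD false) hm ma'
      rwa [hmb] at this
  refine ⟨M, isRandomizedLogspace_of_space (Cmd.noMultiAccess_compile _ _ _)
    (c := cS * (8 * cD + 4) + 4 * cD + 7 + 1) (fun x ro ma t κ => ?_) (fun x ro ma => ?_), ?_⟩
  · obtain ⟨_, _, _, _, h⟩ := key x ro
    refine ((h ma).2 t κ).trans_lt ?_
    simp only [H]
    exact Nat.mul_lt_mul_of_pos_right (Nat.lt_succ_self _) (Nat.succ_pos _)
  · obtain ⟨_, b, _, _, h⟩ := key x ro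
    obtain ⟨t, ht⟩ := (h ma).1
    exact ⟨t, b, ht⟩
  · intro x y hy ro ma b
    obtain ⟨y', b', hy', hSb, h⟩ := key x ro
    obtain rfl := hy' y hy
    exact ⟨fun hb => by rwa [hb.unique (h ma).1], fun hb => by rw [hb.unique hSb]; exact (h ma).1⟩

end Machine

/-! ### The simulated strings on encodings of graphs -/

open Classical in
/-- The adjacency matrix of a graph, with entries `false` outside the range of the vertices. -/
def natAdj {n : ℕ} (G : SimpleGraph (Fin n)) (i j : ℕ) : Bool :=
  decide (∃ (hi : i < n) (hj : j < n), G.Adj ⟨i, hi⟩ ⟨j, hj⟩)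

/-- The rows, counted from row `N` on, of those among the vertices `N, …, 7 N - 1` that are not
adjacent to the first vertex. -/
def goodRows {n : ℕ} (N : ℕ) (G : SimpleGraph (Fin n)) : List ℕ :=
  (List.range (6 * N)).filter fun u => !natAdj G 0 (N + u)

/-- The bits that the reduction extracts from a graph on `8 N` vertices. -/
def graphBits {n : ℕ} (N : ℕ) (G : SimpleGraph (Fin n)) (a : ℕ) : Bool :=
  (goodRows N G)[a / N]?.elim false fun u => natAdj G (N + u) (7 * N + a % N)

/-- The search with the filter in closed form: bit `a` stands in the row with index `a / w` among
those that count, in column `a % w`. -/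
lemma scanVal_eq_filter (x : List Bool) (W : ℕ) {w : ℕ} (hw : 0 < w) : ∀ c q row a,
    scanVal x true W w c q row a =
      ((List.range c).filter fun u => x[q + u]? = some false)[a / w]?.map fun u =>
        x[row + u * W + a % w]?.getD false := by
  intro c
  induction c with
  | zero => intro q row a; simp [scanVal]
  | succ c ih =>
    intro q row a
    rw [scanVal, List.range_succ_eq_map, List.filter_cons, List.filter_map]
    have hsucc : ∀ i : ℕ, ((List.filter ((fun u => decide (x[q + u]? = some false)) ∘ Nat.succ)
        (List.range c)).map Nat.succ)[i]?.map (fun u => x[row + u * W + a % w]?.getD false) =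
        ((List.range c).filter fun u => x[q + 1 + u]? = some false)[i]?.map fun u =>
          x[row + W + u * W + a % w]?.getD false := by
      intro i
      rw [List.getElem?_map, Option.map_map]
      have h1 : ((fun u => decide (x[q + u]? = some false)) ∘ Nat.succ) =
          fun u => decide (x[q + 1 + u]? = some false) := by
        funext u
        simp only [Function.comp, Nat.succ_eq_add_one]
        rw [show q + (u + 1) = q + 1 + u by omega]
      have h2 : ((fun u => x[row + u * W + a % w]?.getD false) ∘ Nat.succ) =
          fun u => x[row + W + u * W + a % w]?.getD false := by
        funext u
        simp only [Function.comp, Nat.succ_eq_add_one]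
        rw [show row + (u + 1) * W = row + W + u * W by ring]
      rw [h1, h2]
    by_cases hq : x[q]? = some false
    · simp only [hq, or_true, if_true, add_zero, decide_true]
      split_ifs with ha
      · simp [Nat.div_eq_of_lt ha, Nat.mod_eq_of_lt ha]
      · rw [ih, show a / w = (a - w) / w + 1 by rw [Nat.div_eq_sub_div hw (by omega)],
          List.getElem?_cons_succ, hsucc, ← Nat.mod_eq_sub_mod (by omega)]
    · simp only [hq, add_zero, decide_false, Bool.false_eq_true, Bool.true_eq_false, or_self,
        if_false]
      rw [ih, hsucc]

lemma runLen_eq {x : List Bool} {p m : ℕ} (h : ∀ j < m, x[p + 8 * j]? = some true)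
    (h' : x[p + 8 * m]? ≠ some true) : runLen x p = m := by
  rw [runLen, Nat.find_eq_iff]
  exact ⟨h', fun j hj => not_not.2 (h j hj)⟩

section

variable {n k : ℕ} (G : SimpleGraph (Fin n))

lemma getElem?_encodeInstance_left {i : ℕ} (hi : i < n) :
    (encodeInstance k G)[i]? = some true := by
  rw [encodeInstance, getElem?_encodePair_append, if_pos hi]

lemma getElem?_encodeInstance_sep : (encodeInstance k G)[n]? = some false := by
  rw [encodeInstance, getElem?_encodePair_append]
  simp

lemma getElem?_encodeInstance_mid {i : ℕ} (hi : i < k) :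
    (encodeInstance k G)[n + 1 + i]? = some true := by
  rw [encodeInstance, getElem?_encodePair_append]
  simp [hi]
  omega

lemma getElem?_encodeInstance_sep' : (encodeInstance k G)[n + 1 + k]? = some false := by
  rw [encodeInstance, getElem?_encodePair_append]
  simp
  omega

lemma getElem?_encodeInstance_matrix {i j : ℕ} (hi : i < n) (hj : j < n) :
    (encodeInstance k G)[n + 1 + k + 1 + i * n + j]? = some (natAdj G i j) := by
  have hij : i * n + j < n * n := by
    have := Nat.mul_le_mul_right n (Nat.succ_le_of_lt hi)
    rw [Nat.succ_mul] at this
    omega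
  have h : (encodePair n k).length = n + k + 2 := length_encodePair n k
  rw [encodeInstance, List.getElem?_append_right (by omega), h, adjacencyBits, List.getElem?_ofFn,
    dif_pos (by omega)]
  have h1 : (⟨n + 1 + k + 1 + i * n + j - (n + k + 2), by omega⟩ : Fin (n * n)).divNat =
      ⟨i, hi⟩ := by
    ext
    rw [Fin.coe_divNat]
    change (n + 1 + k + 1 + i * n + j - (n + k + 2)) / n = i
    rw [show n + 1 + k + 1 + i * n + j - (n + k + 2) = j + i * n by omega,
      Nat.add_mul_div_right _ _ (by omega), Nat.div_eq_of_lt hj, zero_add]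
  have h2 : (⟨n + 1 + k + 1 + i * n + j - (n + k + 2), by omega⟩ : Fin (n * n)).modNat =
      ⟨j, hj⟩ := by
    ext
    rw [Fin.coe_modNat]
    change (n + 1 + k + 1 + i * n + j - (n + k + 2)) % n = j
    rw [show n + 1 + k + 1 + i * n + j - (n + k + 2) = j + i * n by omega,
      Nat.add_mul_mod_self_right, Nat.mod_eq_of_lt hj]
  rw [h1, h2]
  simp [natAdj, hi, hj]

end

section

variable {n N k : ℕ} (hn : n = 8 * N) (G : SimpleGraph (Fin n))
include hn

lemma valN_encodeInstance : valN (encodeInstance (8 * k) G) = N := by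
  subst hn
  refine runLen_eq (fun j hj => ?_) ?_
  · exact getElem?_encodeInstance_left G (by omega)
  · rw [zero_add, getElem?_encodeInstance_sep]
    simp

lemma valK_encodeInstance : valK (encodeInstance (8 * k) G) = k := by
  rw [valK, valN_encodeInstance hn]
  subst hn
  refine runLen_eq (fun j hj => ?_) ?_
  · exact getElem?_encodeInstance_mid G (by omega)
  · rw [getElem?_encodeInstance_sep']
    simp

lemma base_encodeInstance : base (encodeInstance (8 * k) G) = n + 1 + 8 * k + 1 := by
  rw [base, valN_encodeInstance hn, valK_encodeInstance hn, hn]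

lemma instanceBits_encodeInstance (hN : 0 < N) {a : ℕ} :
    instanceBits (encodeInstance (8 * k) G) a = graphBits N G a := by
  rw [instanceBits, base_encodeInstance hn, valN_encodeInstance hn, scanVal_eq_filter _ _ hN,
    graphBits, goodRows]
  have h1 : (List.range (6 * N)).filter (fun u => decide
      ((encodeInstance (8 * k) G)[n + 1 + 8 * k + 1 + N + u]? = some false)) =
      (List.range (6 * N)).filter fun u => !natAdj G 0 (N + u) := by
    refine List.filter_congr fun u hu => ?_
    rw [List.mem_range] at hu
    have := getElem?_encodeInstance_matrix (k := 8 * k) G (i := 0) (j := N + u) (by omega)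
        (by omega)
    rw [zero_mul, add_zero, ← add_assoc] at this
    rw [this]
    cases natAdj G 0 (N + u) <;> simp
  rw [h1]
  cases h : ((List.range (6 * N)).filter fun u => !natAdj G 0 (N + u))[a / N]? with
  | none => rfl
  | some u =>
    have hu : u < 6 * N := by
      have := List.mem_of_getElem? h
      simpa using (List.mem_filter.1 this).1
    have hmod := Nat.mod_lt a hN
    have := getElem?_encodeInstance_matrix (k := 8 * k) G (i := N + u) (j := 7 * N + a % N)
      (by omega) (by omega)
    rw [Option.map_some, Option.getD_some, Option.elim_some,
      show n + 1 + 8 * k + 1 + N * (8 * N) + 7 * N + u * (8 * N) + a % N =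
        n + 1 + 8 * k + 1 + (N + u) * n + (7 * N + a % N) by rw [hn]; ring, this, Option.getD_some]

end

lemma instanceInput_encodeInstance {ℓ k y : ℕ} (hk : 0 < k) (hy : ℓ * y ≤ ℓ * (8 * k))
    (G : SimpleGraph (Fin (ℓ * (8 * k)))) :
    instanceInput (encodeInstance (8 * k) G) y = encodeInstance y (G.comap (Fin.castLE hy)) := by
  have hn : ℓ * (8 * k) = 8 * (ℓ * k) := by ring
  have hL : valL (encodeInstance (8 * k) G) = ℓ := by
    rw [valL, valN_encodeInstance hn, valK_encodeInstance hn, quot_mul _ hk]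
  rw [instanceInput, hL, valN_encodeInstance hn, base_encodeInstance hn]
  conv_rhs => rw [encodeInstance, adjacencyBits]
  congr 2
  funext i
  have h1 : (i.divNat : ℕ) < ℓ * (8 * k) := i.divNat.2.trans_le hy
  have h2 : (i.modNat : ℕ) < ℓ * (8 * k) := i.modNat.2.trans_le hy
  rw [← hn, getElem?_encodeInstance_matrix G h1 h2, Option.getD_some]
  exact decide_eq_decide.2 ⟨fun ⟨_, _, h⟩ => h, fun h => ⟨h1, h2, h⟩⟩

namespace Machine

/-- A machine that reads only the first `m` multiple access bits depends only on these. -/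
lemma outputs_congr_of_usesAtMost {M : Machine} {x : List Bool} {m : ℕ} (h : M.UsesAtMost x m)
    (ro : ℕ → Bool) {ma ma' : ℕ → Bool} (hma : ∀ a < m, ma a = ma' a) (b : Bool) :
    M.Outputs x ro ma b ↔ M.Outputs x ro ma' b := by
  have key : ∀ t, M.run x ro ma t = M.run x ro ma' t := by
    intro t
    induction t with
    | zero => rfl
    | succ t ih =>
      rw [run_succ, run_succ, ← ih, step, step]
      cases ha : (M.run x ro ma t).action with
      | readMultiAccess κ n => simp only [hma _ (h ro ma t κ n ha)]
      | _ => rfl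
  simp only [Outputs, key]

/-- The reduction: a randomized logspace algorithm that simulates the multiple access algorithm `S`
on the first rows and columns of a larger graph, and takes the multiple access bits from the
graph. -/
theorem exists_reduction {D S : Machine} (hD : D.IsDeterministicLogspace)
    (hS : S.IsMultiAccessLogspace) (out : D.Tapes) :
    ∃ M : Machine, M.IsRandomizedLogspace ∧ ∀ (ℓ k y : ℕ) (_ : 0 < ℓ) (_ : 0 < k)
      (hy : ℓ * y ≤ ℓ * (8 * k)), D.Stores out (encodePair (ℓ * k) k) y →
      ∀ (G : SimpleGraph (Fin (ℓ * (8 * k)))) ro ma b,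
        M.Outputs (encodeInstance (8 * k) G) ro ma b ↔
        S.Outputs (encodeInstance y (G.comap (Fin.castLE hy))) ro (graphBits (ℓ * k) G) b := by
  obtain ⟨M, hM, h⟩ := exists_simulator hD hS out
  refine ⟨M, hM, fun ℓ k y hℓ hk hy hst G ro ma b => ?_⟩
  have hn : ℓ * (8 * k) = 8 * (ℓ * k) := by ring
  rw [h _ y (by rwa [pairInput, valN_encodeInstance hn, valK_encodeInstance hn]),
    instanceInput_encodeInstance hk hy,
    show instanceBits (encodeInstance (8 * k) G) = graphBits (ℓ * k) G from
      funext fun a => instanceBits_encodeInstance hn G (Nat.mul_pos hℓ hk)]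

end Machine

open Finset (univ)
open scoped BigOperators

/-! ### Output probabilities as finite sums -/

lemma measureReal_eq_sum_fiber {Ω ι : Type*} [MeasurableSpace Ω] [Fintype ι] [MeasurableSpace ι]
    [MeasurableSingletonClass ι] (μ : Measure Ω) [IsFiniteMeasure μ] {f : Ω → ι} (hf : Measurable f)
    (A : Set Ω) : μ.real A = ∑ i, μ.real (f ⁻¹' {i} ∩ A) := by
  have h := sum_measureReal_preimage_singleton (μ := μ.restrict A) (f := f) univ
    (fun y _ => hf (measurableSet_singleton y))
  rw [Finset.coe_univ, Set.preimage_univ, measureReal_restrict_apply_univ] at h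
  rw [← h]
  exact Finset.sum_congr rfl fun i _ => (measureReal_restrict_apply
    (hf (measurableSet_singleton i)))

instance (n : ℕ) : MeasurableSingletonClass (SimpleGraph (Fin n)) where
  measurableSet_singleton G := by
    have h := (SimpleGraph.measurableEmbedding_edgeSet (V := Fin n)).measurable
      (measurableSet_singleton G.edgeSet)
    convert h
    ext G'
    simp

instance : IsProbabilityMeasure coins := by
  unfold coins
  infer_instance

instance (n : ℕ) : IsProbabilityMeasure (erdosRenyi n) := by
  unfold erdosRenyi
  infer_instance

/-- The probability that the first bits are `w`. -/
lemma coins_real_prefix {m : ℕ} (w : Fin m → Bool) :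
    coins.real {ma | (fun a : Fin m => ma a) = w} = ((2 : ℝ) ^ m)⁻¹ := by
  let t : ℕ → Set Bool := fun a => if h : a < m then {w ⟨a, h⟩} else Set.univ
  have ht : {ma : ℕ → Bool | (fun a : Fin m => ma a) = w} = (↑(Finset.range m) : Set ℕ).pi t := by
    ext ma
    simp only [Set.mem_ofPred_eq, funext_iff, Set.mem_pi, Finset.coe_range, Set.mem_Iio, t]
    constructor
    · intro h a ha
      rw [dif_pos ha]
      exact h ⟨a, ha⟩
    · intro h a
      have := h a a.2
      rw [dif_pos a.2] at this
      exact this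
  have hs : ∀ a ∈ Finset.range m, ((PMF.uniformOfFintype Bool).toMeasure) (t a) = 2⁻¹ := by
    intro a ha
    rw [Finset.mem_range] at ha
    simp only [t, dif_pos ha]
    rw [PMF.toMeasure_apply_singleton _ _ (measurableSet_singleton _)]
    simp
  rw [ht, measureReal_def, coins, Measure.infinitePi_pi _ (fun a _ =>
    (Set.toFinite _).measurableSet),
    Finset.prod_congr rfl hs]
  simp

/-- The infinite string that starts with the bits `w` and continues with zeros. -/
def extendBits {m : ℕ} (w : Fin m → Bool) (a : ℕ) : Bool := if h : a < m then w ⟨a, h⟩ else false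

/-- The probability that `M` outputs `b` on input `x` if the multiple access bits are `w`. -/
def prefixProb (M : Machine) (x : List Bool) (b : Bool) {m : ℕ} (w : Fin m → Bool) : ℝ :=
  coins.real {ro | M.Outputs x ro (extendBits w) b}

lemma prefixProb_nonneg (M : Machine) (x : List Bool) (b : Bool) {m : ℕ} (w : Fin m → Bool) :
    0 ≤ prefixProb M x b w := measureReal_nonneg

lemma prefixProb_le_one (M : Machine) (x : List Bool) (b : Bool) {m : ℕ} (w : Fin m → Bool) :
    prefixProb M x b w ≤ 1 := measureReal_le_one

lemma outputProb_eq_sum (M : Machine) {n : ℕ} (k : ℕ) (μ : Measure (SimpleGraph (Fin n)))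
    [IsFiniteMeasure μ] (b : Bool) : outputProb M k μ b = ∑ G, μ.real {G} *
      (coins.prod coins).real {r | M.Outputs (encodeInstance k G) r.1 r.2 b} := by
  rw [outputProb, measureReal_eq_sum_fiber _ measurable_fst]
  refine Finset.sum_congr rfl fun G _ => ?_
  rw [← measureReal_prod_prod]
  congr 1
  ext ⟨G', r⟩
  simp only [Set.mem_inter_iff, Set.mem_preimage, Set.mem_singleton_iff, Set.mem_ofPred_eq,
    Set.mem_prod]
  constructor <;> rintro ⟨rfl, h⟩ <;> exact ⟨rfl, h⟩

/-- The output probability of a machine that reads only the first `m` multiple access bits. -/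
lemma coins_prod_real_of_usesAtMost {M : Machine} {x : List Bool} {m : ℕ} (h : M.UsesAtMost x m)
    (b : Bool) : (coins.prod coins).real {r | M.Outputs x r.1 r.2 b} =
      𝔼 w : Fin m → Bool, prefixProb M x b w := by
  have hmeas : Measurable fun r : (ℕ → Bool) × (ℕ → Bool) => fun a : Fin m => r.2 a := by fun_prop
  rw [measureReal_eq_sum_fiber _ hmeas, Fintype.expect_eq_sum_div_card, Finset.sum_div]
  refine Finset.sum_congr rfl fun w _ => ?_
  have hset : (fun r : (ℕ → Bool) × (ℕ → Bool) => fun a : Fin m => r.2 a) ⁻¹' {w} ∩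
      {r | M.Outputs x r.1 r.2 b} =
      {ro | M.Outputs x ro (extendBits w) b} ×ˢ {ma | (fun a : Fin m => ma a) = w} := by
    ext ⟨ro, ma⟩
    simp only [Set.mem_inter_iff, Set.mem_preimage, Set.mem_singleton_iff, Set.mem_ofPred_eq,
      Set.mem_prod]
    rw [and_comm]
    refine and_congr_left fun hw => Machine.outputs_congr_of_usesAtMost h ro (fun a ha => ?_) b
    rw [← hw, extendBits, dif_pos ha]
  rw [hset, measureReal_prod_prod, coins_real_prefix, prefixProb, div_eq_mul_inv]
  simp

lemma coins_prod_real_fst (p : (ℕ → Bool) → Prop) :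
    (coins.prod coins).real {r | p r.1} = coins.real {ro | p ro} := by
  have : {r : (ℕ → Bool) × (ℕ → Bool) | p r.1} = {ro | p ro} ×ˢ Set.univ := by ext; simp
  rw [this, measureReal_prod_prod, probReal_univ, mul_one]

/-! ### The distributions of the graphs -/

lemma erdosRenyi_real_singleton {n : ℕ} (G : SimpleGraph (Fin n)) :
    (erdosRenyi n).real {G} = (Fintype.card (SimpleGraph (Fin n)) : ℝ)⁻¹ := by
  classical
  obtain ⟨c, hc⟩ : ∃ c : ℝ, ∀ G : SimpleGraph (Fin n), (erdosRenyi n).real {G} = c := by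
    refine ⟨(1 / 2) ^ n.choose 2, fun G => ?_⟩
    have hle : G.edgeSet.ncard ≤ n.choose 2 := by
      have := G.card_edgeFinset_le_card_choose_two
      rwa [Fintype.card_fin, ← Set.ncard_coe_finset, SimpleGraph.coe_edgeFinset] at this
    rw [measureReal_def, erdosRenyi, SimpleGraph.binomialRandom_singleton, Nat.card_fin]
    have h2 : (unitInterval.toNNReal (unitInterval.symm ⟨1 / 2, by norm_num, by norm_num⟩)) =
        unitInterval.toNNReal ⟨1 / 2, by norm_num, by norm_num⟩ := by
      ext
      simp [unitInterval.toNNReal]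
      norm_num
    rw [h2, ← pow_add, Nat.add_sub_cancel' hle, ENNReal.toReal_pow]
    rfl
  have hsum := measureReal_eq_sum_fiber (erdosRenyi n) measurable_id Set.univ
  simp only [Set.preimage_id, Set.inter_univ, hc, Finset.sum_const, probReal_univ, nsmul_eq_mul,
    Finset.card_univ] at hsum
  rw [hc]
  exact eq_inv_of_mul_eq_one_right hsum.symm

lemma sum_erdosRenyi {n : ℕ} (h : SimpleGraph (Fin n) → ℝ) :
    ∑ G, (erdosRenyi n).real {G} * h G = 𝔼 G, h G := by
  simp_rw [erdosRenyi_real_singleton]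
  rw [← Finset.mul_sum, Fintype.expect_eq_sum_div_card, div_eq_inv_mul]

lemma sum_erdosRenyi_preimage {n : ℕ} (φ : SimpleGraph (Fin n) → SimpleGraph (Fin n))
    (h : SimpleGraph (Fin n) → ℝ) :
    ∑ G, (erdosRenyi n).real {G₀ | φ G₀ = G} * h G = 𝔼 G₀, h (φ G₀) := by
  classical
  rw [← sum_erdosRenyi fun G => h (φ G)]
  have h1 : ∀ G, (erdosRenyi n).real {G₀ | φ G₀ = G} * h G =
      ∑ G₀, if φ G₀ = G then (erdosRenyi n).real {G₀} * h G else 0 := by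
    intro G
    rw [measureReal_eq_sum_fiber _ measurable_id, Finset.sum_mul]
    refine Finset.sum_congr rfl fun G₀ _ => ?_
    split_ifs with hG
    · congr 2
      ext G'
      simp only [Set.preimage_id, Set.mem_inter_iff, Set.mem_singleton_iff, Set.mem_ofPred_eq]
      exact ⟨fun h => h.1, fun h => ⟨h, h ▸ hG⟩⟩
    · convert zero_mul _
      convert measureReal_empty
      ext G'
      simp only [Set.preimage_id, Set.mem_inter_iff, Set.mem_singleton_iff, Set.mem_ofPred_eq,
        Set.mem_empty_iff_false, iff_false, not_and]
      rintro rfl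
      exact hG
  simp_rw [h1]
  rw [Finset.sum_comm]
  simp

/-- The vertex sets of size `k` with exactly one vertex in each block that contain the first
vertex. -/
def plantedSets (ℓ k : ℕ) : Finset (Finset (Fin (ℓ * k))) := by
  classical
  exact univ.filter fun K => K.card = k ∧
    (∀ i < k, ∃! v : Fin (ℓ * k), v ∈ K ∧ i * ℓ ≤ v.val ∧ v.val < (i + 1) * ℓ) ∧
      ∃ v ∈ K, v.val = 0

lemma mem_plantedSets {ℓ k : ℕ} {K : Finset (Fin (ℓ * k))} : K ∈ plantedSets ℓ k ↔ K.card = k ∧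
    (∀ i < k, ∃! v : Fin (ℓ * k), v ∈ K ∧ i * ℓ ≤ v.val ∧ v.val < (i + 1) * ℓ) ∧
      ∃ v ∈ K, v.val = 0 := by
  simp only [plantedSets, Finset.mem_filter, Finset.mem_univ, true_and]

lemma plantedPair_real (n k : ℕ) (E : Set (Finset (Fin n) × SimpleGraph (Fin n))) :
    (plantedPair n k).real E = ∑ K, (uniformOn {K : Finset (Fin n) | K.card = k}).real {K} *
      (erdosRenyi n).real {G | (K, G ⊔ cliqueOn K) ∈ E} := by
  rw [plantedPair, map_measureReal_apply (measurable_of_finite _) (Set.toFinite _).measurableSet,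
    measureReal_eq_sum_fiber _ measurable_fst]
  refine Finset.sum_congr rfl fun K _ => ?_
  rw [← measureReal_prod_prod]
  congr 1
  ext ⟨K', G⟩
  simp only [Set.mem_inter_iff, Set.mem_preimage, Set.mem_singleton_iff, Set.mem_ofPred_eq,
    Set.mem_prod]
  constructor <;> rintro ⟨rfl, h⟩ <;> exact ⟨rfl, h⟩

/-- The clique leakage distribution is the average, over the planted sets, of the distributions that
arise by planting a fixed set. -/
lemma sum_cliqueLeakage (ℓ k : ℕ) (h : SimpleGraph (Fin (ℓ * k)) → ℝ) :
    ∑ G, (cliqueLeakage ℓ k).real {G} * h G =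
      𝔼 K ∈ plantedSets ℓ k, 𝔼 G, h (G ⊔ cliqueOn K) := by
  classical
  set s : Set (Finset (Fin (ℓ * k))) := {K | K.card = k} with hs
  have hfin : IsFiniteMeasure (plantedPair (ℓ * k) k) := by
    unfold plantedPair
    infer_instance
  obtain ⟨c, hc0, hc⟩ : ∃ c : ℝ, (∀ K ∈ s, c ≠ 0) ∧
      ∀ K, (uniformOn s).real {K} = if K ∈ s then c else 0 := by
    refine ⟨(s.ncard : ℝ)⁻¹, fun K hK => ?_, fun K => ?_⟩
    · have : s.ncard ≠ 0 := Set.ncard_ne_zero_of_mem hK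
      positivity
    · have h1 := uniformOn_apply_finset (s := s.toFinset) (t := {K})
      rw [Set.coe_toFinset, Finset.coe_singleton, Finset.inter_singleton] at h1
      rw [measureReal_def, h1, Set.ncard_eq_toFinset_card']
      split_ifs with h2 h3 h3
      · simp
      · simp at h2; exact absurd h2 h3
      · simp at h2; exact absurd h3 h2
      · simp
  set A : Set (Finset (Fin (ℓ * k)) × SimpleGraph (Fin (ℓ * k))) :=
    {p | ∀ i < k, ∃! v : Fin (ℓ * k), v ∈ p.1 ∧ i * ℓ ≤ v.val ∧ v.val < (i + 1) * ℓ} with hA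
  set B : Set (Finset (Fin (ℓ * k)) × SimpleGraph (Fin (ℓ * k))) :=
    {p | ∃ v ∈ p.1, v.val = 0} with hB
  have hlaw : cliqueLeakage ℓ k = (cond (plantedPair (ℓ * k) k) (A ∩ B)).map Prod.snd := by
    rw [cliqueLeakage, cliqueLeakagePair, kPartitePair, cond_cond_eq_cond_inter
      (Set.toFinite _).measurableSet (Set.toFinite _).measurableSet]
  have hmem : ∀ K G, K ∈ s → ((K, G) ∈ A ∩ B ↔ K ∈ plantedSets ℓ k) := by
    intro K G hK
    rw [mem_plantedSets]
    exact ⟨fun h => ⟨hK, h.1, h.2⟩, fun h => ⟨h.2.1, h.2.2⟩⟩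
  have hsub : ∀ K ∈ plantedSets ℓ k, K ∈ s := by
    exact fun K hK => (mem_plantedSets.1 hK).1
  have hreal : ∀ E : Set (SimpleGraph (Fin (ℓ * k))), (plantedPair (ℓ * k) k).real
      (A ∩ B ∩ Prod.snd ⁻¹' E) =
      ∑ K ∈ plantedSets ℓ k, c * (erdosRenyi (ℓ * k)).real {G | G ⊔ cliqueOn K ∈ E} := by
    intro E
    rw [plantedPair_real, ← Finset.sum_subset (Finset.subset_univ (plantedSets ℓ k))]
    · refine Finset.sum_congr rfl fun K hK => ?_
      rw [hc, if_pos (hsub K hK)]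
      congr 2
      ext G
      exact ⟨fun h => h.2, fun h => ⟨(hmem K _ (hsub K hK)).2 hK, h⟩⟩
    · intro K _ hK
      rw [hc]
      split_ifs with hKs
      · convert mul_zero _
        convert measureReal_empty
        ext G
        simp only [Set.mem_ofPred_eq, Set.mem_empty_iff_false, iff_false]
        exact fun h => hK ((hmem K _ hKs).1 h.1)
      · rw [zero_mul]
  have hAB : (plantedPair (ℓ * k) k).real (A ∩ B) = (plantedSets ℓ k).card * c := by
    have := hreal Set.univ
    simpa using this
  have hpoint : ∀ G, (cliqueLeakage ℓ k).real {G} =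
      𝔼 K ∈ plantedSets ℓ k, (erdosRenyi (ℓ * k)).real {G₀ | G₀ ⊔ cliqueOn K = G} := by
    intro G
    rw [hlaw, map_measureReal_apply measurable_snd (measurableSet_singleton G),
      measureReal_def, cond_apply (Set.toFinite _).measurableSet, ENNReal.toReal_mul,
      ENNReal.toReal_inv, ← measureReal_def, ← measureReal_def, hreal, hAB, ← Finset.mul_sum,
      Finset.expect_eq_sum_div_card]
    rcases (plantedSets ℓ k).eq_empty_or_nonempty with h0 | ⟨K, hK⟩
    · simp [h0]
    · have := hc0 K (hsub K hK)
      have h2 : ((plantedSets ℓ k).card : ℝ) ≠ 0 := by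
        simpa using Finset.ne_empty_of_mem hK
      field_simp
      rfl
  simp_rw [hpoint, Finset.expect_mul, ← Finset.expect_sum_comm]
  exact Finset.expect_congr rfl fun K _ => sum_erdosRenyi_preimage _ h

/-! ### Averages and symmetry -/

/-- If the permutations `e t` of the finite set `s` act simply transitively on the values of `π`,
and do not change the values of `ρ`, then `π` is uniformly distributed and independent of `ρ` on
`s`. -/
lemma sum_eq_sum_expect {X T Y Z : Type*} [Fintype T] [Nonempty T] [Fintype Y] (s : Finset X)
    (e : T → X → X) (hmap : ∀ t, ∀ x ∈ s, e t x ∈ s) (hinj : ∀ t, Set.InjOn (e t) s) (a : T → Y → Y)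
    (ha : ∀ y, Function.Bijective fun t => a t y) (π : X → Y)
      (hπ : ∀ t, ∀ x ∈ s, π (e t x) = a t (π x))
    (ρ : X → Z) (hρ : ∀ t, ∀ x ∈ s, ρ (e t x) = ρ x) (h : Z → Y → ℝ) :
    ∑ x ∈ s, h (ρ x) (π x) = ∑ x ∈ s, 𝔼 y, h (ρ x) y := by
  have h1 : ∀ t, ∑ x ∈ s, h (ρ x) (π x) = ∑ x ∈ s, h (ρ x) (a t (π x)) := by
    intro t
    symm
    refine Finset.sum_nbij (e t) (hmap t) (hinj t)
      (Finset.surjOn_of_injOn_of_card_le _ (hmap t) (hinj t) le_rfl) fun x hx => ?_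
    rw [hπ t x hx, hρ t x hx]
  calc ∑ x ∈ s, h (ρ x) (π x) = 𝔼 _t : T, ∑ x ∈ s, h (ρ x) (π x) := by
        rw [Fintype.expect_const]
    _ = 𝔼 t, ∑ x ∈ s, h (ρ x) (a t (π x)) := Finset.expect_congr rfl fun t _ => h1 t
    _ = ∑ x ∈ s, 𝔼 t, h (ρ x) (a t (π x)) := Finset.expect_sum_comm _ _ _
    _ = _ := Finset.sum_congr rfl fun x _ => Fintype.expect_bijective _ (ha (π x)) _ _ fun _ => rfl

/-- The case of `sum_eq_sum_expect` without `ρ`. -/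
lemma expect_eq_expect {X T Y : Type*} [Fintype T] [Nonempty T] [Fintype Y] (s : Finset X)
    (hs : s.Nonempty) (e : T → X → X) (hmap : ∀ t, ∀ x ∈ s, e t x ∈ s)
    (hinj : ∀ t, Set.InjOn (e t) s) (a : T → Y → Y)
    (ha : ∀ y, Function.Bijective fun t => a t y) (π : X → Y)
    (hπ : ∀ t, ∀ x ∈ s, π (e t x) = a t (π x)) (h : Y → ℝ) :
    𝔼 x ∈ s, h (π x) = 𝔼 y, h y := by
  have := sum_eq_sum_expect s e hmap hinj a ha π hπ (fun _ => ()) (fun _ _ _ => rfl) fun _ => h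
  rw [Finset.expect_eq_sum_div_card, this, Finset.sum_const, nsmul_eq_mul, mul_div_cancel_left₀]
  exact_mod_cast hs.card_pos.ne'

lemma symmDiff_adj {V : Type*} (G E : SimpleGraph V) (u v : V) :
    (symmDiff G E).Adj u v ↔ ¬(G.Adj u v ↔ E.Adj u v) := by
  simp only [symmDiff, SimpleGraph.sup_adj, SimpleGraph.sdiff_adj]
  tauto

/-- Induced subgraphs of uniformly random graphs are uniformly random. -/
lemma expect_comap {m n : ℕ} {f : Fin m → Fin n} (hf : Function.Injective f)
    (h : SimpleGraph (Fin m) → ℝ) :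
    𝔼 G : SimpleGraph (Fin n), h (G.comap f) = 𝔼 G, h G := by
  refine expect_eq_expect (T := SimpleGraph (Fin m)) univ ⟨⊥, Finset.mem_univ _⟩
    (fun t G => symmDiff G (t.map f)) (fun _ _ _ => Finset.mem_univ _)
    (fun t => (symmDiff_left_injective _).injOn) (fun t y => symmDiff y t)
    (fun y => (symmDiff_right_involutive y).bijective) (fun G => G.comap f) (fun t G _ => ?_) h
  ext u v
  have : (t.map f).Adj (f u) (f v) ↔ t.Adj u v := SimpleGraph.map_adj_apply (f := ⟨f, hf⟩)
  simp only [SimpleGraph.comap_adj, symmDiff_adj, this]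

/-! ### Planted sets and their restrictions to the first blocks -/

lemma block_unique {ℓ i i' a a' : ℕ} (ha : a < ℓ) (ha' : a' < ℓ) (h : i * ℓ + a = i' * ℓ + a') :
    i = i' ∧ a = a' := by
  have h1 : i = i' := by
    have := congrArg (· / ℓ) h
    simpa [Nat.add_comm _ a, Nat.add_comm _ a', Nat.add_mul_div_right _ _ (Nat.zero_lt_of_lt ha),
      Nat.div_eq_of_lt ha, Nat.div_eq_of_lt ha'] using this
  subst h1
  exact ⟨rfl, by omega⟩

lemma block_lt {ℓ k i a : ℕ} (hi : i < k) (ha : a < ℓ) : i * ℓ + a < ℓ * k := by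
  have := Nat.mul_le_mul_right ℓ (Nat.succ_le_of_lt hi)
  rw [Nat.succ_mul] at this
  rw [Nat.mul_comm ℓ k]
  omega

/-- The set that contains the vertex number `f i` of the block `i`, for all `i`. -/
def sectionSet {ℓ k : ℕ} (f : Fin k → Fin ℓ) : Finset (Fin (ℓ * k)) :=
  univ.image fun i => ⟨i * ℓ + f i, block_lt i.2 (f i).2⟩

lemma mem_sectionSet {ℓ k : ℕ} {f : Fin k → Fin ℓ} {v : Fin (ℓ * k)} :
    v ∈ sectionSet f ↔ ∃ i : Fin k, v.val = i * ℓ + f i := by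
  simp only [sectionSet, Finset.mem_image, Finset.mem_univ, true_and, Fin.ext_iff]
  exact exists_congr fun i => eq_comm

lemma card_sectionSet {ℓ k : ℕ} (f : Fin k → Fin ℓ) : (sectionSet f).card = k := by
  rw [sectionSet, Finset.card_image_of_injective, Finset.card_univ, Fintype.card_fin]
  intro i i' h
  rw [Fin.mk.injEq] at h
  exact Fin.ext (block_unique (f i).2 (f i').2 h).1

lemma sectionSet_injective {ℓ k : ℕ} :
    Function.Injective (sectionSet : (Fin k → Fin ℓ) → Finset (Fin (ℓ * k))) := by
  intro f f' h
  funext i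
  have : (⟨i * ℓ + f i, block_lt i.2 (f i).2⟩ : Fin (ℓ * k)) ∈ sectionSet f' :=
    h ▸ mem_sectionSet.2 ⟨i, rfl⟩
  obtain ⟨i', hi'⟩ := mem_sectionSet.1 this
  obtain ⟨h1, h2⟩ := block_unique (f i).2 (f' i').2 hi'
  rw [Fin.ext_iff, h2, Fin.ext h1]

section
variable {ℓ k : ℕ} [NeZero ℓ] [NeZero k]

lemma sectionSet_mem_plantedSets {f : Fin k → Fin ℓ} (hf : f 0 = 0) :
    sectionSet f ∈ plantedSets ℓ k := by
  rw [mem_plantedSets]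
  refine ⟨card_sectionSet f, fun i hi => ?_, ?_⟩
  · refine ⟨⟨i * ℓ + f ⟨i, hi⟩, block_lt hi (f ⟨i, hi⟩).2⟩, ⟨mem_sectionSet.2 ⟨⟨i, hi⟩, rfl⟩, ?_,
      ?_⟩, ?_⟩
    · exact Nat.le_add_right _ _
    · have := (f ⟨i, hi⟩).2
      rw [Nat.succ_mul]
      exact Nat.add_lt_add_left this _
    · rintro v ⟨hv, hv1, hv2⟩
      obtain ⟨i', hi'⟩ := mem_sectionSet.1 hv
      rw [Nat.succ_mul] at hv2
      have h3 : v.val - i * ℓ < ℓ := by omega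
      obtain ⟨h1, h2⟩ := block_unique (i := i'.val) (i' := i) (f i').2 h3 (by omega)
      obtain rfl : i' = ⟨i, hi⟩ := Fin.ext h1
      exact Fin.ext hi'
  · refine ⟨⟨((0 : Fin k) : ℕ) * ℓ + f 0, block_lt (0 : Fin k).2 (f 0).2⟩,
      mem_sectionSet.2 ⟨0, rfl⟩, ?_⟩
    simp [hf]

lemma exists_eq_sectionSet {K : Finset (Fin (ℓ * k))} (hK : K ∈ plantedSets ℓ k) :
    ∃ f : Fin k → Fin ℓ, f 0 = 0 ∧ sectionSet f = K := by
  rw [mem_plantedSets] at hK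
  obtain ⟨hcard, hex, v₀, hv₀, hv₀'⟩ := hK
  choose v hv using fun i : Fin k => (hex i i.2).exists
  have hlt : ∀ i : Fin k, (v i).val - i * ℓ < ℓ := fun i => by
    have := (hv i).2.2
    rw [Nat.succ_mul] at this
    have := NeZero.pos ℓ
    omega
  let f : Fin k → Fin ℓ := fun i => ⟨(v i).val - i * ℓ, hlt i⟩
  have hf : sectionSet f = K := by
    refine Finset.eq_of_subset_of_card_le (fun w hw => ?_) (by rw [hcard, card_sectionSet])
    obtain ⟨i, hi⟩ := mem_sectionSet.1 hw
    have : w = v i := Fin.ext (by rw [hi]; exact Nat.add_sub_cancel' (hv i).2.1)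
    rw [this]
    exact (hv i).1
  refine ⟨f, ?_, hf⟩
  obtain ⟨i, hi⟩ := mem_sectionSet.1 (hf ▸ hv₀)
  have hi0 : i = 0 := by
    obtain ⟨h1, -⟩ := block_unique (i := 0) (i' := i.val) (a := 0) (NeZero.pos ℓ) (f i).2 (by omega)
    exact Fin.ext (by rw [← h1, Fin.val_zero])
  subst hi0
  exact Fin.ext (by simp only [Fin.val_zero]; omega)

lemma expect_plantedSets (h : Finset (Fin (ℓ * k)) → ℝ) :
    𝔼 K ∈ plantedSets ℓ k, h K = 𝔼 f : {f : Fin k → Fin ℓ // f 0 = 0}, h (sectionSet f.1) := by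
  symm
  refine Finset.expect_nbij (fun f => sectionSet f.1) (fun f _ => sectionSet_mem_plantedSets f.2)
    (fun _ _ => rfl) (fun f _ f' _ hff => Subtype.ext (sectionSet_injective hff)) fun K hK => ?_
  obtain ⟨f, hf, rfl⟩ := exists_eq_sectionSet hK
  exact ⟨⟨f, hf⟩, Finset.mem_coe.2 (Finset.mem_univ _), rfl⟩

end

/-- The vertices of a set that belong to the induced subgraph on the first `m` vertices. -/
def restrictSet {m n : ℕ} (hmn : m ≤ n) (K : Finset (Fin n)) : Finset (Fin m) :=
  univ.filter fun v => Fin.castLE hmn v ∈ K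

lemma restrictSet_sectionSet {ℓ k k' : ℕ} (hk : k ≤ k') (hmn : ℓ * k ≤ ℓ * k')
    (f : Fin k' → Fin ℓ) :
    restrictSet hmn (sectionSet f) = sectionSet fun i => f (Fin.castLE hk i) := by
  ext v
  rw [restrictSet, Finset.mem_filter, mem_sectionSet, mem_sectionSet]
  constructor
  · rintro ⟨-, i, hi⟩
    have hik : i.val < k := by
      by_contra hik
      have h1 := Nat.mul_le_mul_right ℓ (not_lt.1 hik)
      have h2 : v.val < k * ℓ := v.2.trans_eq (Nat.mul_comm _ _)
      rw [Fin.val_castLE] at hi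
      omega
    exact ⟨⟨i, hik⟩, hi⟩
  · rintro ⟨i, hi⟩
    exact ⟨Finset.mem_univ _, Fin.castLE hk i, hi⟩

/-- The restriction of a uniformly random planted set to the first `k` blocks is a uniformly random
planted set. -/
lemma expect_restrictSet {ℓ k k' : ℕ} [NeZero ℓ] [NeZero k] (hk : k ≤ k')
    (hmn : ℓ * k ≤ ℓ * k') (h : Finset (Fin (ℓ * k)) → ℝ) :
    𝔼 K ∈ plantedSets ℓ k', h (restrictSet hmn K) = 𝔼 K ∈ plantedSets ℓ k, h K := by
  have : NeZero k' := ⟨by have := NeZero.pos k; omega⟩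
  rw [expect_plantedSets, expect_plantedSets]
  simp_rw [restrictSet_sectionSet hk hmn]
  let X (j : ℕ) [NeZero j] := {f : Fin j → Fin ℓ // f 0 = 0}
  have : Nonempty (X k) := ⟨⟨0, rfl⟩⟩
  refine expect_eq_expect (X := X k') (T := X k) (Y := X k) univ ⟨⟨0, rfl⟩, Finset.mem_univ _⟩
    (fun t f => ⟨fun i => f.1 i + if hi : i.val < k then t.1 ⟨i, hi⟩ else 0, ?_⟩)
    (fun _ _ _ => Finset.mem_univ _) (fun t => ?_) (fun t y => ⟨y.1 + t.1, ?_⟩) (fun y => ?_)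
    (fun f => ⟨fun i => f.1 (Fin.castLE hk i), ?_⟩) (fun t f _ => ?_) fun f => h (sectionSet f.1)
  · have : ((0 : Fin k') : ℕ) < k := NeZero.pos k
    beta_reduce
    rw [f.2, zero_add, dif_pos this]
    exact t.2
  · intro f _ f' _ hff
    refine Subtype.ext (funext fun i => ?_)
    exact add_right_cancel (congrFun (congrArg Subtype.val hff) i)
  · simp [y.2, t.2]
  · refine (Finite.injective_iff_bijective).1 fun t t' htt => ?_
    exact Subtype.ext (add_left_cancel (congrArg Subtype.val htt))
  · exact f.2
  · refine Subtype.ext (funext fun i => ?_)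
    simp

lemma comap_sup_cliqueOn {m n : ℕ} (hmn : m ≤ n) (G : SimpleGraph (Fin n)) (K : Finset (Fin n)) :
    (G ⊔ cliqueOn K).comap (Fin.castLE hmn) =
      G.comap (Fin.castLE hmn) ⊔ cliqueOn (restrictSet hmn K) := by
  ext u v
  simp [cliqueOn, restrictSet, SimpleGraph.comap_adj]

/-! ### The extracted bits are uniformly distributed -/

section

variable {n N : ℕ}

lemma natAdj_of_lt (G : SimpleGraph (Fin n)) {i j : ℕ} (hi : i < n) (hj : j < n) :
    natAdj G i j = true ↔ G.Adj ⟨i, hi⟩ ⟨j, hj⟩ := by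
  simp [natAdj, hi, hj]

lemma mem_goodRows {G : SimpleGraph (Fin n)} {r : ℕ} :
    r ∈ goodRows N G ↔ r < 6 * N ∧ natAdj G 0 (N + r) = false := by
  simp [goodRows]

lemma nodup_goodRows (G : SimpleGraph (Fin n)) : (goodRows N G).Nodup :=
  List.nodup_range.filter _

/-- The edges that belong to those extracted bits with `t a = true`. -/
def flipGraph (N : ℕ) (t : Fin (N * N) → Bool) (G : SimpleGraph (Fin n)) : SimpleGraph (Fin n) :=
  SimpleGraph.fromRel fun u v => ∃ a, t a = true ∧ ∃ r, (goodRows N G)[a.val / N]? = some r ∧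
    u.val = N + r ∧ v.val = 7 * N + a.val % N

lemma flipGraph_congr (t : Fin (N * N) → Bool) {G G' : SimpleGraph (Fin n)}
    (h : goodRows N G = goodRows N G') : flipGraph N t G = flipGraph N t G' := by
  simp only [flipGraph, h]

/-- Toggled edges end in the last eighth of the vertices and avoid the first eighth. -/
lemma le_of_flipGraph_adj {t : Fin (N * N) → Bool} {G : SimpleGraph (Fin n)} {u v : Fin n}
    (h : (flipGraph N t G).Adj u v) : N ≤ u.val ∧ N ≤ v.val ∧ (7 * N ≤ u.val ∨ 7 * N ≤ v.val) := by
  rw [flipGraph, SimpleGraph.fromRel_adj] at h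
  obtain ⟨-, ⟨a, -, r, -, h1, h2⟩ | ⟨a, -, r, -, h1, h2⟩⟩ := h <;> omega

lemma flipGraph_adj {t : Fin (N * N) → Bool} {G : SimpleGraph (Fin n)} {u v : Fin n} {r : ℕ}
    {a : Fin (N * N)} (hr : (goodRows N G)[a.val / N]? = some r) (hu : u.val = N + r)
    (hv : v.val = 7 * N + a.val % N) : (flipGraph N t G).Adj u v ↔ t a = true := by
  have hlt : ∀ {i r' : ℕ}, (goodRows N G)[i]? = some r' → r' < 6 * N := fun h =>
    (mem_goodRows.1 (List.mem_of_getElem? h)).1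
  have hr6 := hlt hr
  rw [flipGraph, SimpleGraph.fromRel_adj]
  constructor
  · rintro ⟨-, ⟨a', ht, r', hr', h1, h2⟩ | ⟨a', ht, r', hr', h1, h2⟩⟩
    · obtain rfl : r' = r := by omega
      have h3 : a.val / N = a'.val / N :=
        (List.getElem?_inj (List.getElem?_eq_some_iff.1 hr).1 (nodup_goodRows G)).1
          (hr.trans hr'.symm)
      have h4 : a.val % N = a'.val % N := by omega
      have : a = a' := Fin.ext (by rw [← Nat.div_add_mod a.val N, h3, h4, Nat.div_add_mod])
      rwa [this]
    · have := hlt hr'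
      omega
  · intro ht
    refine ⟨fun h => ?_, .inl ⟨a, ht, r, hr, hu, hv⟩⟩
    have := congrArg Fin.val h
    omega

variable (hn : n = 8 * N) (hN : 0 < N) (K : Finset (Fin n))
include hn hN

lemma goodRows_flip (t : Fin (N * N) → Bool) (G₀ G : SimpleGraph (Fin n)) :
    goodRows N (symmDiff G₀ (flipGraph N t G) ⊔ cliqueOn K) = goodRows N (G₀ ⊔ cliqueOn K) := by
  refine List.filter_congr fun r hr => ?_
  rw [List.mem_range] at hr
  congr 1
  rw [Bool.eq_iff_iff, natAdj_of_lt _ (by omega) (by omega), natAdj_of_lt _ (by omega) (by omega)]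
  have : ¬(flipGraph N t G).Adj ⟨0, by omega⟩ ⟨N + r, by omega⟩ := fun h => by
    have := (le_of_flipGraph_adj h).1
    simp only at this
    omega
  simp only [SimpleGraph.sup_adj, symmDiff_adj, this, iff_false, not_not]

omit hn hN in
lemma comap_flip {m : ℕ} (hmn : m ≤ n) (hm : m ≤ 7 * N) (t : Fin (N * N) → Bool)
    (G₀ G : SimpleGraph (Fin n)) :
    (symmDiff G₀ (flipGraph N t G) ⊔ cliqueOn K).comap (Fin.castLE hmn) =
      (G₀ ⊔ cliqueOn K).comap (Fin.castLE hmn) := by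
  ext u v
  have : ¬(flipGraph N t G).Adj (Fin.castLE hmn u) (Fin.castLE hmn v) := fun h => by
    have := (le_of_flipGraph_adj h).2.2
    simp only [Fin.val_castLE] at this
    omega
  simp only [SimpleGraph.comap_adj, SimpleGraph.sup_adj, symmDiff_adj, this, iff_false, not_not]

variable (hK : ∀ v ∈ K, (⟨0, by omega⟩ : Fin n) ∈ K)
include hK

/-- If the first vertex is planted, then vertices that are not adjacent to it are not planted. -/
lemma not_mem_of_mem_goodRows {G₀ : SimpleGraph (Fin n)} {r : ℕ}
    (hr : r ∈ goodRows N (G₀ ⊔ cliqueOn K)) (h : N + r < n) : (⟨N + r, h⟩ : Fin n) ∉ K := by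
  intro hmem
  have h1 := (mem_goodRows.1 hr).2
  have h2 : natAdj (G₀ ⊔ cliqueOn K) 0 (N + r) = true := by
    rw [natAdj_of_lt _ (by omega) h]
    refine Or.inr ⟨fun h3 => ?_, hK _ hmem, hmem⟩
    have := congrArg Fin.val h3
    simp only at this
    omega
  rw [h1] at h2
  exact absurd h2 (by simp)

/-- As the rows that are used belong to unplanted vertices, toggling an edge before the planting
toggles the extracted bit. -/
lemma graphBits_flip (t : Fin (N * N) → Bool) {G₀ : SimpleGraph (Fin n)}
    (hG : N ≤ (goodRows N (G₀ ⊔ cliqueOn K)).length) (a : Fin (N * N)) :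
    graphBits N (symmDiff G₀ (flipGraph N t (G₀ ⊔ cliqueOn K)) ⊔ cliqueOn K) a =
      (graphBits N (G₀ ⊔ cliqueOn K) a ^^ t a) := by
  have ha : a.val / N < (goodRows N (G₀ ⊔ cliqueOn K)).length :=
    (Nat.div_lt_of_lt_mul a.2).trans_le hG
  obtain ⟨r, hr⟩ : ∃ r, (goodRows N (G₀ ⊔ cliqueOn K))[a.val / N]? = some r :=
    ⟨_, List.getElem?_eq_getElem ha⟩
  have hmem := List.mem_of_getElem? hr
  have hr6 := (mem_goodRows.1 hmem).1
  have hmod := Nat.mod_lt a.val hN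
  have hu : N + r < n := by omega
  have hv : 7 * N + a.val % N < n := by omega
  have hKr := not_mem_of_mem_goodRows hn hN K hK hmem hu
  rw [graphBits, graphBits, goodRows_flip hn hN, hr, Option.elim_some, Option.elim_some,
    Bool.eq_iff_iff, natAdj_of_lt _ hu hv, Bool.xor_iff_ne, ne_eq, Bool.eq_iff_iff,
    natAdj_of_lt _ hu hv, ← flipGraph_adj (t := t) (u := ⟨N + r, hu⟩) (v := ⟨_, hv⟩) hr rfl rfl]
  have hc : ¬(cliqueOn K).Adj ⟨N + r, hu⟩ ⟨7 * N + a.val % N, hv⟩ := fun h => hKr h.2.1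
  simp only [SimpleGraph.sup_adj, symmDiff_adj, hc, or_false]

open Classical in
/-- Over the graphs from which at least `N` rows of bits can be extracted, the extracted bits are
uniformly distributed and independent of the induced subgraph on the first vertices: toggling their
edges permutes these graphs, and changes neither the rows nor the induced subgraph. -/
lemma sum_good {m : ℕ} (hmn : m ≤ n) (hm : m ≤ 7 * N)
    (h : SimpleGraph (Fin m) → (Fin (N * N) → Bool) → ℝ) :
    ∑ G₀ with N ≤ (goodRows N (G₀ ⊔ cliqueOn K)).length,
        h ((G₀ ⊔ cliqueOn K).comap (Fin.castLE hmn)) (fun a => graphBits N (G₀ ⊔ cliqueOn K) a) =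
      ∑ G₀ with N ≤ (goodRows N (G₀ ⊔ cliqueOn K)).length,
        𝔼 w, h ((G₀ ⊔ cliqueOn K).comap (Fin.castLE hmn)) w := by
  refine sum_eq_sum_expect (T := Fin (N * N) → Bool) _
    (fun t G₀ => symmDiff G₀ (flipGraph N t (G₀ ⊔ cliqueOn K))) (fun t G₀ hG => ?_)
    (fun t => Function.Injective.injOn ?_) (fun t y a => y a ^^ t a) (fun y => ?_) _
    (fun t G₀ hG => ?_) (fun G₀ => (G₀ ⊔ cliqueOn K).comap (Fin.castLE hmn))
    (fun t G₀ _ => comap_flip K hmn hm t G₀ _) h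
  · rw [Finset.mem_filter] at hG ⊢
    rw [goodRows_flip hn hN]
    exact ⟨Finset.mem_univ _, hG.2⟩
  · have hflip : ∀ G₀ G, flipGraph N t (symmDiff G₀ (flipGraph N t G) ⊔ cliqueOn K) =
        flipGraph N t (G₀ ⊔ cliqueOn K) := fun G₀ G =>
      flipGraph_congr t (goodRows_flip hn hN K t G₀ G)
    refine Function.Involutive.injective fun G₀ => ?_
    rw [hflip, symmDiff_symmDiff_cancel_right]
  · refine (Finite.injective_iff_bijective).1 fun t t' htt => funext fun a => ?_
    simpa using congrFun htt a
  · rw [Finset.mem_filter] at hG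
    exact funext fun a => graphBits_flip hn hN K hK t hG.2 a

end

/-! ### Most graphs yield sufficiently many bits -/

section

open scoped Classical

variable {n : ℕ}

/-- `1` for edges and `-1` for non-edges. -/
def edgeSign (G : SimpleGraph (Fin n)) (u v : Fin n) : ℝ := if G.Adj u v then 1 else -1

lemma edgeSign_sq (G : SimpleGraph (Fin n)) (u v : Fin n) :
    edgeSign G u v * edgeSign G u v = 1 := by
  unfold edgeSign
  split_ifs <;> norm_num

/-- The signs of different edges at a vertex are uncorrelated. -/
lemma sum_edgeSign_mul {u v w : Fin n} (huv : u ≠ v) (hvw : v ≠ w) :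
    ∑ G : SimpleGraph (Fin n), edgeSign G u v * edgeSign G u w = 0 := by
  have key : ∑ G : SimpleGraph (Fin n), edgeSign G u v * edgeSign G u w =
      ∑ G : SimpleGraph (Fin n), -(edgeSign G u v * edgeSign G u w) := by
    refine Fintype.sum_bijective (fun G => symmDiff G (SimpleGraph.edge u v))
      (symmDiff_left_involutive _).bijective _ _ fun G => ?_
    have h1 : (SimpleGraph.edge u v).Adj u v := by simp [SimpleGraph.edge_adj, huv]
    have h2 : ¬(SimpleGraph.edge u v).Adj u w := by
      simp only [SimpleGraph.edge_adj]
      rintro ⟨⟨-, h⟩ | ⟨h, -⟩, -⟩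
      · exact hvw h.symm
      · exact huv h
    simp only [edgeSign, symmDiff_adj, h1, h2, iff_true, iff_false, not_not]
    split_ifs <;> norm_num
  rw [Finset.sum_neg_distrib] at key
  linarith

lemma sum_sq_sum_edgeSign (u : Fin n) {R : Finset (Fin n)} (hu : u ∉ R) :
    ∑ G : SimpleGraph (Fin n), (∑ v ∈ R, edgeSign G u v) ^ 2 =
      R.card * Fintype.card (SimpleGraph (Fin n)) := by
  simp_rw [sq, Finset.sum_mul_sum]
  rw [Finset.sum_comm]
  have : ∀ v ∈ R, ∑ G : SimpleGraph (Fin n), ∑ w ∈ R, edgeSign G u v * edgeSign G u w =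
      Fintype.card (SimpleGraph (Fin n)) := by
    intro v hv
    rw [Finset.sum_comm, Finset.sum_eq_single v]
    · simp [edgeSign_sq]
    · exact fun w _ hwv => sum_edgeSign_mul (fun h => hu (h ▸ hv)) hwv.symm
    · exact fun h => absurd hv h
  rw [Finset.sum_congr rfl this]
  simp

variable {N : ℕ} (hn : n = 8 * N) (hN : 0 < N) (K : Finset (Fin n)) (hcard : K.card ≤ N)
include hn hN hcard

/-- Chebyshev's inequality for the number of non-neighbours of the first vertex among the at least
`5 * N` unplanted vertices in `N, …, 7 * N - 1`: with probability at most `1 / N` there are fewer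
than `N` of them. -/
lemma card_bad : ({G₀ | ¬N ≤ (goodRows N (G₀ ⊔ cliqueOn K)).length} :
    Finset (SimpleGraph (Fin n))).card * N ≤ Fintype.card (SimpleGraph (Fin n)) := by
  let v₀ : Fin n := ⟨0, by omega⟩
  let A : Finset (Fin n) := univ.filter fun v => N ≤ v.val ∧ v.val < 7 * N
  let R := A \ K
  have hA : A.card = 6 * N := by
    have hf : Function.Injective fun i : Fin (6 * N) => (⟨N + i, by omega⟩ : Fin n) := by
      intro i j h
      rw [Fin.mk.injEq] at h
      exact Fin.ext (by omega)
    have : A = univ.image fun i : Fin (6 * N) => (⟨N + i, by omega⟩ : Fin n) := by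
      ext v
      simp only [A, Finset.mem_filter, Finset.mem_univ, true_and, Finset.mem_image, Fin.ext_iff]
      constructor
      · rintro ⟨h1, h2⟩
        exact ⟨⟨v.val - N, by omega⟩, Nat.add_sub_cancel' h1⟩
      · rintro ⟨i, hi⟩
        have := i.2
        omega
    rw [this, Finset.card_image_of_injective _ hf, Finset.card_univ, Fintype.card_fin]
  have hR : R.card ≤ 6 * N := hA ▸ Finset.card_le_card Finset.sdiff_subset
  have hR' : 5 * N ≤ R.card := by
    have := Finset.le_card_sdiff K A
    change A.card - K.card ≤ R.card at this
    omega
  have hv₀ : v₀ ∉ R := by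
    intro h
    have := (Finset.mem_filter.1 (Finset.mem_sdiff.1 h).1).2.1
    simp only [v₀] at this
    omega
  -- few non-neighbours of the first vertex make the sum of the signs large
  have hbad : ∀ G₀ : SimpleGraph (Fin n), ¬N ≤ (goodRows N (G₀ ⊔ cliqueOn K)).length →
      (3 * N : ℝ) ^ 2 ≤ (∑ v ∈ R, edgeSign G₀ v₀ v) ^ 2 := by
    intro G₀ hG
    let B := R.filter fun v => ¬G₀.Adj v₀ v
    have hB : B.card ≤ (goodRows N (G₀ ⊔ cliqueOn K)).length := by
      rw [← List.toFinset_card_of_nodup (nodup_goodRows _)]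
      refine Finset.card_le_card_of_injOn (fun v => v.val - N) (fun v hv => ?_) fun v hv w hw h =>
        ?_
      · rw [Finset.mem_coe, Finset.mem_filter, Finset.mem_sdiff, Finset.mem_filter] at hv
        obtain ⟨⟨⟨-, h1, h2⟩, h3⟩, h4⟩ := hv
        rw [Finset.mem_coe, List.mem_toFinset, mem_goodRows]
        refine ⟨by beta_reduce; omega, ?_⟩
        rw [Nat.add_sub_cancel' h1, ← Bool.not_eq_true, natAdj_of_lt _ (by omega) v.2]
        rintro (h | h)
        · exact h4 h
        · exact h3 h.2.2
      · rw [Finset.mem_coe, Finset.mem_filter, Finset.mem_sdiff, Finset.mem_filter] at hv hw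
        have h1 := hv.1.1.2.1
        have h2 := hw.1.1.2.1
        simp only at h
        exact Fin.ext (by omega)
    have hsum : ∑ v ∈ R, edgeSign G₀ v₀ v = R.card - 2 * B.card := by
      have h1 : ∀ v, edgeSign G₀ v₀ v = 1 - 2 * if ¬G₀.Adj v₀ v then 1 else 0 := fun v => by
        unfold edgeSign
        split_ifs <;> norm_num
      rw [Finset.sum_congr rfl fun v _ => h1 v, Finset.sum_sub_distrib, ← Finset.mul_sum,
        Finset.sum_boole]
      simp [B]
    rw [hsum]
    have h3 : (B.card : ℝ) ≤ N := by exact_mod_cast (by omega : B.card ≤ N)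
    have h4 : (5 * N : ℝ) ≤ R.card := by exact_mod_cast hR'
    exact pow_le_pow_left₀ (by positivity) (by linarith) 2
  set S : Finset (SimpleGraph (Fin n)) :=
    {G₀ | ¬N ≤ (goodRows N (G₀ ⊔ cliqueOn K)).length} with hS
  have hmain : (S.card : ℝ) * (3 * N) ^ 2 ≤ 6 * N * Fintype.card (SimpleGraph (Fin n)) := by
    calc (S.card : ℝ) * (3 * N) ^ 2 = ∑ _G₀ ∈ S, (3 * N : ℝ) ^ 2 := by simp
      _ ≤ ∑ G₀ ∈ S, (∑ v ∈ R, edgeSign G₀ v₀ v) ^ 2 :=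
        Finset.sum_le_sum fun G₀ h => hbad G₀ (Finset.mem_filter.1 h).2
      _ ≤ ∑ G₀, (∑ v ∈ R, edgeSign G₀ v₀ v) ^ 2 :=
        Finset.sum_le_sum_of_subset_of_nonneg (Finset.subset_univ _) fun _ _ _ => sq_nonneg _
      _ = R.card * Fintype.card (SimpleGraph (Fin n)) := sum_sq_sum_edgeSign v₀ hv₀
      _ ≤ _ := by
        gcongr
        exact_mod_cast hR
  have hNpos : (0 : ℝ) < N := by exact_mod_cast hN
  have : (S.card : ℝ) * N ≤ Fintype.card (SimpleGraph (Fin n)) := by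
    have h1 : N * (9 * (S.card * N)) ≤ N * (6 * (Fintype.card (SimpleGraph (Fin n)) : ℝ)) := by
      nlinarith
    have h2 := le_of_mul_le_mul_left h1 hNpos
    have h3 : (0 : ℝ) ≤ Fintype.card (SimpleGraph (Fin n)) := Nat.cast_nonneg _
    linarith
  exact_mod_cast this

variable (hK : ∀ v ∈ K, (⟨0, by omega⟩ : Fin n) ∈ K)
include hK

/-- Up to an error of at most `1 / N`, the extracted bits of a graph with a fixed planted set are
uniformly distributed and independent of the induced subgraph on the first vertices. -/
lemma abs_expect_sub_le {m : ℕ} (hmn : m ≤ n) (hm : m ≤ 7 * N)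
    (h : SimpleGraph (Fin m) → (Fin (N * N) → Bool) → ℝ) (h0 : ∀ G w, 0 ≤ h G w)
    (h1 : ∀ G w, h G w ≤ 1) :
    |(𝔼 G₀, h ((G₀ ⊔ cliqueOn K).comap (Fin.castLE hmn))
        (fun a => graphBits N (G₀ ⊔ cliqueOn K) a)) -
      𝔼 G₀ : SimpleGraph (Fin n), 𝔼 w, h ((G₀ ⊔ cliqueOn K).comap (Fin.castLE hmn)) w| ≤ 1 / N := by
  set F : SimpleGraph (Fin n) → ℝ := fun G₀ => h ((G₀ ⊔ cliqueOn K).comap (Fin.castLE hmn))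
        (fun a => graphBits N (G₀ ⊔ cliqueOn K) a) with hF
  set F' : SimpleGraph (Fin n) → ℝ :=
    fun G₀ => 𝔼 w, h ((G₀ ⊔ cliqueOn K).comap (Fin.castLE hmn)) w with hF'
  have hF1 : ∀ G, |F G - F' G| ≤ 1 := by
    intro G
    have h2 : 0 ≤ F' G := Finset.expect_nonneg fun w _ => h0 _ _
    have h3 : F' G ≤ 1 := Finset.expect_le Finset.univ_nonempty fun w _ => h1 _ _
    have h4 := h0 ((G ⊔ cliqueOn K).comap (Fin.castLE hmn)) fun a => graphBits N (G ⊔ cliqueOn K) a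
    have h5 := h1 ((G ⊔ cliqueOn K).comap (Fin.castLE hmn)) fun a => graphBits N (G ⊔ cliqueOn K) a
    rw [abs_le]
    constructor <;> simp only [hF] <;> linarith
  have hgood := sum_good hn hN K hK hmn hm h
  have hsplit : ∑ G, F G - ∑ G, F' G =
      ∑ G₀ with ¬N ≤ (goodRows N (G₀ ⊔ cliqueOn K)).length, (F G₀ - F' G₀) := by
    rw [← Finset.sum_filter_add_sum_filter_not univ
      (fun G₀ => N ≤ (goodRows N (G₀ ⊔ cliqueOn K)).length) F,
      ← Finset.sum_filter_add_sum_filter_not univ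
      (fun G₀ => N ≤ (goodRows N (G₀ ⊔ cliqueOn K)).length) F', hgood, Finset.sum_sub_distrib]
    ring
  have hbad := card_bad hn hN K hcard
  have hΓ : (0 : ℝ) < Fintype.card (SimpleGraph (Fin n)) := by exact_mod_cast Fintype.card_pos
  have hNpos : (0 : ℝ) < N := by exact_mod_cast hN
  rw [Fintype.expect_eq_sum_div_card, Fintype.expect_eq_sum_div_card, ← sub_div, hsplit, abs_div,
    abs_of_pos hΓ, div_le_div_iff₀ hΓ hNpos, one_mul]
  calc |∑ G₀ with ¬N ≤ (goodRows N (G₀ ⊔ cliqueOn K)).length, (F G₀ - F' G₀)| * N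
      ≤ (∑ G₀ with ¬N ≤ (goodRows N (G₀ ⊔ cliqueOn K)).length, |F G₀ - F' G₀|) * N := by
        gcongr
        exact Finset.abs_sum_le_sum_abs _ _
    _ ≤ (∑ G₀ with ¬N ≤ (goodRows N (G₀ ⊔ cliqueOn K)).length, (1 : ℝ)) * N := by
        gcongr with G _
        exact hF1 G
    _ ≤ _ := by
        rw [Finset.sum_const, nsmul_eq_mul, mul_one]
        exact_mod_cast hbad

end

/-! ### Comparison of the success sums -/

instance (ℓ k : ℕ) : IsFiniteMeasure (cliqueLeakage ℓ k) := by
  unfold cliqueLeakage cliqueLeakagePair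
  infer_instance

lemma Machine.UsesAtMost.mono {M : Machine} {x : List Bool} {m m' : ℕ} (h : M.UsesAtMost x m)
    (hm : m ≤ m') : M.UsesAtMost x m' := fun ro ma t κ next ha => (h ro ma t κ next ha).trans_le hm

lemma sup_cliqueOn_empty {n : ℕ} (G : SimpleGraph (Fin n)) : G ⊔ cliqueOn ∅ = G := by
  ext u v
  simp [cliqueOn]

section

variable {M S : Machine} {ℓ k y : ℕ} (hℓ : 8 ≤ ℓ) (hk : 0 < k) (hy0 : 0 < y) (hyk : y ≤ k)
  (hy : ℓ * y ≤ ℓ * (8 * k))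
  (hM : ∀ (G : SimpleGraph (Fin (ℓ * (8 * k)))) ro ma b,
    M.Outputs (encodeInstance (8 * k) G) ro ma b ↔
    S.Outputs (encodeInstance y (G.comap (Fin.castLE hy))) ro (graphBits (ℓ * k) G) b)
  (hS : ∀ G : SimpleGraph (Fin (ℓ * y)), S.UsesAtMost (encodeInstance y G) ((ℓ * k).choose 2))

include hS in
lemma usesAtMost_mul_self (G : SimpleGraph (Fin (ℓ * y))) :
    S.UsesAtMost (encodeInstance y G) (ℓ * k * (ℓ * k)) := by
  refine (hS G).mono ?_
  rw [Nat.choose_two_right]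
  exact (Nat.div_le_self _ _).trans (Nat.mul_le_mul_left _ (Nat.sub_le _ _))

include hM hS in
lemma outputProb_simulation (μ : Measure (SimpleGraph (Fin (ℓ * (8 * k))))) [IsFiniteMeasure μ]
    (b : Bool) : outputProb M (8 * k) μ b = ∑ G, μ.real {G} *
      prefixProb S (encodeInstance y (G.comap (Fin.castLE hy))) b
        (fun a : Fin (ℓ * k * (ℓ * k)) => graphBits (ℓ * k) G a) := by
  rw [outputProb_eq_sum]
  refine Finset.sum_congr rfl fun G _ => ?_
  simp_rw [hM]
  rw [coins_prod_real_fst fun ro => S.Outputs (encodeInstance y (G.comap (Fin.castLE hy))) ro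
    (graphBits (ℓ * k) G) b, prefixProb]
  congr 3
  ext ro
  refine Machine.outputs_congr_of_usesAtMost (usesAtMost_mul_self hS _) ro (fun a ha => ?_) b
  rw [extendBits, dif_pos ha]

include hS in
lemma outputProb_original (μ : Measure (SimpleGraph (Fin (ℓ * y)))) [IsFiniteMeasure μ] (b : Bool) :
    outputProb S y μ b = ∑ G, μ.real {G} *
      𝔼 w : Fin (ℓ * k * (ℓ * k)) → Bool, prefixProb S (encodeInstance y G) b w := by
  rw [outputProb_eq_sum]
  refine Finset.sum_congr rfl fun G _ => ?_
  rw [coins_prod_real_of_usesAtMost (usesAtMost_mul_self hS G)]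

include hℓ hk hyk

/-- For a fixed planted set, replacing the extracted bits by true random bits, and the induced
subgraph of the larger planted graph by a planted graph on the first vertices, changes the output
probability by at most `1 / ℓ`. -/
lemma abs_expect_planted_sub_le (K : Finset (Fin (ℓ * (8 * k)))) (hcard : K.card ≤ ℓ * k)
    (hK : ∀ v ∈ K, (⟨0, by positivity⟩ : Fin (ℓ * (8 * k))) ∈ K) (b : Bool) :
    |(𝔼 G, prefixProb S (encodeInstance y ((G ⊔ cliqueOn K).comap (Fin.castLE hy))) b
        (fun a : Fin (ℓ * k * (ℓ * k)) => graphBits (ℓ * k) (G ⊔ cliqueOn K) a)) -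
      𝔼 G, 𝔼 w : Fin (ℓ * k * (ℓ * k)) → Bool,
        prefixProb S (encodeInstance y (G ⊔ cliqueOn (restrictSet hy K))) b w| ≤ 1 / ℓ := by
  have hn : ℓ * (8 * k) = 8 * (ℓ * k) := by ring
  have hN : 0 < ℓ * k := by positivity
  have hm : ℓ * y ≤ 7 * (ℓ * k) := by
    have := Nat.mul_le_mul_left ℓ hyk
    omega
  have h := abs_expect_sub_le hn hN K hcard hK hy hm
    (fun G w => prefixProb S (encodeInstance y G) b w) (fun _ _ => prefixProb_nonneg _ _ _ _)
    (fun _ _ => prefixProb_le_one _ _ _ _)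
  have h2 : 𝔼 G₀ : SimpleGraph (Fin (ℓ * (8 * k))), 𝔼 w : Fin (ℓ * k * (ℓ * k)) → Bool,
      prefixProb S (encodeInstance y ((G₀ ⊔ cliqueOn K).comap (Fin.castLE hy))) b w =
      𝔼 G, 𝔼 w : Fin (ℓ * k * (ℓ * k)) → Bool,
        prefixProb S (encodeInstance y (G ⊔ cliqueOn (restrictSet hy K))) b w := by
    simp_rw [comap_sup_cliqueOn]
    exact expect_comap (Fin.castLE_injective hy) fun G => 𝔼 w : Fin (ℓ * k * (ℓ * k)) → Bool,
      prefixProb S (encodeInstance y (G ⊔ cliqueOn (restrictSet hy K))) b w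
  rw [h2] at h
  refine h.trans (one_div_le_one_div_of_le (by positivity) ?_)
  exact_mod_cast Nat.le_mul_of_pos_right ℓ hk

include hM hS

/-- The null distributions; this is the case of an empty planted set. -/
lemma abs_outputProb_null_sub_le (b : Bool) :
    |outputProb M (8 * k) (erdosRenyi (ℓ * (8 * k))) b - outputProb S y (erdosRenyi (ℓ * y)) b| ≤
      1 / ℓ := by
  rw [outputProb_simulation hy hM hS, outputProb_original hS, sum_erdosRenyi, sum_erdosRenyi]
  have := abs_expect_planted_sub_le (S := S) hℓ hk hyk hy ∅ (by simp) (by simp) b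
  simpa only [sup_cliqueOn_empty, show restrictSet hy ∅ = ∅ by simp [restrictSet]] using this

include hy0

/-- The planted distributions: the restriction of a random planted set to the first blocks is again
a random planted set. -/
lemma abs_outputProb_planted_sub_le (b : Bool) :
    |outputProb M (8 * k) (cliqueLeakage ℓ (8 * k)) b - outputProb S y (cliqueLeakage ℓ y) b| ≤
      1 / ℓ := by
  have : NeZero ℓ := ⟨by omega⟩
  have : NeZero y := ⟨by omega⟩
  have : NeZero (8 * k) := ⟨by omega⟩
  rw [outputProb_simulation hy hM hS, outputProb_original hS, sum_cliqueLeakage, sum_cliqueLeakage,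
    ← expect_restrictSet (show y ≤ 8 * k by omega) hy, ← Finset.expect_sub_distrib]
  refine (Finset.abs_expect_le _ _).trans
    (Finset.expect_le ⟨_, sectionSet_mem_plantedSets (f := fun _ => 0) rfl⟩ fun K hK => ?_)
  obtain ⟨h1, -, v, hv, hv0⟩ := mem_plantedSets.1 hK
  refine abs_expect_planted_sub_le (S := S) hℓ hk hyk hy K ?_ (fun _ _ => ?_) b
  · rw [h1]
    exact Nat.mul_le_mul_right k hℓ
  · rwa [show (⟨0, _⟩ : Fin (ℓ * (8 * k))) = v from Fin.ext hv0.symm]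

lemma successSum_le : successSum S ℓ y ≤ successSum M ℓ (8 * k) + 2 / ℓ := by
  have h1 := abs_le.1 (abs_outputProb_null_sub_le hℓ hk hyk hy hM hS false)
  have h2 := abs_le.1 (abs_outputProb_planted_sub_le hℓ hk hy0 hyk hy hM hS true)
  rw [successSum, successSum, show (2 : ℝ) / ℓ = 1 / ℓ + 1 / ℓ by ring]
  linarith [h1.1, h2.1]

end

end ClkPC

end

theorem mainTheorem7 (hconj : ClkPC.ClkPCConjSpace)
    (ℓ k ks : ℕ → ℕ) (hℓ : ClkPC.IsParam ℓ) (hk : ClkPC.IsParam k) (hks : ClkPC.IsParam ks)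
    (hℓ_top : Tendsto ℓ atTop atTop) (hk_small : ClkPC.IsSublinear k ℓ) (hks_le : ∀ j, ks j ≤ k j)
    (hks_comp : ClkPC.ComputableInLogspace (fun j => ℓ j * k j) k ks)
    (S : ClkPC.Machine) (hS : S.IsMultiAccessLogspace)
    (hS_bits : ∀ (j : ℕ) (G : SimpleGraph (Fin (ℓ j * ks j))),
      S.UsesAtMost (ClkPC.encodeInstance (ks j) G) ((ℓ j * k j).choose 2)) :
    ¬ ClkPC.Solves S ℓ ks := by
  rintro ⟨ε, hε, hsolves⟩
  obtain ⟨D, hD, out, hout⟩ := hks_comp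
  obtain ⟨M, hM, hred⟩ := ClkPC.Machine.exists_reduction hD hS out
  have hk8 : ClkPC.IsParam fun j => 8 * k j :=
    ⟨fun i j hij => Nat.mul_le_mul_left 8 (hk.1 hij), fun j => Nat.mul_pos (by norm_num) (hk.2 j)⟩
  have hsmall : ClkPC.IsSublinear (fun j => 8 * k j) ℓ := by
    obtain ⟨δ, hδ, hO⟩ := hk_small
    refine ⟨δ, hδ, ?_⟩
    simp only [Nat.cast_mul]
    exact hO.const_mul_left _
  have hlim := hconj M hM ℓ (fun j => 8 * k j) hℓ hk8 hℓ_top hsmall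
  have hzero : Tendsto (fun j => (2 : ℝ) / (ℓ j : ℝ)) atTop (𝓝 0) :=
    tendsto_const_nhds.div_atTop (tendsto_natCast_atTop_atTop.comp hℓ_top)
  have hsum := hlim.add hzero
  rw [add_zero] at hsum
  have hle : ∀ᶠ j in atTop,
      1 + ε ≤ ClkPC.successSum M (ℓ j) (8 * k j) + (2 : ℝ) / (ℓ j : ℝ) := by
    filter_upwards [hsolves, hℓ_top.eventually_ge_atTop 8] with j hj h8
    have hy : ℓ j * ks j ≤ ℓ j * (8 * k j) :=
      Nat.mul_le_mul_left _ ((hks_le j).trans (Nat.le_mul_of_pos_left _ (by norm_num)))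
    exact hj.trans (ClkPC.successSum_le h8 (hk.2 j) (hks.2 j) (hks_le j) hy
      (hred _ _ _ (hℓ.2 j) (hk.2 j) hy (hout j)) (hS_bits j))
  have := ge_of_tendsto hsum hle
  linarith
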